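/- **Setting.** A regular spectral curve consists of a smooth complex curve $\Sigma$, two (possibly multivalued) functions $x,y$ with meromorphic differentials such that $\mathrm dx$ has a finite, non-empty set $\mathfrak a$ of zeros, all simple, and at each $a\in\mathfrak a$ the function $y$ is holomorphic with $\mathrm dy(a)\neq 0$, and a symmetric bidifferential $\omega_{0,2}$ on $\Sigma\times\Sigma$ whose only singularity is a double pole with biresidue $1$ on the diagonal. Choose local coordinates $\zeta_a$ at $a\in\mathfrak a$ with $\zeta_a(a)=0$ and $x=x(a)+\zeta_a^2$. For a regular local spectral curve, $\Sigma$ is replaced by a finite non-empty disjoint union of formal discs with coordinates $\zeta_a$, $a\in\mathfrak a$, and the expansions below are formal power series. Write $\sigma_a\colon\zeta_a\mapsto-\zeta_a$ and expand at the ramification points $$\theta_a:=\frac{-2}{(y-y\circ\sigma_a)\,\mathrm dx}=\sum_{m\ge0}\theta_{(a,m)}\zeta_a^{2m-2}\,\frac1{\mathrm d\zeta_a},\qquad \frac1{\theta_a}=\sum_{i\ge1}t_{(a,i)}\zeta_a^{2i}\,\mathrm d\zeta_a,\qquad t_{(a,0)}:=0,$$ and let $\phi_{(a,i),(b,j)}$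 be the coefficient of $\zeta_a^{2i}\zeta_b^{2j}$ in the holomorphic part $\frac{\omega_{0,2}}{\mathrm d\zeta_a\mathrm d\zeta_b}-\frac{\delta_{a,b}}{(\zeta_a-\zeta_b)^2}$. Let $\mathfrak A=\mathfrak a\times\mathbb Z_{\ge0}$ and, for $\alpha=(a,i)\in\mathfrak A$, let $e_\alpha=\zeta_a^{2i+1}/(2i+1)!!$ near $a$ (and $0$ near $b\ne a$) and $\xi^\alpha(z)=\operatorname{Res}_{w=a}\bigl(\int_a^w\omega_{0,2}(z,\cdot)\bigr)(2i+1)!!\,\zeta_a(w)^{-2i-2}\mathrm d\zeta_a(w)$. Put, for $\alpha=(a,i)$, $$A_{\alpha,\beta,\gamma}=\operatorname{Res}_{a}\theta_a e_\alpha\,\mathrm de_\beta\,\mathrm de_\gamma,\quad B_{\alpha,\beta}^{\gamma}=\operatorname{Res}_{a}\theta_a e_\alpha\,\mathrm de_\beta\,\xi^\gamma,\quad C_\alpha^{\beta,\gamma}=\operatorname{Res}_{a}\theta_a e_\alpha\,\xi^\beta\xi^\gamma,$$ $$D_\alpha=\delta_{i,0}\Bigl(\tfrac12\theta_{(a,0)}\phi_{(a,0),(a,0)}+\tfrac18\theta_{(a,1)}\Bigr)+\tfrac1{24}\delta_{i,1}\theta_{(a,0)}.$$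 The amplitudes $F_{g;\alpha_1,\dots,\alpha_n}$ ($g\ge0$, $n\ge1$) are determined by $F_{0;\alpha}=F_{0;\alpha,\beta}=0$, $F_{0;\alpha,\beta,\gamma}=A_{\alpha,\beta,\gamma}$, $F_{1;\alpha}=D_\alpha$ and, in all other cases, the recursion $$F_{g;\alpha_1,\dots,\alpha_n}=\sum_{m=2}^n\sum_{\mu\in\mathfrak A}B_{\alpha_1,\alpha_m}^{\mu}F_{g;\mu,\alpha_2,\dots,\widehat{\alpha_m},\dots,\alpha_n}+\frac12\sum_{\mu,\nu\in\mathfrak A}C_{\alpha_1}^{\mu,\nu}\Bigl(F_{g-1;\mu,\nu,\alpha_2,\dots,\alpha_n}+\sum_{\substack{g_1+g_2=g\\I_1\sqcup I_2=\{\alpha_2,\dots,\alpha_n\}}}F_{g_1;\mu,I_1}F_{g_2;\nu,I_2}\Bigr)$$ (with $F_{-1;\dots}=0$; all sums have finitely many non-zero terms). The (local) spectral curve is *bounded* with constants $M_t,\rho_t,M_\theta,\rho>0$ and $M_\phi\ge0$ if for all $(a,i),(b,j)\in\mathfrak A$ $$|t_{(a,i)}|\le\frac{M_t}{\rho_t^{i+1}},\qquad|\theta_{(a,i)}|\le\frac{M_\theta}{\rho^{i+1}},\qquad|\phi_{(a,i),(b,j)}|\le\frac{M_\phi}{\rho^{i+j}}.$$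 In that case put $u=3^{-4/3}\rho$, $Q=2M_\theta\max\{(1+\rho M_\phi)^2,\,1+4\rho M_\phi\}$, and $P(u)=\frac2{5u^2}$ if $u<\frac25$, $P(u)=\frac5{10u-2}$ if $u\ge\frac25$. **Theorem.** There exist functions $S(u)>0$ and $\mathsf S_n(u)>0$ of $u>0$ (and $n$) such that for every regular spectral curve or regular local spectral curve that is bounded with constants as above, all $g\ge0$, $n>0$ with $2g-2+n>0$, and all $\alpha_i=(a_i,k_i)\in\mathfrak A$, $$\bigl|F_{g;\alpha_1,\dots,\alpha_n}\bigr|\prod_{i=1}^n(2k_i+1)!!\le S(u)\Bigl(\frac{2u}{27}\Bigr)^gQ^{2g-2+n}\bigl(|\mathfrak a|P(u)\bigr)^{3g-3+n}\frac{(3g-3+n)!}{g!}$$ and $$\bigl|F_{g;\alpha_1,\dots,\alpha_n}\bigr|\prod_{i=1}^n(2k_i+1)!!\le\mathsf S_n(u)\,\frac{\Gamma(2g-2+n)}{\mathsf A^{2g-2+n}},\qquad\text{where }\ \mathsf A>0,\ \ \mathsf A^{-1}=Q\sqrt{u/2}\,\bigl(|\mathfrak a|P(u)\bigr)^{3/2}.$$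 -/

import Mathlib

/-! ## Local spectral curves, quantum Airy structures and their amplitudes -/

section LocalCurves

open scoped Nat

/-- A regular local spectral curve with ramification points `𝔞`.  On the formal disc at `a`, with
coordinate `ζ_a`, the function `x` is `x(a) + ζ_a ^ 2`, the function `y` is the power series
`y a` in `ζ_a`, and on the product of the discs at `a` and `b`
`ω_{0,2} = (δ_{a,b} / (ζ_a - ζ_b)² + ∑_{m,l} hol a b m l * ζ_a ^ m * ζ_b ^ l) dζ_a dζ_b`. -/
structure LocalSpectralCurve (𝔞 : Type*) where
  y : 𝔞 → PowerSeries ℂ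
  hol : 𝔞 → 𝔞 → ℕ → ℕ → ℂ
  hol_symm : ∀ a b m l, hol a b m l = hol b a l m
  regular : ∀ a, PowerSeries.coeff 1 (y a) ≠ 0

/-- The coefficients `A_{α,β,γ}`, `B_{α,β}^γ` (as `B α β γ`), `C_α^{β,γ}` (as `C α β γ`), `D_α` of
the at most quadratic operators of an Airy structure. -/
structure AiryTensors (I : Type*) where
  A : I → I → I → ℂ
  B : I → I → I → ℂ
  C : I → I → I → ℂ
  D : I → ℂ

/-- The sublist of `l` of the entries whose positions lie in `J`. -/
def pick {I : Type*} (l : List I) (J : Finset (Fin l.length)) : List I :=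
  ((List.finRange l.length).filter (fun i => i ∈ J)).map l.get

theorem length_pick {I : Type*} (l : List I) (J : Finset (Fin l.length)) :
    (pick l J).length = J.card := by
  have h : J = ((List.finRange l.length).filter (fun i => i ∈ J)).toFinset := by
    ext i; simp
  rw [pick, List.length_map]
  conv_rhs => rw [h]
  rw [List.toFinset_card_of_nodup ((List.nodup_finRange _).filter _)]

theorem length_pick_add {I : Type*} (l : List I) (J : Finset (Fin l.length)) :
    (pick l J).length + (pick l Jᶜ).length = l.length := by
  rw [length_pick, length_pick, Finset.card_add_card_compl, Fintype.card_fin]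

/-- The amplitudes `F_{g;α₁,…,αₙ}` of an Airy structure, with `[α₁,…,αₙ]` given as a list.  The
quadratic sum runs over `g₁ + g₂ = g` and over splittings of `α₂,…,αₙ` into the entries with
positions in `J` and the complementary ones; the terms containing a factor `F_{0;α}` or
`F_{0;α,β}`, both zero, are left out.  The value at the empty list plays no role. -/
noncomputable def AiryTensors.amplitude {I : Type*} (T : AiryTensors I) : ℕ → List I → ℂ
  | _, [] => 0
  | 0, [_] => 0
  | 0, [_, _] => 0
  | 0, [α, β, γ] => T.A α β γ
  | 1, [α] => T.D α
  | g, α :: l =>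
    (∑ m : Fin l.length, ∑ᶠ μ : I, T.B α (l.get m) μ * T.amplitude g (μ :: l.eraseIdx m)) +
    (1 / 2) * ∑ᶠ μ : I, ∑ᶠ ν : I, T.C α μ ν *
      ((if _h : 0 < g then T.amplitude (g - 1) (μ :: ν :: l) else 0) +
        ∑ g₁ : Fin (g + 1), ∑ J : Finset (Fin l.length),
          if _h : 1 < 2 * g₁.1 + (pick l J).length ∧ 1 < 2 * (g - g₁.1) + (pick l Jᶜ).length then
            T.amplitude g₁.1 (μ :: pick l J) * T.amplitude (g - g₁.1) (ν :: pick l Jᶜ)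
          else 0)
termination_by g l => 2 * g + l.length
decreasing_by
  · have h1 := List.length_eraseIdx_add_one m.2
    simp only [List.length_cons]
    omega
  · simp only [List.length_cons]
    omega
  · have h1 := length_pick_add l J
    simp only [List.length_cons]
    omega
  · have h1 := length_pick_add l J
    simp only [List.length_cons]
    omega

namespace LocalSpectralCurve

variable {𝔞 : Type*} (L : LocalSpectralCurve 𝔞)

/-- `(y(ζ) - y(σ_a(ζ))) dx / dζ` at `a`, where `σ_a(ζ) = -ζ` and `dx = 2 ζ dζ`. -/
noncomputable def deltaYdx (a : 𝔞) : LaurentSeries ℂ :=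
  ((L.y a - PowerSeries.rescale (-1 : ℂ) (L.y a) : PowerSeries ℂ) : LaurentSeries ℂ) *
    HahnSeries.single (1 : ℤ) (2 : ℂ)

/-- `θ_a dζ`, that is `-2 / ((y(ζ) - y(σ_a(ζ))) dx / dζ)`. -/
noncomputable def Theta (a : 𝔞) : LaurentSeries ℂ := -2 / L.deltaYdx a

/-- The coefficient `θ_{(a,m)}` of `ζ ^ (2 m - 2)` in `θ_a dζ`. -/
noncomputable def theta (a : 𝔞) (m : ℕ) : ℂ := (L.Theta a).coeff (2 * (m : ℤ) - 2)

/-- The coefficient `t_{(a,i)}` of `ζ ^ (2 i)` in `1 / (θ_a dζ)`. -/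
noncomputable def t (a : 𝔞) (i : ℕ) : ℂ := ((L.Theta a)⁻¹).coeff (2 * (i : ℤ))

/-- The coefficient `φ_{(a,i),(b,j)}` of `ζ_a ^ (2 i) ζ_b ^ (2 j)` in `ω_{0,2}`. -/
def phi (α β : 𝔞 × ℕ) : ℂ := L.hol α.1 β.1 (2 * α.2) (2 * β.2)

open Classical in
/-- `ω_{0,2}(z, w) / (dζ_b(z) dζ_a(w))` for `z` in the disc at `b` and `w` in the disc at `a`,
expanded in powers of `ζ_a(w)` with coefficients Laurent series in `ζ_b(z)` (so `w` is closer to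
the centre than `z`: `1 / (z - w)² = ∑ (l + 1) z ^ (-l - 2) w ^ l`). -/
noncomputable def omega02 (b a : 𝔞) : PowerSeries (LaurentSeries ℂ) :=
  PowerSeries.mk fun l =>
    (if b = a then HahnSeries.single (-(l : ℤ) - 2) ((l : ℂ) + 1) else 0) +
      ((PowerSeries.mk fun m => L.hol b a m l : PowerSeries ℂ) : LaurentSeries ℂ)

/-- `∫_a^w ω_{0,2}(z, ·) / dζ_b(z)`, the primitive in `w` that vanishes at the centre `a`. -/
noncomputable def primOmega02 (b a : 𝔞) : PowerSeries (LaurentSeries ℂ) :=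
  PowerSeries.mk fun l =>
    match l with
    | 0 => 0
    | l + 1 => (1 / ((l : ℂ) + 1)) • PowerSeries.coeff l (L.omega02 b a)

/-- The expansion at `b` of `ξ^{(a,i)} / dζ_b`: the residue at `w = a` of the primitive above
times `(2i+1)!! ζ_a(w) ^ (-2i-2) dζ_a(w)`. -/
noncomputable def xi (α : 𝔞 × ℕ) (b : 𝔞) : LaurentSeries ℂ :=
  ((2 * α.2 + 1)‼ : ℂ) • PowerSeries.coeff (2 * α.2 + 1) (L.primOmega02 b α.1)

open Classical in
/-- The function `e_{(a,i)} = ζ_a ^ (2i+1) / (2i+1)!!`, extended by zero to the discs `b ≠ a`. -/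
noncomputable def e (α : 𝔞 × ℕ) (b : 𝔞) : LaurentSeries ℂ :=
  if b = α.1 then HahnSeries.single (2 * (α.2 : ℤ) + 1) (1 / ((2 * α.2 + 1)‼ : ℂ)) else 0

/-- `d e_α / dζ_b` on the disc at `b`. -/
noncomputable def de (α : 𝔞 × ℕ) (b : 𝔞) : LaurentSeries ℂ :=
  LaurentSeries.derivative ℂ (e α b)

/-- The residue of the differential `f dζ`. -/
def residue (f : LaurentSeries ℂ) : ℂ := f.coeff (-1)

/-- The quantum Airy structure of a local spectral curve. -/
noncomputable def tensors : AiryTensors (𝔞 × ℕ) where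
  A α β γ := residue (L.Theta α.1 * e α α.1 * de β α.1 * de γ α.1)
  B α β γ := residue (L.Theta α.1 * e α α.1 * de β α.1 * L.xi γ α.1)
  C α β γ := residue (L.Theta α.1 * e α α.1 * L.xi β α.1 * L.xi γ α.1)
  D α :=
    (if α.2 = 0 then L.theta α.1 0 / 2 * L.phi (α.1, 0) (α.1, 0) + L.theta α.1 1 / 8 else 0) +
      (if α.2 = 1 then L.theta α.1 0 / 24 else 0)

/-- The amplitude `F_{g;α₁,…,αₙ}`. -/
noncomputable def amplitude (g : ℕ) {n : ℕ} (α : Fin n → 𝔞 × ℕ) : ℂ :=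
  L.tensors.amplitude g (List.ofFn α)

/-- The local spectral curve is bounded, with the given constants. -/
structure BoundedBy (Mt ρt Mθ Mφ ρ : ℝ) : Prop where
  Mt_pos : 0 < Mt
  ρt_pos : 0 < ρt
  Mθ_pos : 0 < Mθ
  Mφ_nonneg : 0 ≤ Mφ
  ρ_pos : 0 < ρ
  t_le : ∀ a i, ‖L.t a i‖ ≤ Mt / ρt ^ (i + 1)
  theta_le : ∀ a i, ‖L.theta a i‖ ≤ Mθ / ρ ^ (i + 1)
  phi_le : ∀ a i b j, ‖L.phi (a, i) (b, j)‖ ≤ Mφ / ρ ^ (i + j)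

end LocalSpectralCurve

end LocalCurves

/-! ## Spectral curves -/

section GlobalCurves

open scoped Manifold ContDiff Topology

/-- A differential 1-form on a complex curve; at isolated points (poles) its value is arbitrary. -/
abbrev OneForm (X : Type*) [TopologicalSpace X] [ChartedSpace ℂ X] :=
  (p : X) → TangentSpace 𝓘(ℂ) p →L[ℂ] ℂ

/-- A bidifferential on `X × X`; its value on the diagonal is arbitrary. -/
abbrev Bidifferential (X : Type*) [TopologicalSpace X] [ChartedSpace ℂ X] :=
  (p q : X) → TangentSpace 𝓘(ℂ) p →L[ℂ] TangentSpace 𝓘(ℂ) q →L[ℂ] ℂ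

/-- The coordinate vector field `∂/∂ζ` at the point with coordinate `s`. -/
noncomputable def coordVec {X : Type*} [TopologicalSpace X] [ChartedSpace ℂ X]
    (ζ : OpenPartialHomeomorph X ℂ) (s : ℂ) : TangentSpace 𝓘(ℂ) (ζ.symm s) :=
  mfderiv 𝓘(ℂ) 𝓘(ℂ) ζ.symm s (1 : ℂ)

/-- The coefficient `η / dζ` of a 1-form, as a function of the coordinate. -/
noncomputable def OneForm.coeff {X : Type*} [TopologicalSpace X] [ChartedSpace ℂ X]
    (η : OneForm X) (ζ : OpenPartialHomeomorph X ℂ) (s : ℂ) : ℂ :=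
  η (ζ.symm s) (coordVec ζ s)

/-- The coefficient `w / (dζ dζ')` of a bidifferential, as a function of the two coordinates. -/
noncomputable def Bidifferential.coeff {X : Type*} [TopologicalSpace X] [ChartedSpace ℂ X]
    (w : Bidifferential X) (ζ ζ' : OpenPartialHomeomorph X ℂ) (z : ℂ × ℂ) : ℂ :=
  w (ζ.symm z.1) (ζ'.symm z.2) (coordVec ζ z.1) (coordVec ζ' z.2)

/-- `ζ` is a local holomorphic coordinate around `p`. -/
def IsCoordAt {X : Type*} [TopologicalSpace X] [ChartedSpace ℂ X]
    (ζ : OpenPartialHomeomorph X ℂ) (p : X) : Prop :=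
  ζ ∈ IsManifold.maximalAtlas 𝓘(ℂ) ω X ∧ p ∈ ζ.source

/-- The 1-form is meromorphic. -/
def OneForm.IsMeromorphic {X : Type*} [TopologicalSpace X] [ChartedSpace ℂ X]
    (η : OneForm X) : Prop :=
  ∀ p ζ, IsCoordAt ζ p → MeromorphicAt (η.coeff ζ) (ζ p)

/-- The 1-form has order `n` at `p`. -/
def OneForm.HasOrder {X : Type*} [TopologicalSpace X] [ChartedSpace ℂ X]
    (η : OneForm X) (p : X) (n : WithTop ℤ) : Prop :=
  ∀ ζ, IsCoordAt ζ p → meromorphicOrderAt (η.coeff ζ) (ζ p) = n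

/-- The zeros of a meromorphic 1-form. -/
def OneForm.zeros {X : Type*} [TopologicalSpace X] [ChartedSpace ℂ X]
    (η : OneForm X) : Set X :=
  {p | ∃ n : WithTop ℤ, 0 < n ∧ η.HasOrder p n}

/-- A regular spectral curve `(X, x, y, ω_{0,2})`.  The functions `x` and `y`, which may be
multi-valued and singular at isolated points, enter through the meromorphic forms `dx`, `dy`;
so `y` is holomorphic at `a` with `dy(a) ≠ 0` if and only if `dy` has order `0` at `a`. -/
structure SpectralCurve (X : Type*) [TopologicalSpace X] [ChartedSpace ℂ X]
    [IsManifold 𝓘(ℂ) ω X] where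
  dx : OneForm X
  dy : OneForm X
  omega02 : Bidifferential X
  dx_mero : dx.IsMeromorphic
  dy_mero : dy.IsMeromorphic
  finite_zeros : dx.zeros.Finite
  simple_zeros : ∀ a ∈ dx.zeros, dx.HasOrder a 1
  regular : ∀ a ∈ dx.zeros, dy.HasOrder a 0
  omega02_symm : ∀ p q v w, omega02 p q v w = omega02 q p w v
  /-- `ω_{0,2}` is holomorphic away from the diagonal -/
  omega02_holo : ∀ p q, p ≠ q → ∀ ζ ζ', IsCoordAt ζ p → IsCoordAt ζ' q →
    AnalyticAt ℂ (omega02.coeff ζ ζ') (ζ p, ζ' q)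
  /-- `ω_{0,2}` has a double pole with biresidue 1 (and no other singularity) on the diagonal -/
  omega02_diag : ∀ p ζ, IsCoordAt ζ p → ∃ h : ℂ × ℂ → ℂ, AnalyticAt ℂ h (ζ p, ζ p) ∧
    ∀ᶠ z in 𝓝 (ζ p, ζ p), z.1 ≠ z.2 → omega02.coeff ζ ζ z = 1 / (z.1 - z.2) ^ 2 + h z

/-- The coefficient of `s ^ m * t ^ l` in the Taylor series of `h (s, t)` at the origin. -/
noncomputable def taylorCoeff₂ (h : ℂ × ℂ → ℂ) (m l : ℕ) : ℂ :=
  iteratedFDeriv ℂ (m + l) h (0, 0)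
    (Fin.append (fun _ : Fin m => ((1 : ℂ), (0 : ℂ))) (fun _ : Fin l => ((0 : ℂ), (1 : ℂ)))) /
      (m.factorial * l.factorial)

theorem iteratedFDeriv_reindex {h : ℂ × ℂ → ℂ} {x : ℂ × ℂ} (hh : AnalyticAt ℂ h x) {n n' : ℕ}
    (e : n = n') (σ : Fin n ≃ Fin n') (v : Fin n' → ℂ × ℂ) :
    iteratedFDeriv ℂ n h x (v ∘ σ) = iteratedFDeriv ℂ n' h x v := by
  subst e
  exact (hh.contDiffAt (n := ω)).iteratedFDeriv_comp_perm v σ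

theorem taylorCoeff₂_swap {h k : ℂ × ℂ → ℂ} (hk : AnalyticAt ℂ k (0, 0))
    (e : h =ᶠ[𝓝 (0, 0)] k ∘ Prod.swap) (m l : ℕ) :
    taylorCoeff₂ h m l = taylorCoeff₂ k l m := by
  have e1 : h =ᶠ[𝓝 ((0 : ℂ), (0 : ℂ))] k ∘ (ContinuousLinearEquiv.prodComm ℂ ℂ ℂ) := e
  have e2 : iteratedFDeriv ℂ (m + l) (k ∘ (ContinuousLinearEquiv.prodComm ℂ ℂ ℂ)) (0, 0) =
      (iteratedFDeriv ℂ (m + l) k (0, 0)).compContinuousLinearMap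
        fun _ => ((ContinuousLinearEquiv.prodComm ℂ ℂ ℂ : (ℂ × ℂ) ≃L[ℂ] ℂ × ℂ) :
          ℂ × ℂ →L[ℂ] ℂ × ℂ) := by
    simpa [← iteratedFDerivWithin_univ] using
      (ContinuousLinearEquiv.prodComm ℂ ℂ ℂ).iteratedFDerivWithin_comp_right k uniqueDiffOn_univ
        (x := (0, 0)) (Set.mem_univ _) (m + l)
  rw [taylorCoeff₂, taylorCoeff₂, (e1.iteratedFDeriv ℂ (m + l)).eq_of_nhds, e2,
    mul_comm (m.factorial : ℂ)]
  congr 1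
  rw [← iteratedFDeriv_reindex hk (Nat.add_comm m l) finAddFlip]
  simp only [ContinuousMultilinearMap.compContinuousLinearMap_apply]
  congr 1
  funext i
  refine Fin.addCases (fun i => ?_) (fun i => ?_) i <;> simp

namespace SpectralCurve

variable {X : Type*} [TopologicalSpace X] [ChartedSpace ℂ X] [IsManifold 𝓘(ℂ) ω X]
  (S : SpectralCurve X)

/-- The set `𝔞` of ramification points. -/
def ramification : Set X := S.dx.zeros

/-- Local coordinates `ζ_a` at the ramification points with `ζ_a(a) = 0` and
`x = x(a) + ζ_a ^ 2`, that is `dx = 2 ζ_a dζ_a`. -/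
structure Coordinates where
  ζ : S.ramification → OpenPartialHomeomorph X ℂ
  isCoordAt : ∀ a, IsCoordAt (ζ a) (a : X)
  ζ_zero : ∀ a, ζ a a = 0
  dx_eq : ∀ a, ∀ᶠ s in 𝓝[≠] (0 : ℂ), S.dx.coeff (ζ a) s = 2 * s

variable {S} (c : S.Coordinates)

namespace Coordinates

open Classical in
theorem exists_holPart (a b : S.ramification) : ∃ h : ℂ × ℂ → ℂ, AnalyticAt ℂ h (0, 0) ∧
    ∀ᶠ z in 𝓝 ((0 : ℂ), (0 : ℂ)), z.1 ≠ z.2 → S.omega02.coeff (c.ζ a) (c.ζ b) z =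
      (if a = b then 1 / (z.1 - z.2) ^ 2 else 0) + h z := by
  by_cases hab : a = b
  · subst hab
    have := S.omega02_diag a (c.ζ a) (c.isCoordAt a)
    simpa [c.ζ_zero] using this
  · refine ⟨S.omega02.coeff (c.ζ a) (c.ζ b), ?_, Filter.Eventually.of_forall fun z _ => ?_⟩
    · have := S.omega02_holo a b (fun h => hab (Subtype.ext h)) _ _ (c.isCoordAt a) (c.isCoordAt b)
      rw [c.ζ_zero, c.ζ_zero] at this
      exact this
    · simp [hab]

/-- The holomorphic part `ω_{0,2} / (dζ_a dζ_b) - δ_{a,b} / (ζ_a - ζ_b)²`, near the origin. -/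
noncomputable def holPart (a b : S.ramification) : ℂ × ℂ → ℂ :=
  Classical.choose (c.exists_holPart a b)

theorem analyticAt_holPart (a b : S.ramification) : AnalyticAt ℂ (c.holPart a b) (0, 0) :=
  (Classical.choose_spec (c.exists_holPart a b)).1

theorem holPart_swap (a b : S.ramification) :
    c.holPart a b =ᶠ[𝓝 (0, 0)] c.holPart b a ∘ Prod.swap := by
  have h1 := (Classical.choose_spec (c.exists_holPart a b)).2
  have h2 := (Classical.choose_spec (c.exists_holPart b a)).2
  have hs : Filter.Tendsto (Prod.swap : ℂ × ℂ → ℂ × ℂ) (𝓝 (0, 0)) (𝓝 (0, 0)) :=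
    continuous_swap.tendsto' _ _ rfl
  have c1 := (c.analyticAt_holPart a b).eventually_analyticAt
  have c2 := hs.eventually (c.analyticAt_holPart b a).eventually_analyticAt
  have key : ∀ᶠ z in 𝓝 ((0 : ℂ), (0 : ℂ)),
      z.1 ≠ z.2 → c.holPart a b z = c.holPart b a z.swap := by
    filter_upwards [h1, hs.eventually h2] with z h1 h2 hz
    have h1 := h1 hz
    have h2 := h2 (by simpa using hz.symm)
    have h3 : S.omega02.coeff (c.ζ a) (c.ζ b) z = S.omega02.coeff (c.ζ b) (c.ζ a) z.swap :=
      S.omega02_symm _ _ _ _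
    rw [h1, h2] at h3
    have h4 : (z.swap.1 - z.swap.2) ^ 2 = (z.1 - z.2) ^ 2 := by simp; ring
    rw [h4] at h3
    by_cases hab : a = b
    · subst hab
      simpa [holPart] using h3
    · simpa [holPart, hab, Ne.symm hab] using h3
  filter_upwards [c1, c2, key.eventually_nhds] with z c1 c2 hz
  refine tendsto_nhds_unique_of_frequently_eq (f := c.holPart a b)
    (g := c.holPart b a ∘ Prod.swap) (l := 𝓝 z) c1.continuousAt.tendsto
    (c2.continuousAt.tendsto.comp continuous_swap.continuousAt.tendsto) ?_
  have hd : ∃ᶠ z' in 𝓝 z, z'.1 ≠ z'.2 := by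
    intro hcon
    have ht : Filter.Tendsto (fun s : ℂ => (s, z.2)) (𝓝[≠] z.1) (𝓝 z) :=
      Filter.Tendsto.mono_left (Continuous.tendsto' (by fun_prop) _ _ rfl) nhdsWithin_le_nhds
    have ht' : Filter.Tendsto (fun s : ℂ => (z.1, s)) (𝓝[≠] z.2) (𝓝 z) :=
      Filter.Tendsto.mono_left (Continuous.tendsto' (by fun_prop) _ _ rfl) nhdsWithin_le_nhds
    have hz' : z.1 = z.2 := by simpa using hcon.self_of_nhds
    obtain ⟨s, h5, h6⟩ := ((ht.eventually hcon).and self_mem_nhdsWithin).exists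
    simp only [ne_eq, not_not] at h5
    exact h6 (by simp [h5, hz'])
  exact (hd.and_eventually hz).mono fun z' h => h.2 h.1

/-- The local spectral curve formed by the expansions of `x`, `y`, `ω_{0,2}` at the ramification
points in the coordinates `ζ_a`.  The primitive `y` of `dy` at `a` is normalised by `y(a) = 0`;
`toMeromorphicNFAt` only removes the arbitrary value of `dy / dζ_a` at the single point `a`. -/
noncomputable def toLocal : LocalSpectralCurve S.ramification where
  y a := PowerSeries.mk fun n =>
    match n with
    | 0 => 0
    | n + 1 => iteratedDeriv n (toMeromorphicNFAt (S.dy.coeff (c.ζ a)) 0) 0 / (n + 1).factorial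
  hol a b m l := taylorCoeff₂ (c.holPart a b) m l
  hol_symm a b m l := taylorCoeff₂_swap (c.analyticAt_holPart b a) (c.holPart_swap a b) m l
  regular a := by
    have hm : MeromorphicAt (S.dy.coeff (c.ζ a)) 0 := by
      have := S.dy_mero a (c.ζ a) (c.isCoordAt a)
      rwa [c.ζ_zero] at this
    have ho : meromorphicOrderAt (S.dy.coeff (c.ζ a)) 0 = 0 := by
      have := S.regular a a.2 (c.ζ a) (c.isCoordAt a)
      rwa [c.ζ_zero] at this
    have hn := (meromorphicNFAt_toMeromorphicNFAt (f := S.dy.coeff (c.ζ a))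
      (x := 0)).meromorphicOrderAt_eq_zero_iff.1 (by rwa [hm.meromorphicOrderAt_toMeromorphicNFAt])
    simpa using hn

end Coordinates

end SpectralCurve

end GlobalCurves

/-! ## The constants in the bounds -/

/-- `u = 3^{-4/3} ρ` -/
noncomputable def constU (ρ : ℝ) : ℝ := (3 : ℝ) ^ (-(4 / 3) : ℝ) * ρ

/-- `Q = 2 M_θ max {(1 + ρ M_φ)², 1 + 4 ρ M_φ}` -/
noncomputable def constQ (Mθ Mφ ρ : ℝ) : ℝ := 2 * Mθ * max ((1 + ρ * Mφ) ^ 2) (1 + 4 * ρ * Mφ)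

/-- The function `P(u)`. -/
noncomputable def constP (u : ℝ) : ℝ := if u < 2 / 5 then 2 / (5 * u ^ 2) else 5 / (10 * u - 2)

/-- The constant `A`, with `A⁻¹ = Q √(u/2) (N P(u))^{3/2}`, for `N` ramification points. -/
noncomputable def constA (N : ℕ) (Mθ Mφ ρ : ℝ) : ℝ :=
  (constQ Mθ Mφ ρ * Real.sqrt (constU ρ / 2) *
    ((N : ℝ) * constP (constU ρ)) ^ (3 / 2 : ℝ))⁻¹

open scoped Nat

namespace LocalSpectralCurve

variable {𝔞 : Type*} (L : LocalSpectralCurve 𝔞)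

theorem exists_Theta_eq (a : 𝔞) : ∃ τ : PowerSeries ℂ,
    L.Theta a = HahnSeries.single (-2 : ℤ) (1 : ℂ) * (τ : LaurentSeries ℂ) ∧
      ∀ n, Odd n → PowerSeries.coeff n τ = 0 := by
  set D : PowerSeries ℂ := L.y a - PowerSeries.rescale (-1 : ℂ) (L.y a) with hD
  have hDc : ∀ n, PowerSeries.coeff n D = (1 - (-1) ^ n) * PowerSeries.coeff n (L.y a) := by
    intro n; simp [hD, PowerSeries.coeff_rescale]; ring
  set G : PowerSeries ℂ := PowerSeries.mk fun n => PowerSeries.coeff (n + 1) D with hG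
  have hDG : D = PowerSeries.X * G := by
    ext n
    cases n with
    | zero => simp [hDc]
    | succ n => rw [PowerSeries.coeff_succ_X_mul]; simp [hG]
  have hG0 : PowerSeries.constantCoeff G ≠ 0 := by
    rw [← PowerSeries.coeff_zero_eq_constantCoeff_apply]
    simp only [hG, PowerSeries.coeff_mk, hDc]
    have := L.regular a
    norm_num
    exact this
  have hinv : G * G⁻¹ = 1 := PowerSeries.mul_inv_cancel G hG0
  have hres : PowerSeries.rescale (-1 : ℂ) G = G := by
    ext n
    simp only [hG, PowerSeries.coeff_rescale, PowerSeries.coeff_mk, hDc]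
    rcases Nat.even_or_odd n with h | h
    · simp [h.neg_one_pow]
    · simp [h.neg_one_pow, pow_succ]
  have hres' : PowerSeries.rescale (-1 : ℂ) G⁻¹ = G⁻¹ := by
    have h := congrArg (PowerSeries.rescale (-1 : ℂ)) hinv
    rw [map_mul, hres, map_one] at h
    calc PowerSeries.rescale (-1 : ℂ) G⁻¹ = (G⁻¹ * G) * PowerSeries.rescale (-1 : ℂ) G⁻¹ := by
          rw [mul_comm G⁻¹ G, hinv, one_mul]
      _ = G⁻¹ := by rw [mul_assoc, h, mul_one]
  refine ⟨-G⁻¹, ?_, ?_⟩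
  · have hX : ((PowerSeries.X : PowerSeries ℂ) : LaurentSeries ℂ) = HahnSeries.single 1 1 :=
      PowerSeries.coe_X
    have hd : L.deltaYdx a = HahnSeries.single (2 : ℤ) (2 : ℂ) * (G : LaurentSeries ℂ) := by
      rw [deltaYdx, ← hD, hDG, PowerSeries.coe_mul, hX, mul_assoc, mul_comm (G : LaurentSeries ℂ),
        ← mul_assoc, HahnSeries.single_mul_single]
      norm_num
    have hGG : (G : LaurentSeries ℂ) * ((G⁻¹ : PowerSeries ℂ) : LaurentSeries ℂ) = 1 := by
      rw [← PowerSeries.coe_mul, hinv, PowerSeries.coe_one]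
    have h2 : (-2 : LaurentSeries ℂ) = HahnSeries.single (0 : ℤ) (-2 : ℂ) := by
      have : HahnSeries.single (0 : ℤ) (-2 : ℂ) = HahnSeries.C (-2 : ℂ) := rfl
      rw [this, map_neg, map_ofNat]
    have hne : L.deltaYdx a ≠ 0 := by
      rw [hd]
      refine mul_ne_zero ?_ (left_ne_zero_of_mul_eq_one hGG)
      simp
    rw [Theta, div_eq_iff hne, hd, PowerSeries.coe_neg]
    have : HahnSeries.single (-2 : ℤ) (1 : ℂ) * -((G⁻¹ : PowerSeries ℂ) : LaurentSeries ℂ) *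
        (HahnSeries.single (2 : ℤ) (2 : ℂ) * (G : LaurentSeries ℂ)) =
        -(HahnSeries.single (-2 : ℤ) (1 : ℂ) * HahnSeries.single (2 : ℤ) (2 : ℂ)) *
          ((G : LaurentSeries ℂ) * ((G⁻¹ : PowerSeries ℂ) : LaurentSeries ℂ)) := by ring
    rw [this, hGG, mul_one, HahnSeries.single_mul_single, h2]
    norm_num
  · intro n hn
    have h := congrArg (PowerSeries.coeff n) hres'
    rw [PowerSeries.coeff_rescale, hn.neg_one_pow] at h
    have : PowerSeries.coeff n G⁻¹ = 0 := by
      have h' : (2 : ℂ) * PowerSeries.coeff n G⁻¹ = 0 := by linear_combination -h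
      simpa using h'
    simp [this]

/-- The power series `τ` with `θ_a dζ = ζ ^ (-2) τ`. -/
noncomputable def thetaSeries (a : 𝔞) : PowerSeries ℂ := Classical.choose (L.exists_Theta_eq a)

theorem Theta_eq (a : 𝔞) : L.Theta a =
    HahnSeries.single (-2 : ℤ) (1 : ℂ) * (L.thetaSeries a : LaurentSeries ℂ) :=
  (Classical.choose_spec (L.exists_Theta_eq a)).1

theorem coeff_thetaSeries_odd (a : 𝔞) {n : ℕ} (hn : Odd n) :
    PowerSeries.coeff n (L.thetaSeries a) = 0 :=
  (Classical.choose_spec (L.exists_Theta_eq a)).2 n hn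

theorem coeff_thetaSeries (a : 𝔞) (m : ℕ) :
    PowerSeries.coeff (2 * m) (L.thetaSeries a) = L.theta a m := by
  rw [theta, Theta_eq, HahnSeries.coeff_single_mul, one_mul, PowerSeries.coeff_coe]
  have h : (2 * (m : ℤ) - 2 - -2) = ((2 * m : ℕ) : ℤ) := by push_cast; ring
  rw [h, if_neg (by omega), Int.natAbs_natCast]

/-- The residue of `θ_a ζ ^ p h`, for a power series `h`. -/
theorem residue_Theta_mul (a : 𝔞) (p : ℤ) (c : ℂ) (h : PowerSeries ℂ) :
    residue (L.Theta a * HahnSeries.single p c * (h : LaurentSeries ℂ)) =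
      if p ≤ 1 then c * PowerSeries.coeff (1 - p).toNat (L.thetaSeries a * h) else 0 := by
  have : L.Theta a * HahnSeries.single p c * (h : LaurentSeries ℂ) =
      HahnSeries.single (p - 2) c * ((L.thetaSeries a * h : PowerSeries ℂ) : LaurentSeries ℂ) := by
    rw [Theta_eq, PowerSeries.coe_mul]
    have h1 : HahnSeries.single (p - 2) c =
        HahnSeries.single (-2 : ℤ) (1 : ℂ) * HahnSeries.single p c := by
      rw [HahnSeries.single_mul_single, one_mul, show p - 2 = -2 + p by ring]
    rw [h1]; ring
  rw [residue, this, HahnSeries.coeff_single_mul, PowerSeries.coeff_coe]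
  have h2 : (-1 - (p - 2)) = 1 - p := by ring
  rw [h2]
  by_cases hp : p ≤ 1
  · rw [if_pos hp, if_neg (by omega)]
    congr 3
    omega
  · rw [if_neg hp, if_pos (by omega), mul_zero]

theorem e_self (a : 𝔞) (i : ℕ) : e (a, i) a =
    HahnSeries.single (2 * (i : ℤ) + 1) (1 / ((2 * i + 1)‼ : ℂ)) := by
  simp [e]

theorem de_self (a : 𝔞) (i : ℕ) : de (a, i) a =
    HahnSeries.single (2 * (i : ℤ)) ((2 * i + 1) / ((2 * i + 1)‼ : ℂ)) := by
  rw [de, e_self, LaurentSeries.derivative_apply, LaurentSeries.hasseDeriv_single]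
  have : (2 * (i : ℤ) + 1 - ((1 : ℕ) : ℤ)) = 2 * i := by push_cast; ring
  rw [this, Ring.choose_one_right, zsmul_eq_mul]
  push_cast
  congr 1
  ring

theorem de_of_ne {a : 𝔞} {β : 𝔞 × ℕ} (h : a ≠ β.1) : de β a = 0 := by
  simp [de, e, h]

/-- The holomorphic part of `ξ^{(c,k)}` at `a`, up to normalisation. -/
noncomputable def xiHol (a : 𝔞) (γ : 𝔞 × ℕ) : PowerSeries ℂ :=
  PowerSeries.mk fun m => L.hol a γ.1 m (2 * γ.2)

open Classical in
theorem xi_eq (γ : 𝔞 × ℕ) (a : 𝔞) : L.xi γ a =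
    HahnSeries.C ((2 * γ.2 + 1)‼ : ℂ) *
      ((if a = γ.1 then HahnSeries.single (-(2 * (γ.2 : ℤ)) - 2) 1 else 0) +
        HahnSeries.C (1 / (2 * (γ.2 : ℂ) + 1)) * (L.xiHol a γ : LaurentSeries ℂ)) := by
  have hne : (2 * (γ.2 : ℂ) + 1) ≠ 0 := by exact_mod_cast Nat.succ_ne_zero (2 * γ.2)
  have h1 : PowerSeries.coeff (2 * γ.2 + 1) (L.primOmega02 a γ.1) =
      (1 / (((2 * γ.2 : ℕ) : ℂ) + 1)) • PowerSeries.coeff (2 * γ.2) (L.omega02 a γ.1) := by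
    rw [primOmega02, PowerSeries.coeff_mk]
  rw [xi, h1, omega02, PowerSeries.coeff_mk, ← HahnSeries.C_mul_eq_smul,
    ← HahnSeries.C_mul_eq_smul, mul_add, xiHol]
  push_cast
  congr 2
  split_ifs
  · rw [HahnSeries.C_apply, HahnSeries.single_mul_single]
    simp [hne]
  · simp

theorem residue_add (f g : LaurentSeries ℂ) : residue (f + g) = residue f + residue g := by
  simp [residue]

theorem residue_C_mul (c : ℂ) (f : LaurentSeries ℂ) :
    residue (HahnSeries.C c * f) = c * residue f := by
  simp [residue]

end LocalSpectralCurve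

theorem Finset.sum_range_two_mul_add_one {M : Type*} [AddCommMonoid M] (f : ℕ → M) (m : ℕ) :
    ∑ v ∈ Finset.range (2 * m + 1), f v =
      ∑ p ∈ Finset.range (m + 1), f (2 * p) + ∑ p ∈ Finset.range m, f (2 * p + 1) := by
  induction m with
  | zero => simp
  | succ m ih =>
    rw [show 2 * (m + 1) + 1 = 2 * m + 1 + 1 + 1 by ring, Finset.sum_range_succ,
      Finset.sum_range_succ, ih, Finset.sum_range_succ (fun p => f (2 * p)) (m + 1),
      Finset.sum_range_succ (fun p => f (2 * p + 1)) m, show 2 * m + 1 + 1 = 2 * (m + 1) by ring]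
    abel

namespace LocalSpectralCurve

variable {𝔞 : Type*} (L : LocalSpectralCurve 𝔞)

theorem coeff_thetaSeries_mul (a : 𝔞) (m : ℕ) (h : PowerSeries ℂ) :
    PowerSeries.coeff (2 * m) (L.thetaSeries a * h) =
      ∑ p ∈ Finset.range (m + 1), L.theta a (m - p) * PowerSeries.coeff (2 * p) h := by
  rw [mul_comm (L.thetaSeries a), PowerSeries.coeff_mul, Finset.Nat.sum_antidiagonal_eq_sum_range_succ_mk,
    Nat.succ_eq_add_one, Finset.sum_range_two_mul_add_one]
  rw [Finset.sum_eq_zero (s := Finset.range m), add_zero]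
  · refine Finset.sum_congr rfl fun p _ => ?_
    simp only
    rw [show 2 * m - 2 * p = 2 * (m - p) by omega, coeff_thetaSeries, mul_comm]
  · intro p hp
    have := Finset.mem_range.1 hp
    simp only
    rw [L.coeff_thetaSeries_odd a ⟨m - p - 1, by omega⟩, mul_zero]

theorem residue_Theta_mul_mul (a : 𝔞) (i s : ℕ) (c : ℂ) (h : PowerSeries ℂ) :
    residue (L.Theta a * HahnSeries.single (2 * (i : ℤ) + 1 - 2 * s) c * (h : LaurentSeries ℂ)) =
      if i ≤ s then c * ∑ p ∈ Finset.range (s - i + 1),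
        L.theta a (s - i - p) * PowerSeries.coeff (2 * p) h else 0 := by
  rw [residue_Theta_mul]
  by_cases his : i ≤ s
  · rw [if_pos his, if_pos (by omega),
      show (1 - (2 * (i : ℤ) + 1 - 2 * s)).toNat = 2 * (s - i) by omega, coeff_thetaSeries_mul]
  · rw [if_neg his, if_neg (by omega)]

theorem residue_Theta_mul_one (a : 𝔞) (i s : ℕ) (c : ℂ) :
    residue (L.Theta a * HahnSeries.single (2 * (i : ℤ) + 1 - 2 * s) c) =
      if i ≤ s then c * L.theta a (s - i) else 0 := by
  have h := L.residue_Theta_mul_mul a i s c 1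
  rw [PowerSeries.coe_one, mul_one] at h
  rw [h]
  split_ifs
  · rw [Finset.sum_eq_single_of_mem 0 (by simp)]
    · simp
    · intro p _ hp
      rw [PowerSeries.coeff_one, if_neg (by omega), mul_zero]
  · rfl

theorem coeff_xiHol (a : 𝔞) (γ : 𝔞 × ℕ) (p : ℕ) :
    PowerSeries.coeff (2 * p) (L.xiHol a γ) = L.phi (a, p) γ := by
  simp [xiHol, phi]

theorem tensors_A (a b c : 𝔞) (i j k : ℕ) (h : ¬ (i = 0 ∧ j = 0 ∧ k = 0)) :
    L.tensors.A (a, i) (b, j) (c, k) = 0 := by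
  simp only [tensors]
  by_cases hb : a = b
  · by_cases hc : a = c
    · subst hb hc
      rw [e_self, de_self, de_self, mul_assoc, mul_assoc, HahnSeries.single_mul_single,
        HahnSeries.single_mul_single,
        show (2 * (i : ℤ) + 1 + (2 * j + 2 * k)) =
          2 * ((i + j + k : ℕ) : ℤ) + 1 - 2 * (0 : ℕ) by push_cast; ring, residue_Theta_mul_one,
        if_neg (by omega)]
    · rw [de_of_ne (β := (c, k)) hc]; simp [residue]
  · rw [de_of_ne (β := (b, j)) hb]; simp [residue]

theorem norm_tensors_A_le (a b c : 𝔞) : ‖L.tensors.A (a, 0) (b, 0) (c, 0)‖ ≤ ‖L.theta a 0‖ := by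
  simp only [tensors]
  by_cases hb : a = b
  · by_cases hc : a = c
    · subst hb hc
      rw [e_self, de_self, mul_assoc, mul_assoc, HahnSeries.single_mul_single,
        HahnSeries.single_mul_single,
        show (2 * ((0 : ℕ) : ℤ) + 1 + (2 * ((0 : ℕ) : ℤ) + 2 * ((0 : ℕ) : ℤ))) =
          2 * ((0 : ℕ) : ℤ) + 1 - 2 * (0 : ℕ) by simp, residue_Theta_mul_one]
      simp
    · rw [de_of_ne (β := (c, 0)) hc]; simp [residue]
  · rw [de_of_ne (β := (b, 0)) hb]; simp [residue]

open Classical in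
theorem tensors_B (a b c : 𝔞) (i j k : ℕ) : L.tensors.B (a, i) (b, j) (c, k) =
    if a = b then ((2 * k + 1)‼ : ℂ) * ((2 * j + 1) / ((2 * i + 1)‼ * (2 * j + 1)‼)) *
      ((if a = c ∧ i + j ≤ k + 1 then L.theta a (k + 1 - (i + j)) else 0) +
        (1 / (2 * (k : ℂ) + 1)) * if i + j = 0 then L.theta a 0 * L.phi (a, 0) (c, k) else 0)
    else 0 := by
  simp only [tensors]
  by_cases hb : a = b
  · subst hb
    rw [if_pos rfl, e_self, de_self, xi_eq]
    set κ : ℂ := (2 * j + 1) / ((2 * i + 1)‼ * (2 * j + 1)‼) with hκ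
    have e1 : L.Theta a * HahnSeries.single (2 * (i : ℤ) + 1) (1 / ((2 * i + 1)‼ : ℂ)) *
        HahnSeries.single (2 * (j : ℤ)) ((2 * j + 1) / ((2 * j + 1)‼ : ℂ)) =
        L.Theta a * HahnSeries.single (2 * ((i + j : ℕ) : ℤ) + 1) κ := by
      rw [mul_assoc, HahnSeries.single_mul_single, hκ, div_mul_div_comm, one_mul]
      congr 3
      push_cast; ring
    rw [e1]
    have e2 : ∀ S H : LaurentSeries ℂ, L.Theta a * HahnSeries.single (2 * ((i + j : ℕ) : ℤ) + 1) κ *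
        (HahnSeries.C ((2 * k + 1)‼ : ℂ) * (S + HahnSeries.C (1 / (2 * (k : ℂ) + 1)) * H)) =
        HahnSeries.C ((2 * k + 1)‼ : ℂ) *
          (L.Theta a * HahnSeries.single (2 * ((i + j : ℕ) : ℤ) + 1) κ * S +
          HahnSeries.C (1 / (2 * (k : ℂ) + 1)) *
            (L.Theta a * HahnSeries.single (2 * ((i + j : ℕ) : ℤ) + 1) κ * H)) := by
      intro S H; ring
    have e3 : residue (L.Theta a * HahnSeries.single (2 * ((i + j : ℕ) : ℤ) + 1) κ *
        (L.xiHol a (c, k) : LaurentSeries ℂ)) =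
        κ * if i + j = 0 then L.theta a 0 * L.phi (a, 0) (c, k) else 0 := by
      have := L.residue_Theta_mul_mul a (i + j) 0 κ (L.xiHol a (c, k))
      rw [show (2 * ((i + j : ℕ) : ℤ) + 1 - 2 * (0 : ℕ)) = 2 * ((i + j : ℕ) : ℤ) + 1 by simp] at this
      rw [this]
      by_cases h0 : i + j = 0
      · rw [if_pos (by omega), if_pos h0]
        have := L.coeff_xiHol a (c, k) 0
        rw [mul_zero, PowerSeries.coeff_zero_eq_constantCoeff_apply] at this
        simp [h0, this]
      · rw [if_neg (by omega), if_neg h0, mul_zero]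
    have e4 : residue (L.Theta a * HahnSeries.single (2 * ((i + j : ℕ) : ℤ) + 1) κ *
        (if a = c then HahnSeries.single (-(2 * (k : ℤ)) - 2) 1 else 0)) =
        κ * if a = c ∧ i + j ≤ k + 1 then L.theta a (k + 1 - (i + j)) else 0 := by
      by_cases hc : a = c
      · rw [if_pos hc, mul_assoc, HahnSeries.single_mul_single,
          show (2 * ((i + j : ℕ) : ℤ) + 1 + (-(2 * (k : ℤ)) - 2)) =
            2 * ((i + j : ℕ) : ℤ) + 1 - 2 * (k + 1 : ℕ) by push_cast; ring, residue_Theta_mul_one]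
        simp [hc]
      · simp [hc, residue]
    rw [e2, residue_C_mul, residue_add, residue_C_mul, e3, e4]
    ring
  · rw [if_neg hb, de_of_ne (β := (b, j)) hb]; simp [residue]

open Classical in
theorem tensors_C (a b c : 𝔞) (i j k : ℕ) : L.tensors.C (a, i) (b, j) (c, k) =
    ((2 * j + 1)‼ : ℂ) * ((2 * k + 1)‼ : ℂ) * (1 / ((2 * i + 1)‼ : ℂ)) *
      ((if a = b ∧ a = c ∧ i ≤ j + k + 2 then L.theta a (j + k + 2 - i) else 0) +
        (1 / (2 * (k : ℂ) + 1)) * (if a = b ∧ i ≤ j + 1 then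
          ∑ p ∈ Finset.range (j + 1 - i + 1), L.theta a (j + 1 - i - p) * L.phi (a, p) (c, k)
          else 0) +
        (1 / (2 * (j : ℂ) + 1)) * (if a = c ∧ i ≤ k + 1 then
          ∑ p ∈ Finset.range (k + 1 - i + 1), L.theta a (k + 1 - i - p) * L.phi (a, p) (b, j)
          else 0) +
        (1 / (2 * (j : ℂ) + 1)) * (1 / (2 * (k : ℂ) + 1)) *
          if i = 0 then L.theta a 0 * (L.phi (a, 0) (b, j) * L.phi (a, 0) (c, k)) else 0) := by
  simp only [tensors]
  rw [e_self, xi_eq, xi_eq]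
  set κ : ℂ := 1 / ((2 * i + 1)‼ : ℂ) with hκ
  set E : LaurentSeries ℂ := HahnSeries.single (2 * (i : ℤ) + 1) κ with hE
  have e2 : ∀ S H S' H' : LaurentSeries ℂ, L.Theta a * E *
      (HahnSeries.C ((2 * j + 1)‼ : ℂ) * (S + HahnSeries.C (1 / (2 * (j : ℂ) + 1)) * H)) *
      (HahnSeries.C ((2 * k + 1)‼ : ℂ) * (S' + HahnSeries.C (1 / (2 * (k : ℂ) + 1)) * H')) =
      HahnSeries.C ((2 * j + 1)‼ : ℂ) * (HahnSeries.C ((2 * k + 1)‼ : ℂ) *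
        (L.Theta a * (E * (S * S')) +
        HahnSeries.C (1 / (2 * (k : ℂ) + 1)) * (L.Theta a * (E * S) * H') +
        HahnSeries.C (1 / (2 * (j : ℂ) + 1)) * (L.Theta a * (E * S') * H) +
        HahnSeries.C (1 / (2 * (j : ℂ) + 1)) * (HahnSeries.C (1 / (2 * (k : ℂ) + 1)) *
          (L.Theta a * E * (H * H'))))) := by
    intro S H S' H'; ring
  have e1 : ∀ (b c : 𝔞) (j k : ℕ), residue (L.Theta a *
      (E * (if a = b then HahnSeries.single (-(2 * (j : ℤ)) - 2) 1 else 0)) *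
        (L.xiHol a (c, k) : LaurentSeries ℂ)) =
      κ * if a = b ∧ i ≤ j + 1 then
        ∑ p ∈ Finset.range (j + 1 - i + 1), L.theta a (j + 1 - i - p) * L.phi (a, p) (c, k)
        else 0 := by
    intro b c j k
    by_cases hb : a = b
    · rw [if_pos hb, hE, HahnSeries.single_mul_single, mul_one,
        show (2 * (i : ℤ) + 1 + (-(2 * (j : ℤ)) - 2)) = 2 * (i : ℤ) + 1 - 2 * (j + 1 : ℕ) by
          push_cast; ring, residue_Theta_mul_mul]
      simp only [coeff_xiHol, hb, true_and, mul_ite, mul_zero]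
    · simp [hb, residue]
  have e3 : residue (L.Theta a * (E * ((if a = b then HahnSeries.single (-(2 * (j : ℤ)) - 2) 1
      else 0) * (if a = c then HahnSeries.single (-(2 * (k : ℤ)) - 2) 1 else 0)))) =
      κ * if a = b ∧ a = c ∧ i ≤ j + k + 2 then L.theta a (j + k + 2 - i) else 0 := by
    by_cases hb : a = b
    · by_cases hc : a = c
      · rw [if_pos hb, if_pos hc, hE, HahnSeries.single_mul_single, HahnSeries.single_mul_single,
          mul_one, mul_one,
          show (2 * (i : ℤ) + 1 + (-(2 * (j : ℤ)) - 2 + (-(2 * (k : ℤ)) - 2))) =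
            2 * (i : ℤ) + 1 - 2 * (j + k + 2 : ℕ) by push_cast; ring, residue_Theta_mul_one]
        simp only [← hb, ← hc, true_and, mul_ite, mul_zero]
      · simp [hc, residue]
    · simp [hb, residue]
  have e4 : residue (L.Theta a * E * ((L.xiHol a (b, j) : LaurentSeries ℂ) *
      (L.xiHol a (c, k) : LaurentSeries ℂ))) =
      κ * if i = 0 then L.theta a 0 * (L.phi (a, 0) (b, j) * L.phi (a, 0) (c, k)) else 0 := by
    have := L.residue_Theta_mul_mul a i 0 κ (L.xiHol a (b, j) * L.xiHol a (c, k))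
    rw [show (2 * (i : ℤ) + 1 - 2 * (0 : ℕ)) = 2 * (i : ℤ) + 1 by simp, PowerSeries.coe_mul] at this
    rw [this]
    by_cases h0 : i = 0
    · rw [if_pos (by omega), if_pos h0]
      have h1 := L.coeff_xiHol a (b, j) 0
      have h2 := L.coeff_xiHol a (c, k) 0
      rw [mul_zero, PowerSeries.coeff_zero_eq_constantCoeff_apply] at h1 h2
      simp [h0, h1, h2]
    · rw [if_neg (by omega), if_neg h0, mul_zero]
  rw [e2, residue_C_mul, residue_C_mul, residue_add, residue_add, residue_add, residue_C_mul,
    residue_C_mul, residue_C_mul, residue_C_mul, e3, e4, e1, e1]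
  ring

end LocalSpectralCurve

/-- The weight `(2k+1)!!`. -/
noncomputable def oddFact (k : ℕ) : ℝ := ((2 * k + 1)‼ : ℝ)

theorem oddFact_pos (k : ℕ) : 0 < oddFact k := by
  unfold oddFact; exact_mod_cast Nat.doubleFactorial_pos _

/-- The `(i, j, k)`-dependence of the bound on `C`, with `x = ρ M_φ`. -/
noncomputable def quadWeight (x : ℝ) (i j k : ℕ) : ℝ :=
  (if i ≤ j + k + 2 then 1 else 0) +
    x * (((j + 2 - i : ℕ) : ℝ) / (2 * k + 1) + ((k + 2 - i : ℕ) : ℝ) / (2 * j + 1)) +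
    if i = 0 then x ^ 2 else 0

theorem quadWeight_nonneg {x : ℝ} (hx : 0 ≤ x) (i j k : ℕ) : 0 ≤ quadWeight x i j k := by
  unfold quadWeight
  have h1 : (0 : ℝ) ≤ if i ≤ j + k + 2 then 1 else 0 := by split_ifs <;> norm_num
  have h2 : (0 : ℝ) ≤ if i = 0 then x ^ 2 else 0 := by split_ifs <;> positivity
  positivity

theorem pow_sub_div {ρ : ℝ} (hρ : 0 < ρ) {s m : ℕ} (h : s ≤ m) (M : ℝ) :
    M / ρ ^ (m - s) = M * (ρ ^ s / ρ ^ m) := by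
  have : ρ ^ m = ρ ^ s * ρ ^ (m - s) := by rw [← pow_add]; congr 1; omega
  rw [this]
  field_simp

namespace LocalSpectralCurve

variable {𝔞 : Type*} {L : LocalSpectralCurve 𝔞} {Mt ρt Mθ Mφ ρ : ℝ}

theorem BoundedBy.norm_A_le (hL : L.BoundedBy Mt ρt Mθ Mφ ρ) (α β γ : 𝔞 × ℕ) :
    ‖L.tensors.A α β γ‖ ≤ if α.2 = 0 ∧ β.2 = 0 ∧ γ.2 = 0 then Mθ / ρ else 0 := by
  obtain ⟨a, i⟩ := α; obtain ⟨b, j⟩ := β; obtain ⟨c, k⟩ := γ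
  split_ifs with h
  · obtain ⟨h1, h2, h3⟩ := h
    simp only at h1 h2 h3
    subst h1 h2 h3
    have := hL.theta_le a 0
    rw [zero_add, pow_one] at this
    exact (L.norm_tensors_A_le a b c).trans this
  · rw [L.tensors_A a b c i j k h, norm_zero]

theorem BoundedBy.norm_D_le (hL : L.BoundedBy Mt ρt Mθ Mφ ρ) (α : 𝔞 × ℕ) :
    ‖L.tensors.D α‖ * oddFact α.2 ≤ if α.2 = 0 then Mθ * (1 + 4 * (ρ * Mφ)) / (8 * ρ ^ 2) else
      if α.2 = 1 then Mθ / (8 * ρ) else 0 := by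
  obtain ⟨a, i⟩ := α
  have hρ := hL.ρ_pos
  have h0 := hL.theta_le a 0
  have h1 := hL.theta_le a 1
  have hp := hL.phi_le a 0 a 0
  simp only [tensors]
  rcases i with _ | _ | i
  · simp only [if_true, zero_ne_one, if_false, add_zero]
    have : oddFact 0 = 1 := by simp [oddFact]
    rw [this, mul_one]
    calc ‖L.theta a 0 / 2 * L.phi (a, 0) (a, 0) + L.theta a 1 / 8‖
        ≤ ‖L.theta a 0‖ / 2 * ‖L.phi (a, 0) (a, 0)‖ + ‖L.theta a 1‖ / 8 := by
          refine (norm_add_le _ _).trans ?_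
          simp
      _ ≤ Mθ / ρ ^ (0 + 1) / 2 * (Mφ / ρ ^ (0 + 0)) + Mθ / ρ ^ (1 + 1) / 8 := by
          have := hL.Mθ_pos
          gcongr
      _ = _ := by field_simp; ring
  · have : oddFact 1 = 3 := by simp [oddFact, Nat.doubleFactorial]
    simp only [zero_add, one_ne_zero, if_false, if_true, this]
    rw [norm_div]
    rw [zero_add, pow_one] at h0
    norm_num
    calc ‖L.theta a 0‖ / 24 * 3 ≤ Mθ / ρ / 24 * 3 := by gcongr
      _ = _ := by field_simp; ring
  · simp

theorem BoundedBy.norm_B_le (hL : L.BoundedBy Mt ρt Mθ Mφ ρ) (α β γ : 𝔞 × ℕ) :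
    ‖L.tensors.B α β γ‖ * (oddFact α.2 * oddFact β.2) ≤ oddFact γ.2 * ((2 * β.2 + 1) *
      if α.2 + β.2 ≤ γ.2 + 1 then
        Mθ * (1 + ρ * Mφ) * (ρ ^ (α.2 + β.2) / ρ ^ (γ.2 + 2)) else 0) := by
  classical
  obtain ⟨a, i⟩ := α; obtain ⟨b, j⟩ := β; obtain ⟨c, k⟩ := γ
  have hρ := hL.ρ_pos
  have hθ := hL.Mθ_pos
  have hφ := hL.Mφ_nonneg
  have hi := oddFact_pos i
  have hj := oddFact_pos j
  have hk := oddFact_pos k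
  simp only
  have hR : 0 ≤ if i + j ≤ k + 1 then Mθ * (1 + ρ * Mφ) * (ρ ^ (i + j) / ρ ^ (k + 2)) else 0 := by
    split_ifs <;> positivity
  rw [L.tensors_B]
  by_cases hab : a = b
  swap
  · rw [if_neg hab, norm_zero, zero_mul]; positivity
  rw [if_pos hab, norm_mul, norm_mul, norm_div, norm_mul]
  have e1 : ‖((2 * k + 1)‼ : ℂ)‖ = oddFact k := by simp [oddFact]
  have e2 : ‖((2 * i + 1)‼ : ℂ)‖ = oddFact i := by simp [oddFact]
  have e3 : ‖((2 * j + 1)‼ : ℂ)‖ = oddFact j := by simp [oddFact]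
  have e4 : ‖(2 * (j : ℂ) + 1)‖ = 2 * j + 1 := by
    rw [show (2 * (j : ℂ) + 1) = ((2 * j + 1 : ℕ) : ℂ) by push_cast; ring, Complex.norm_natCast]
    push_cast; ring
  rw [e1, e2, e3, e4]
  have hZ : ∀ Z R : ℝ, Z ≤ R → oddFact k * ((2 * j + 1) / (oddFact i * oddFact j)) * Z *
      (oddFact i * oddFact j) ≤ oddFact k * ((2 * j + 1) * R) := by
    intro Z R h
    have : oddFact k * ((2 * j + 1) / (oddFact i * oddFact j)) * Z *
      (oddFact i * oddFact j) = oddFact k * ((2 * j + 1) * Z) := by field_simp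
    rw [this]
    gcongr
  apply hZ
  refine (norm_add_le _ _).trans ?_
  have t1 : ‖if a = c ∧ i + j ≤ k + 1 then L.theta a (k + 1 - (i + j)) else 0‖ ≤
      if i + j ≤ k + 1 then Mθ * (ρ ^ (i + j) / ρ ^ (k + 2)) else 0 := by
    by_cases h : i + j ≤ k + 1
    · rw [if_pos h]
      by_cases hc : a = c
      · rw [if_pos ⟨hc, h⟩]
        refine (hL.theta_le _ _).trans (le_of_eq ?_)
        rw [← pow_sub_div hρ (by omega : i + j ≤ k + 2)]
        congr 2; omega
      · rw [if_neg (fun h => hc h.1), norm_zero]; positivity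
    · rw [if_neg h, if_neg (fun h' => h h'.2), norm_zero]
  have t2 : ‖(1 / (2 * (k : ℂ) + 1)) *
      if i + j = 0 then L.theta a 0 * L.phi (a, 0) (c, k) else 0‖ ≤
      if i + j ≤ k + 1 then Mθ * (ρ * Mφ) * (ρ ^ (i + j) / ρ ^ (k + 2)) else 0 := by
    by_cases h : i + j = 0
    · rw [if_pos h, if_pos (by omega), h, norm_mul, norm_mul, norm_div, norm_one,
        show (2 * (k : ℂ) + 1) = ((2 * k + 1 : ℕ) : ℂ) by push_cast; ring, Complex.norm_natCast]
      have h1 : 1 / ((2 * k + 1 : ℕ) : ℝ) ≤ 1 := by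
        rw [div_le_one (by positivity)]; push_cast
        linarith [(Nat.cast_nonneg k : (0 : ℝ) ≤ k)]
      calc 1 / ((2 * k + 1 : ℕ) : ℝ) * (‖L.theta a 0‖ * ‖L.phi (a, 0) (c, k)‖)
          ≤ 1 * (Mθ / ρ ^ (0 + 1) * (Mφ / ρ ^ (0 + k))) := by
            gcongr
            · exact hL.theta_le a 0
            · exact hL.phi_le a 0 c k
        _ = _ := by rw [zero_add, zero_add, pow_add]; field_simp
    · rw [if_neg h, mul_zero, norm_zero]
      split_ifs <;> positivity
  refine (add_le_add t1 t2).trans (le_of_eq ?_)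
  split_ifs <;> ring

theorem BoundedBy.norm_sum_theta_phi_le (hL : L.BoundedBy Mt ρt Mθ Mφ ρ) (a c : 𝔞) (P : Prop)
    [Decidable P] (i j k : ℕ) :
    ‖(1 / (2 * (k : ℂ) + 1)) * (if P ∧ i ≤ j + 1 then
      ∑ p ∈ Finset.range (j + 1 - i + 1), L.theta a (j + 1 - i - p) * L.phi (a, p) (c, k)
      else 0)‖ ≤
      Mθ * (ρ ^ i / ρ ^ (j + k + 3)) * (ρ * Mφ * (((j + 2 - i : ℕ) : ℝ) / (2 * k + 1))) := by
  have hρ := hL.ρ_pos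
  have hθ := hL.Mθ_pos
  have hφ := hL.Mφ_nonneg
  by_cases h : P ∧ i ≤ j + 1
  · have hs : ‖∑ p ∈ Finset.range (j + 1 - i + 1),
        L.theta a (j + 1 - i - p) * L.phi (a, p) (c, k)‖ ≤
        ((j + 2 - i : ℕ) : ℝ) * (Mθ * (ρ ^ i / ρ ^ (j + k + 3)) * (ρ * Mφ)) := by
      refine (norm_sum_le _ _).trans ?_
      rw [show j + 2 - i = (Finset.range (j + 1 - i + 1)).card by
        rw [Finset.card_range]; omega, ← nsmul_eq_mul]
      refine Finset.sum_le_card_nsmul _ _ _ fun p hp => ?_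
      have hp := Finset.mem_range.1 hp
      have h1 := hL.theta_le a (j + 1 - i - p)
      have h2 := hL.phi_le a p c k
      rw [norm_mul]
      calc ‖L.theta a (j + 1 - i - p)‖ * ‖L.phi (a, p) (c, k)‖
          ≤ Mθ / ρ ^ (j + 1 - i - p + 1) * (Mφ / ρ ^ (p + k)) := by gcongr
        _ = Mθ * Mφ / ρ ^ (j + k + 2 - i) := by
            rw [div_mul_div_comm, ← pow_add]; congr 2; omega
        _ = _ := by
            rw [pow_sub_div hρ (by omega), show j + k + 3 = j + k + 2 + 1 by ring, pow_succ _ (j + k + 2)]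
            field_simp
    rw [if_pos h, norm_mul, norm_div, norm_one,
      show (2 * (k : ℂ) + 1) = ((2 * k + 1 : ℕ) : ℂ) by push_cast; ring, Complex.norm_natCast]
    calc _ ≤ 1 / ((2 * k + 1 : ℕ) : ℝ) *
        (((j + 2 - i : ℕ) : ℝ) * (Mθ * (ρ ^ i / ρ ^ (j + k + 3)) * (ρ * Mφ))) := by gcongr
      _ = _ := by push_cast; field_simp
  · rw [if_neg h, mul_zero, norm_zero]
    positivity

theorem BoundedBy.norm_C_le (hL : L.BoundedBy Mt ρt Mθ Mφ ρ) (α β γ : 𝔞 × ℕ) :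
    ‖L.tensors.C α β γ‖ * oddFact α.2 ≤ oddFact β.2 * oddFact γ.2 *
      (Mθ * (ρ ^ α.2 / ρ ^ (β.2 + γ.2 + 3)) * quadWeight (ρ * Mφ) α.2 β.2 γ.2) := by
  classical
  obtain ⟨a, i⟩ := α; obtain ⟨b, j⟩ := β; obtain ⟨c, k⟩ := γ
  have hρ := hL.ρ_pos
  have hθ := hL.Mθ_pos
  have hφ := hL.Mφ_nonneg
  have hi := oddFact_pos i
  have hj := oddFact_pos j
  have hk := oddFact_pos k
  simp only
  rw [L.tensors_C, norm_mul, norm_mul, norm_mul, norm_div, norm_one]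
  have e1 : ‖((2 * k + 1)‼ : ℂ)‖ = oddFact k := by simp [oddFact]
  have e2 : ‖((2 * i + 1)‼ : ℂ)‖ = oddFact i := by simp [oddFact]
  have e3 : ‖((2 * j + 1)‼ : ℂ)‖ = oddFact j := by simp [oddFact]
  rw [e1, e2, e3]
  have hZ : ∀ Z R : ℝ, Z ≤ R → oddFact j * oddFact k * (1 / oddFact i) * Z * oddFact i ≤
      oddFact j * oddFact k * R := by
    intro Z R h
    have : oddFact j * oddFact k * (1 / oddFact i) * Z * oddFact i =
      oddFact j * oddFact k * Z := by field_simp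
    rw [this]
    gcongr
  apply hZ
  refine (norm_add_le _ _).trans ?_
  refine (add_le_add ((norm_add_le _ _).trans (add_le_add (norm_add_le _ _) le_rfl)) le_rfl).trans ?_
  have t1 : ‖if a = b ∧ a = c ∧ i ≤ j + k + 2 then L.theta a (j + k + 2 - i) else 0‖ ≤
      Mθ * (ρ ^ i / ρ ^ (j + k + 3)) * if i ≤ j + k + 2 then 1 else 0 := by
    by_cases h : i ≤ j + k + 2
    · rw [if_pos h, mul_one]
      split_ifs
      · refine (hL.theta_le _ _).trans (le_of_eq ?_)
        rw [← pow_sub_div hρ (by omega : i ≤ j + k + 3)]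
        congr 2; omega
      · rw [norm_zero]; positivity
    · rw [if_neg h, if_neg (fun h' => h h'.2.2), norm_zero, mul_zero]
  have t2 := hL.norm_sum_theta_phi_le a c (a = b) i j k
  have t3 := hL.norm_sum_theta_phi_le a b (a = c) i k j
  have t4 : ‖(1 / (2 * (j : ℂ) + 1)) * (1 / (2 * (k : ℂ) + 1)) *
      if i = 0 then L.theta a 0 * (L.phi (a, 0) (b, j) * L.phi (a, 0) (c, k)) else 0‖ ≤
      Mθ * (ρ ^ i / ρ ^ (j + k + 3)) * if i = 0 then (ρ * Mφ) ^ 2 else 0 := by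
    by_cases h : i = 0
    · rw [if_pos h, if_pos h, h, norm_mul, norm_mul, norm_mul, norm_mul, norm_div, norm_div,
        norm_one, show (2 * (k : ℂ) + 1) = ((2 * k + 1 : ℕ) : ℂ) by push_cast; ring,
        show (2 * (j : ℂ) + 1) = ((2 * j + 1 : ℕ) : ℂ) by push_cast; ring, Complex.norm_natCast,
        Complex.norm_natCast]
      have h1 : ∀ k : ℕ, 1 / ((2 * k + 1 : ℕ) : ℝ) ≤ 1 := by
        intro k
        rw [div_le_one (by positivity)]; push_cast
        linarith [(Nat.cast_nonneg k : (0 : ℝ) ≤ k)]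
      calc _ ≤ 1 * 1 * (Mθ / ρ ^ (0 + 1) * (Mφ / ρ ^ (0 + j) * (Mφ / ρ ^ (0 + k)))) := by
            gcongr
            · exact h1 j
            · exact h1 k
            · exact hL.theta_le a 0
            · exact hL.phi_le a 0 b j
            · exact hL.phi_le a 0 c k
        _ = _ := by simp only [zero_add, pow_add]; field_simp
    · rw [if_neg h, mul_zero, norm_zero, if_neg h, mul_zero]
  refine (add_le_add (add_le_add (add_le_add t1 t2) t3) t4).trans (le_of_eq ?_)
  rw [quadWeight, show k + j + 3 = j + k + 3 by ring]
  ring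

end LocalSpectralCurve

/-- `max {(1 + x)², 1 + 4 x}` -/
noncomputable def quadMax (x : ℝ) : ℝ := max ((1 + x) ^ 2) (1 + 4 * x)

theorem one_add_four_le_quadMax (x : ℝ) : 1 + 4 * x ≤ quadMax x := le_max_right _ _

theorem one_add_four_add_sq_le_quadMax {x : ℝ} (hx : 0 ≤ x) :
    1 + 4 * x + x ^ 2 ≤ 13 / 9 * quadMax x := by
  rcases le_total x 2 with h | h
  · have := le_max_right ((1 + x) ^ 2) (1 + 4 * x)
    unfold quadMax
    nlinarith
  · have := le_max_left ((1 + x) ^ 2) (1 + 4 * x)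
    unfold quadMax
    nlinarith

theorem quadMax_pos {x : ℝ} (hx : 0 ≤ x) : 0 < quadMax x :=
  lt_of_lt_of_le (by positivity) (one_add_four_le_quadMax x)

theorem one_add_le_quadMax {x : ℝ} (hx : 0 ≤ x) : 1 + x ≤ quadMax x :=
  (by linarith : 1 + x ≤ 1 + 4 * x).trans (one_add_four_le_quadMax x)

section GeometricSums

variable {r : ℝ}

theorem sum_range_pow_le (h0 : 0 ≤ r) (h1 : r < 1) (K : ℕ) :
    ∑ k ∈ Finset.range K, r ^ k ≤ 1 / (1 - r) := by
  have h := geom_sum_eq h1.ne K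
  rw [h, ← neg_div_neg_eq]
  have : 0 ≤ r ^ K := by positivity
  have h2 : 0 < 1 - r := by linarith
  rw [neg_sub, neg_sub]
  gcongr
  linarith

theorem sum_range_ite_pow_le (h0 : 0 ≤ r) (h1 : r < 1) (m K : ℕ) :
    ∑ k ∈ Finset.range K, (if m ≤ k then r ^ k else 0) ≤ r ^ m / (1 - r) := by
  rw [← Finset.sum_filter]
  calc ∑ k ∈ (Finset.range K).filter (fun k => m ≤ k), r ^ k
      = ∑ k ∈ Finset.range (K - m), r ^ (m + k) := by
        rw [← Finset.sum_Ico_eq_sum_range]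
        refine Finset.sum_congr ?_ fun _ _ => rfl
        ext k; simp; tauto
    _ = r ^ m * ∑ k ∈ Finset.range (K - m), r ^ k := by
        rw [Finset.mul_sum]; exact Finset.sum_congr rfl fun k _ => pow_add _ _ _
    _ ≤ r ^ m * (1 / (1 - r)) := by gcongr; exact sum_range_pow_le h0 h1 _
    _ = _ := by ring

theorem sum_range_succ_mul_pow_le (h0 : 0 ≤ r) (h1 : r < 1) (K : ℕ) :
    ∑ k ∈ Finset.range K, ((k : ℝ) + 1) * r ^ k ≤ 1 / (1 - r) ^ 2 := by
  have h2 : 0 < 1 - r := by linarith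
  have key : (∑ k ∈ Finset.range K, ((k : ℝ) + 1) * r ^ k) * (1 - r) ^ 2 =
      1 - (K + 1) * r ^ K + K * r ^ (K + 1) := by
    induction K with
    | zero => simp
    | succ K ih => rw [Finset.sum_range_succ, add_mul, ih]; push_cast; ring
  rw [le_div_iff₀ (by positivity), key]
  have : (K : ℝ) * r ^ (K + 1) ≤ K * r ^ K := by
    gcongr _ * ?_
    exact pow_le_pow_of_le_one h0 h1.le (Nat.le_succ K)
  have h3 : 0 ≤ r ^ K := by positivity
  nlinarith

theorem sum_range_tsub_mul_pow_le (h0 : 0 ≤ r) (h1 : r < 1) (m K : ℕ) :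
    ∑ k ∈ Finset.range K, ((k + 1 - m : ℕ) : ℝ) * r ^ k ≤ r ^ m / (1 - r) ^ 2 := by
  have h2 : 0 < 1 - r := by linarith
  calc ∑ k ∈ Finset.range K, ((k + 1 - m : ℕ) : ℝ) * r ^ k
      = ∑ k ∈ (Finset.range K).filter (fun k => m ≤ k), ((k + 1 - m : ℕ) : ℝ) * r ^ k := by
        rw [Finset.sum_filter]
        refine Finset.sum_congr rfl fun k _ => ?_
        split_ifs with h
        · rfl
        · rw [show k + 1 - m = 0 by omega]; simp
    _ = ∑ k ∈ Finset.range (K - m), ((m + k + 1 - m : ℕ) : ℝ) * r ^ (m + k) := by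
        rw [← Finset.sum_Ico_eq_sum_range (fun k => ((k + 1 - m : ℕ) : ℝ) * r ^ k)]
        refine Finset.sum_congr ?_ fun _ _ => rfl
        ext k; simp; tauto
    _ = r ^ m * ∑ k ∈ Finset.range (K - m), ((k : ℝ) + 1) * r ^ k := by
        rw [Finset.mul_sum]
        refine Finset.sum_congr rfl fun k _ => ?_
        rw [show m + k + 1 - m = k + 1 by omega, pow_add]; push_cast; ring
    _ ≤ r ^ m * (1 / (1 - r) ^ 2) := by gcongr; exact sum_range_succ_mul_pow_le h0 h1 _
    _ = _ := by ring

theorem sum_range_pow_div_le (h0 : 0 ≤ r) (h1 : r < 1) (K : ℕ) :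
    ∑ k ∈ Finset.range K, r ^ k / (2 * k + 1) ≤ (3 - 2 * r) / (3 * (1 - r)) := by
  have h2 : 0 < 1 - r := by linarith
  cases K with
  | zero => simp; apply div_nonneg <;> nlinarith
  | succ K =>
    rw [Finset.sum_range_succ']
    have : ∑ k ∈ Finset.range K, r ^ (k + 1) / (2 * ((k + 1 : ℕ) : ℝ) + 1) ≤
        ∑ k ∈ Finset.range K, r / 3 * r ^ k := by
      refine Finset.sum_le_sum fun k _ => ?_
      rw [pow_succ, show r / 3 * r ^ k = r ^ k * r / 3 by ring]
      gcongr
      push_cast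
      linarith [(Nat.cast_nonneg k : (0 : ℝ) ≤ k)]
    rw [← Finset.mul_sum] at this
    have h3 := mul_le_mul_of_nonneg_left (sum_range_pow_le h0 h1 K) (by positivity : 0 ≤ r / 3)
    have h4 : (3 - 2 * r) / (3 * (1 - r)) = r / 3 * (1 / (1 - r)) + 1 := by field_simp; ring
    rw [h4]
    simp only [pow_zero, Nat.cast_zero, mul_zero, zero_add, div_one]
    linarith

theorem sum_range_pow_max_le (h0 : 0 ≤ r) (h1 : r < 1) (p K : ℕ) :
    ∑ j ∈ Finset.range K, r ^ max j p ≤ p * r ^ p + r ^ p / (1 - r) := by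
  have : ∀ j, r ^ max j p ≤ (if j ∈ Finset.range p then r ^ p else 0) +
      (if p ≤ j then r ^ j else 0) := by
    intro j
    by_cases h : p ≤ j
    · simp [h, not_lt.2 h]
    · simp [h, not_le.1 h, (not_le.1 h).le]
  refine (Finset.sum_le_sum fun j _ => this j).trans ?_
  rw [Finset.sum_add_distrib]
  refine add_le_add ?_ (sum_range_ite_pow_le h0 h1 p K)
  rw [← Finset.sum_filter, Finset.sum_const, nsmul_eq_mul]
  gcongr
  refine (Finset.card_le_card (t := Finset.range p) fun j hj => ?_).trans (by simp)
  exact (Finset.mem_filter.1 hj).2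

theorem sum_sum_ite_pow_le (h0 : 0 ≤ r) (h1 : r < 1) (i K : ℕ) (s : Finset ℕ) :
    ∑ j ∈ s, ∑ k ∈ Finset.range K, (if i ≤ j + k + 2 then r ^ (j + k) else 0) ≤
      (∑ j ∈ s, r ^ max j (i - 2)) / (1 - r) := by
  rw [Finset.sum_div]
  refine Finset.sum_le_sum fun j _ => ?_
  calc ∑ k ∈ Finset.range K, (if i ≤ j + k + 2 then r ^ (j + k) else 0)
      = r ^ j * ∑ k ∈ Finset.range K, (if i - 2 - j ≤ k then r ^ k else 0) := by
        rw [Finset.mul_sum]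
        refine Finset.sum_congr rfl fun k _ => ?_
        rw [pow_add]
        by_cases h : i ≤ j + k + 2
        · rw [if_pos h, if_pos (by omega)]
        · rw [if_neg h, if_neg (by omega), mul_zero]
    _ ≤ r ^ j * (r ^ (i - 2 - j) / (1 - r)) := by
        gcongr; exact sum_range_ite_pow_le h0 h1 _ _
    _ = _ := by
        rw [← mul_div_assoc, ← pow_add]; congr 2; omega

theorem sum_tsub_le (h0 : 0 ≤ r) (h1 : r < 1) (i K : ℕ) :
    ∑ j ∈ Finset.range K, ((j + 2 - i : ℕ) : ℝ) * r ^ j ≤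
      if i = 0 then (2 - r) / (1 - r) ^ 2 else r ^ (i - 1) / (1 - r) ^ 2 := by
  have h2 : 0 < 1 - r := by linarith
  split_ifs with h
  · subst h
    have : ∀ j ∈ Finset.range K, ((j + 2 - 0 : ℕ) : ℝ) * r ^ j = (j + 1) * r ^ j + r ^ j := by
      intro j _; push_cast [Nat.sub_zero]; ring
    rw [Finset.sum_congr rfl this, Finset.sum_add_distrib]
    refine (add_le_add (sum_range_succ_mul_pow_le h0 h1 K) (sum_range_pow_le h0 h1 K)).trans
      (le_of_eq ?_)
    field_simp; ring
  · refine le_trans (le_of_eq ?_) (sum_range_tsub_mul_pow_le h0 h1 (i - 1) K)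
    refine Finset.sum_congr rfl fun j _ => ?_
    congr 2; omega

/-- The factor in the bound of the full double sum. -/
noncomputable def fullWeight (r : ℝ) (i : ℕ) : ℝ :=
  if i = 0 then 13 / 9 / (1 - r) ^ 2 else ((i : ℝ) - 1 + r / (1 - r)) / (r ^ 2 * (1 - r))

theorem sum_sum_tsub_div_le (h0 : 0 < r) (h1 : r ≤ 1 / 2) (i K : ℕ) :
    (∑ j ∈ Finset.range K, ((j + 2 - i : ℕ) : ℝ) * r ^ j) *
        (∑ k ∈ Finset.range K, r ^ k / (2 * k + 1)) ≤
      if i = 0 then 2 / (1 - r) ^ 2 else 2 * r ^ (i - 1) / (1 - r) ^ 2 := by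
  have h2 : 0 < 1 - r := by linarith
  have hr1 : r < 1 := by linarith
  have hs := sum_tsub_le h0.le hr1 i K
  have hk := sum_range_pow_div_le h0.le hr1 K
  have hk0 : 0 ≤ ∑ k ∈ Finset.range K, r ^ k / (2 * (k : ℝ) + 1) :=
    Finset.sum_nonneg fun k _ => by positivity
  split_ifs at hs ⊢ with h
  · calc _ ≤ (2 - r) / (1 - r) ^ 2 * ((3 - 2 * r) / (3 * (1 - r))) := by
          refine mul_le_mul hs hk hk0 ?_
          apply div_nonneg <;> nlinarith
      _ = (2 - r) * (3 - 2 * r) / (3 * (1 - r)) / (1 - r) ^ 2 := by field_simp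
      _ ≤ _ := by
          gcongr
          rw [div_le_iff₀ (by linarith)]
          nlinarith
  · calc _ ≤ r ^ (i - 1) / (1 - r) ^ 2 * ((3 - 2 * r) / (3 * (1 - r))) := by
          refine mul_le_mul hs hk hk0 (by positivity)
      _ ≤ r ^ (i - 1) / (1 - r) ^ 2 * 2 := by
          gcongr
          rw [div_le_iff₀ (by linarith)]
          nlinarith
      _ = _ := by ring

theorem sum_quadWeight_eq (x : ℝ) (i K : ℕ) :
    ∑ j ∈ Finset.range K, ∑ k ∈ Finset.range K, quadWeight x i j k * r ^ (j + k) =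
      ∑ j ∈ Finset.range K, ∑ k ∈ Finset.range K, (if i ≤ j + k + 2 then r ^ (j + k) else 0) +
      2 * x * ((∑ j ∈ Finset.range K, ((j + 2 - i : ℕ) : ℝ) * r ^ j) *
        (∑ k ∈ Finset.range K, r ^ k / (2 * k + 1))) +
      (if i = 0 then x ^ 2 else 0) * ((∑ j ∈ Finset.range K, r ^ j) *
        ∑ k ∈ Finset.range K, r ^ k) := by
  have e : ∀ j k : ℕ, quadWeight x i j k * r ^ (j + k) =
      (if i ≤ j + k + 2 then r ^ (j + k) else 0) +
      x * ((((j + 2 - i : ℕ) : ℝ) * r ^ j) * (r ^ k / (2 * k + 1))) +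
      x * ((r ^ j / (2 * j + 1)) * (((k + 2 - i : ℕ) : ℝ) * r ^ k)) +
      (if i = 0 then x ^ 2 else 0) * (r ^ j * r ^ k) := by
    intro j k
    rw [quadWeight, pow_add]
    split_ifs <;> ring
  simp only [e, Finset.sum_add_distrib, ← Finset.mul_sum, ← Finset.sum_mul]
  ring

theorem sum_quadWeight_le {x : ℝ} (hx : 0 ≤ x) (h0 : 0 < r) (h1 : r ≤ 1 / 2) (i K : ℕ) :
    ∑ j ∈ Finset.range K, ∑ k ∈ Finset.range K, quadWeight x i j k * r ^ (j + k) ≤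
      quadMax x * (r ^ i * fullWeight r i) := by
  have h2 : 0 < 1 - r := by linarith
  have hr1 : r < 1 := by linarith
  have A1 := (sum_sum_ite_pow_le h0.le hr1 i K (Finset.range K)).trans
    (div_le_div_of_nonneg_right (sum_range_pow_max_le h0.le hr1 (i - 2) K) h2.le)
  have A2 := sum_sum_tsub_div_le h0 h1 i K
  have A3 : (∑ j ∈ Finset.range K, r ^ j) * ∑ k ∈ Finset.range K, r ^ k ≤ 1 / (1 - r) ^ 2 := by
    have := sum_range_pow_le h0.le hr1 K
    calc _ ≤ 1 / (1 - r) * (1 / (1 - r)) := by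
          refine mul_le_mul this this (Finset.sum_nonneg fun k _ => by positivity) (by positivity)
      _ = _ := by field_simp
  rw [sum_quadWeight_eq]
  have A2' := mul_le_mul_of_nonneg_left A2 (by positivity : 0 ≤ 2 * x)
  by_cases hi : i = 0
  · subst hi
    simp only [if_true] at A2' ⊢
    simp only [Nat.zero_sub, Nat.cast_zero, zero_mul, zero_add, pow_zero] at A1
    have A3' := mul_le_mul_of_nonneg_left A3 (sq_nonneg x)
    have hq := one_add_four_add_sq_le_quadMax hx
    rw [fullWeight, if_pos rfl, pow_zero, one_mul]
    calc _ ≤ 1 / (1 - r) / (1 - r) + 2 * x * (2 / (1 - r) ^ 2) + x ^ 2 * (1 / (1 - r) ^ 2) :=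
          add_le_add (add_le_add A1 A2') A3'
      _ = (1 + 4 * x + x ^ 2) / (1 - r) ^ 2 := by field_simp; ring
      _ ≤ 13 / 9 * quadMax x / (1 - r) ^ 2 := by gcongr
      _ = _ := by ring
  · simp only [if_neg hi] at A2' ⊢
    rw [fullWeight, if_neg hi, zero_mul, add_zero]
    have hq := one_add_four_le_quadMax x
    have hri : 0 < r ^ (i - 1) := by positivity
    have hA : ((i - 2 : ℕ) * r ^ (i - 2) + r ^ (i - 2) / (1 - r)) / (1 - r) ≤
        r ^ i * (((i : ℝ) - 1 + r / (1 - r)) / (r ^ 2 * (1 - r))) := by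
      rcases (by omega : i = 1 ∨ 2 ≤ i) with h | h
      · subst h
        apply le_of_eq
        norm_num
        field_simp
      · obtain ⟨m, rfl⟩ := Nat.exists_eq_add_of_le h
        rw [show 2 + m - 2 = m by omega, pow_add]
        apply le_of_eq
        push_cast
        field_simp
        ring
    have hB : r ^ (i - 1) / (1 - r) ^ 2 ≤
        r ^ i * (((i : ℝ) - 1 + r / (1 - r)) / (r ^ 2 * (1 - r))) := by
      obtain ⟨m, rfl⟩ := Nat.exists_eq_add_of_le' (Nat.pos_of_ne_zero hi)
      have e : r ^ (m + 1) * ((((m + 1 : ℕ) : ℝ) - 1 + r / (1 - r)) / (r ^ 2 * (1 - r))) =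
          r ^ m * ((m * (1 - r) + r) / r) / (1 - r) ^ 2 := by
        rw [pow_succ]; push_cast; field_simp; ring
      rw [e, show m + 1 - 1 = m by omega]
      gcongr
      refine le_mul_of_one_le_right (by positivity) ?_
      rw [le_div_iff₀ h0]
      have : 0 ≤ (m : ℝ) * (1 - r) := by positivity
      linarith
    set W := r ^ i * (((i : ℝ) - 1 + r / (1 - r)) / (r ^ 2 * (1 - r)))
    have hW : 0 ≤ W := le_trans (by positivity) hB
    calc _ ≤ W + 2 * x * (2 * r ^ (i - 1) / (1 - r) ^ 2) := add_le_add (A1.trans hA) A2'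
      _ = W + 4 * x * (r ^ (i - 1) / (1 - r) ^ 2) := by ring
      _ ≤ W + 4 * x * W := by gcongr
      _ = (1 + 4 * x) * W := by ring
      _ ≤ _ := by gcongr

theorem sum_filter_pow_max_le (h0 : 0 ≤ r) (h1 : r < 1) (p N K : ℕ) :
    ∑ j ∈ (Finset.range K).filter (fun j => j ≤ N), r ^ max j p ≤ (N + 1) * r ^ p := by
  refine (Finset.sum_le_card_nsmul _ _ (r ^ p) fun j _ =>
    pow_le_pow_of_le_one h0 h1.le (le_max_right _ _)).trans ?_
  rw [nsmul_eq_mul]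
  gcongr
  have : ((Finset.range K).filter (fun j => j ≤ N)).card ≤ (Finset.range (N + 1)).card :=
    Finset.card_le_card fun j hj => by
      have := (Finset.mem_filter.1 hj).2
      simp; omega
  rw [Finset.card_range] at this
  exact_mod_cast this

theorem quadWeight_comm (x : ℝ) (i j k : ℕ) : quadWeight x i j k = quadWeight x i k j := by
  rw [quadWeight, quadWeight, show j + k + 2 = k + j + 2 by ring]; ring

/-- The double sum restricted to `j ≤ N`. -/
theorem sum_quadWeight_filter_le {x : ℝ} (hx : 0 ≤ x) (h0 : 0 < r) (h1 : r ≤ 1 / 2)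
    (i K N : ℕ) :
    ∑ j ∈ (Finset.range K).filter (fun j => j ≤ N), ∑ k ∈ Finset.range K,
      quadWeight x i j k * r ^ (j + k) ≤
      quadMax x * (r ^ i * ((N + 1) / (r ^ 2 * (1 - r)))) := by
  have h2 : 0 < 1 - r := by linarith
  have hr1 : r < 1 := by linarith
  by_cases hi : i = 0
  · calc _ ≤ ∑ j ∈ Finset.range K, ∑ k ∈ Finset.range K, quadWeight x i j k * r ^ (j + k) := by
          refine Finset.sum_le_sum_of_subset_of_nonneg (Finset.filter_subset _ _) fun j _ _ => ?_
          exact Finset.sum_nonneg fun k _ => mul_nonneg (quadWeight_nonneg hx _ _ _) (by positivity)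
      _ ≤ quadMax x * (r ^ i * fullWeight r i) := sum_quadWeight_le hx h0 h1 i K
      _ ≤ _ := by
          have := quadMax_pos hx
          gcongr
          rw [fullWeight, if_pos hi, div_le_div_iff₀ (by positivity) (by positivity)]
          have hN : (1 : ℝ) ≤ N + 1 := by linarith [(Nat.cast_nonneg N : (0 : ℝ) ≤ N)]
          have h3 : 13 / 9 * (r ^ 2 * (1 - r)) ≤ 1 * (1 - r) ^ 2 := by
            have : 13 / 9 * r ^ 2 ≤ 1 - r := by nlinarith
            nlinarith
          refine h3.trans ?_
          gcongr
  · have e : ∀ j k : ℕ, quadWeight x i j k * r ^ (j + k) =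
        (if i ≤ j + k + 2 then r ^ (j + k) else 0) +
        (x * ((((j + 2 - i : ℕ) : ℝ) * r ^ j) * (r ^ k / (2 * k + 1))) +
        x * ((r ^ j / (2 * j + 1)) * (((k + 2 - i : ℕ) : ℝ) * r ^ k))) := by
      intro j k
      rw [quadWeight, pow_add, if_neg hi]
      split_ifs <;> ring
    have A1 := (sum_sum_ite_pow_le h0.le hr1 i K ((Finset.range K).filter (fun j => j ≤ N))).trans
      (div_le_div_of_nonneg_right (sum_filter_pow_max_le h0.le hr1 (i - 2) N K) h2.le)
    have A2 := sum_sum_tsub_div_le h0 h1 i K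
    rw [if_neg hi] at A2
    have A3 : ∑ j ∈ (Finset.range K).filter (fun j => j ≤ N), ∑ k ∈ Finset.range K,
        (x * ((((j + 2 - i : ℕ) : ℝ) * r ^ j) * (r ^ k / (2 * k + 1))) +
        x * ((r ^ j / (2 * j + 1)) * (((k + 2 - i : ℕ) : ℝ) * r ^ k))) ≤
        2 * x * (2 * r ^ (i - 1) / (1 - r) ^ 2) := by
      calc _ ≤ ∑ j ∈ Finset.range K, ∑ k ∈ Finset.range K,
            (x * ((((j + 2 - i : ℕ) : ℝ) * r ^ j) * (r ^ k / (2 * k + 1))) +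
            x * ((r ^ j / (2 * j + 1)) * (((k + 2 - i : ℕ) : ℝ) * r ^ k))) := by
            refine Finset.sum_le_sum_of_subset_of_nonneg (Finset.filter_subset _ _) fun j _ _ => ?_
            exact Finset.sum_nonneg fun k _ => by positivity
        _ = 2 * x * ((∑ j ∈ Finset.range K, ((j + 2 - i : ℕ) : ℝ) * r ^ j) *
            (∑ k ∈ Finset.range K, r ^ k / (2 * k + 1))) := by
            simp only [Finset.sum_add_distrib, ← Finset.mul_sum, ← Finset.sum_mul]
            ring
        _ ≤ _ := by gcongr
    simp only [e, Finset.sum_add_distrib] at A3 ⊢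
    set W : ℝ := r ^ i * ((N + 1) / (r ^ 2 * (1 - r)))
    have hA : (N + 1) * r ^ (i - 2) / (1 - r) ≤ W := by
      have : r ^ (i - 2) * r ^ 2 ≤ r ^ i := by
        rw [← pow_add]
        exact pow_le_pow_of_le_one h0.le hr1.le (by omega)
      have e2 : (N + 1) * r ^ (i - 2) / (1 - r) =
          (r ^ (i - 2) * r ^ 2) * ((N + 1) / (r ^ 2 * (1 - r))) := by field_simp
      rw [e2]
      exact mul_le_mul_of_nonneg_right this (by positivity)
    have hB : r ^ (i - 1) / (1 - r) ^ 2 ≤ W := by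
      obtain ⟨m, rfl⟩ := Nat.exists_eq_add_of_le' (Nat.pos_of_ne_zero hi)
      have e2 : W = r ^ m * ((N + 1) * ((1 - r) / r)) / (1 - r) ^ 2 := by
        simp only [W, pow_succ]; field_simp
      rw [e2, show m + 1 - 1 = m by omega]
      gcongr
      refine le_mul_of_one_le_right (by positivity) ?_
      have hN : (1 : ℝ) ≤ N + 1 := by linarith [(Nat.cast_nonneg N : (0 : ℝ) ≤ N)]
      have h3 : 1 ≤ (1 - r) / r := by rw [le_div_iff₀ h0]; linarith
      nlinarith
    have hW : 0 ≤ W := le_trans (by positivity) hB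
    have hq := one_add_four_le_quadMax x
    calc _ ≤ W + 2 * x * (2 * r ^ (i - 1) / (1 - r) ^ 2) := add_le_add (A1.trans hA) A3
      _ = W + 4 * x * (r ^ (i - 1) / (1 - r) ^ 2) := by ring
      _ ≤ W + 4 * x * W := by gcongr
      _ = (1 + 4 * x) * W := by ring
      _ ≤ _ := by gcongr

/-- The double sum restricted to `j ≤ N₁`, `k ≤ N₂`. -/
theorem sum_quadWeight_filter_filter_le {x : ℝ} (hx : 0 ≤ x) (h0 : 0 < r) (h1 : r ≤ 1 / 2)
    (i K N₁ N₂ : ℕ) :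
    ∑ j ∈ (Finset.range K).filter (fun j => j ≤ N₁), ∑ k ∈ (Finset.range K).filter
      (fun k => k ≤ N₂), quadWeight x i j k * r ^ (j + k) ≤
      quadMax x * (r ^ i * (((min N₁ N₂ : ℕ) + 1) / (r ^ 2 * (1 - r)))) := by
  have hnn : ∀ j k, 0 ≤ quadWeight x i j k * r ^ (j + k) := fun j k =>
    mul_nonneg (quadWeight_nonneg hx _ _ _) (by positivity)
  rcases le_total N₁ N₂ with h | h
  · rw [min_eq_left h]
    refine le_trans (Finset.sum_le_sum fun j _ => ?_) (sum_quadWeight_filter_le hx h0 h1 i K N₁)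
    exact Finset.sum_le_sum_of_subset_of_nonneg (Finset.filter_subset _ _) fun k _ _ => hnn j k
  · rw [min_eq_right h, Finset.sum_comm]
    refine le_trans (Finset.sum_le_sum fun k _ => ?_) (sum_quadWeight_filter_le hx h0 h1 i K N₂)
    refine (Finset.sum_le_sum_of_subset_of_nonneg (Finset.filter_subset _ _)
      fun j _ _ => hnn j k).trans (le_of_eq ?_)
    exact Finset.sum_congr rfl fun j _ => by rw [quadWeight_comm, add_comm j k]

end GeometricSums

theorem AiryTensors.amplitude_rec {I : Type*} (T : AiryTensors I) (g : ℕ) (α : I) (l : List I)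
    (h : 2 < 2 * g + l.length) : T.amplitude g (α :: l) =
    (∑ m : Fin l.length, ∑ᶠ μ : I, T.B α (l.get m) μ * T.amplitude g (μ :: l.eraseIdx m)) +
    (1 / 2) * ∑ᶠ μ : I, ∑ᶠ ν : I, T.C α μ ν *
      ((if 0 < g then T.amplitude (g - 1) (μ :: ν :: l) else 0) +
        ∑ g₁ : Fin (g + 1), ∑ J : Finset (Fin l.length),
          if 1 < 2 * g₁.1 + (pick l J).length ∧ 1 < 2 * (g - g₁.1) + (pick l Jᶜ).length then
            T.amplitude g₁.1 (μ :: pick l J) * T.amplitude (g - g₁.1) (ν :: pick l Jᶜ)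
          else 0) := by
  rw [AiryTensors.amplitude]
  · rfl
  all_goals (intros; simp_all)

section Lists

@[to_additive]
theorem prod_map_pick {I M : Type*} [CommMonoid M] (f : I → M) (l : List I)
    (J : Finset (Fin l.length)) : ((pick l J).map f).prod = ∏ i ∈ J, f (l.get i) := by
  have h : J = ((List.finRange l.length).filter (fun i => i ∈ J)).toFinset := by ext i; simp
  rw [pick, List.map_map]
  conv_rhs => rw [h]
  rw [List.prod_toFinset _ ((List.nodup_finRange _).filter _)]
  rfl

@[to_additive]
theorem prod_map_pick_mul {I M : Type*} [CommMonoid M] (f : I → M) (l : List I)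
    (J : Finset (Fin l.length)) :
    ((pick l J).map f).prod * ((pick l Jᶜ).map f).prod = (l.map f).prod := by
  rw [prod_map_pick, prod_map_pick, Finset.prod_mul_prod_compl]
  conv_rhs => rw [← List.ofFn_get l, List.map_ofFn, List.prod_ofFn]
  rfl

@[to_additive]
theorem mul_prod_map_eraseIdx {I M : Type*} [CommMonoid M] (f : I → M) (l : List I)
    (m : Fin l.length) : f (l.get m) * ((l.eraseIdx m).map f).prod = (l.map f).prod := by
  rw [← List.eraseIdx_map]
  have := List.mul_prod_eraseIdx (l := l.map f) (i := m) (by simp) (fun _ _ => Commute.all _ _)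
  rw [← this]
  simp

variable {𝔞 : Type*}

/-- The sum of the second indices. -/
def degree (l : List (𝔞 × ℕ)) : ℕ := (l.map Prod.snd).sum

/-- The product of the weights `(2k+1)!!`. -/
noncomputable def weight (l : List (𝔞 × ℕ)) : ℝ := (l.map fun α => oddFact α.2).prod

theorem degree_cons (α : 𝔞 × ℕ) (l : List (𝔞 × ℕ)) : degree (α :: l) = α.2 + degree l := by
  simp [degree]

theorem weight_cons (α : 𝔞 × ℕ) (l : List (𝔞 × ℕ)) :
    weight (α :: l) = oddFact α.2 * weight l := by
  simp [weight]

theorem weight_pos (l : List (𝔞 × ℕ)) : 0 < weight l := by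
  induction l with
  | nil => simp [weight]
  | cons α l ih => rw [weight_cons]; exact mul_pos (oddFact_pos _) ih

theorem degree_pick_add (l : List (𝔞 × ℕ)) (J : Finset (Fin l.length)) :
    degree (pick l J) + degree (pick l Jᶜ) = degree l :=
  sum_map_pick_add Prod.snd l J

theorem weight_pick_mul (l : List (𝔞 × ℕ)) (J : Finset (Fin l.length)) :
    weight (pick l J) * weight (pick l Jᶜ) = weight l :=
  prod_map_pick_mul _ l J

theorem add_degree_eraseIdx (l : List (𝔞 × ℕ)) (m : Fin l.length) :
    (l.get m).2 + degree (l.eraseIdx m) = degree l :=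
  add_sum_map_eraseIdx Prod.snd l m

theorem mul_weight_eraseIdx (l : List (𝔞 × ℕ)) (m : Fin l.length) :
    oddFact (l.get m).2 * weight (l.eraseIdx m) = weight l :=
  mul_prod_map_eraseIdx (fun α => oddFact α.2) l m

theorem length_eraseIdx_cons {I : Type*} (μ : I) (l : List I) (m : Fin l.length) :
    (μ :: l.eraseIdx m).length = l.length := by
  have := List.length_eraseIdx_add_one m.2
  simpa using this

end Lists

section Support

variable {𝔞 : Type*} {T : AiryTensors (𝔞 × ℕ)}

/-- The amplitudes vanish unless `∑ kᵢ ≤ 3g - 3 + n`. -/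
theorem AiryTensors.amplitude_eq_zero
    (hA : ∀ α β γ, ¬ (α.2 = 0 ∧ β.2 = 0 ∧ γ.2 = 0) → T.A α β γ = 0)
    (hB : ∀ α β γ, γ.2 + 1 < α.2 + β.2 → T.B α β γ = 0)
    (hC : ∀ α β γ, β.2 + γ.2 + 2 < α.2 → T.C α β γ = 0)
    (hD : ∀ α, 1 < α.2 → T.D α = 0) :
    ∀ (g : ℕ) (l : List (𝔞 × ℕ)), 2 < 2 * g + l.length →
      3 * g + l.length < degree l + 3 → T.amplitude g l = 0 := by
  suffices H : ∀ (s g : ℕ) (l : List (𝔞 × ℕ)), 2 * g + l.length = s → 2 < 2 * g + l.length →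
      3 * g + l.length < degree l + 3 → T.amplitude g l = 0 from fun g l => H _ g l rfl
  intro s
  induction s using Nat.strong_induction_on with
  | _ s ih =>
    intro g l hs h2 hd
    match l, h2 with
    | [], _ => rw [AiryTensors.amplitude]
    | α :: l, h2 =>
      by_cases h3 : 2 < 2 * g + l.length
      · rw [T.amplitude_rec g α l h3]
        rw [degree_cons, List.length_cons] at hd
        rw [List.length_cons] at hs
        rw [Finset.sum_eq_zero, zero_add, finsum_eq_zero_of_forall_eq_zero, mul_zero]
        · intro μ
          apply finsum_eq_zero_of_forall_eq_zero
          intro ν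
          by_cases hc : μ.2 + ν.2 + 2 < α.2
          · rw [hC _ _ _ hc, zero_mul]
          · have e1 : (if 0 < g then T.amplitude (g - 1) (μ :: ν :: l) else 0) = 0 := by
              split_ifs with hg
              · have hl : (μ :: ν :: l).length = l.length + 2 := rfl
                refine ih (2 * (g - 1) + (l.length + 2)) (by omega) _ _ (by rw [hl]) ?_ ?_
                · rw [hl]; omega
                · rw [hl, degree_cons, degree_cons]; omega
              · rfl
            rw [e1, zero_add, Finset.sum_eq_zero, mul_zero]
            intro g₁ _
            apply Finset.sum_eq_zero
            intro J _
            split_ifs with hJ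
            · have hp := length_pick_add l J
              have hdp := degree_pick_add l J
              have hg := g₁.2
              by_cases hz : 3 * g₁.1 + (pick l J).length + 1 < μ.2 + degree (pick l J) + 3
              · rw [ih (2 * g₁.1 + (μ :: pick l J).length) ?_ _ _ rfl, zero_mul] <;>
                simp only [List.length_cons, degree_cons] <;> omega
              · rw [ih (2 * (g - g₁.1) + (ν :: pick l Jᶜ).length) ?_ (g - g₁.1) _ rfl, mul_zero] <;>
                simp only [List.length_cons, degree_cons] <;> omega
            · rfl
        · intro m _
          apply finsum_eq_zero_of_forall_eq_zero
          intro μ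
          by_cases hb : μ.2 + 1 < α.2 + (l.get m).2
          · rw [hB _ _ _ hb, zero_mul]
          · have hl := length_eraseIdx_cons μ l m
            have hde := add_degree_eraseIdx l m
            rw [ih (2 * g + l.length) (by omega) g (μ :: l.eraseIdx m) (by rw [hl]) (by rw [hl]; omega),
              mul_zero]
            rw [hl, degree_cons]; omega
      · rw [List.length_cons] at h2
        match g, l, h2, h3 with
        | 0, [β, γ], _, _ =>
          rw [AiryTensors.amplitude]
          apply hA
          simp [degree] at hd
          omega
        | 1, [], _, _ =>
          rw [AiryTensors.amplitude]
          apply hD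
          simp [degree] at hd
          omega
        | 0, [], h, _ => simp at h
        | 0, [_], h, _ => simp at h
        | 0, _ :: _ :: _ :: _, _, h => simp at h
        | 1, _ :: _, _, h => simp at h
        | g + 2, _, _, h => omega

end Support

section FiniteSums

variable {𝔞 : Type*} [Fintype 𝔞]

theorem norm_finsum_le {f : 𝔞 × ℕ → ℂ} {K : ℕ} (hf : ∀ μ, K ≤ μ.2 → f μ = 0) {b : ℕ → ℝ}
    (hb : ∀ μ, ‖f μ‖ ≤ b μ.2) :
    ‖∑ᶠ μ, f μ‖ ≤ Fintype.card 𝔞 * ∑ k ∈ Finset.range K, b k := by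
  classical
  rw [finsum_eq_sum_of_support_subset (s := Finset.univ ×ˢ Finset.range K)]
  · refine (norm_sum_le _ _).trans ?_
    refine (Finset.sum_le_sum fun μ _ => hb μ).trans (le_of_eq ?_)
    rw [Finset.sum_product]
    simp
  · intro μ hμ
    simp only [Function.mem_support] at hμ
    simp only [Finset.coe_product, Finset.coe_univ, Set.mem_prod, Set.mem_univ, true_and,
      Finset.coe_range, Set.mem_Iio]
    by_contra h
    exact hμ (hf μ (by omega))

theorem norm_finsum_finsum_le {f : 𝔞 × ℕ → 𝔞 × ℕ → ℂ} {K : ℕ}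
    (hf : ∀ μ ν, K ≤ μ.2 ∨ K ≤ ν.2 → f μ ν = 0) {b : ℕ → ℕ → ℝ}
    (hb : ∀ μ ν, ‖f μ ν‖ ≤ b μ.2 ν.2) :
    ‖∑ᶠ μ, ∑ᶠ ν, f μ ν‖ ≤
      (Fintype.card 𝔞 : ℝ) ^ 2 * ∑ j ∈ Finset.range K, ∑ k ∈ Finset.range K, b j k := by
  have h1 : ∀ μ, ‖∑ᶠ ν, f μ ν‖ ≤ Fintype.card 𝔞 * ∑ k ∈ Finset.range K, b μ.2 k :=
    fun μ => norm_finsum_le (fun ν hν => hf μ ν (Or.inr hν)) fun ν => hb μ ν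
  refine (norm_finsum_le (K := K) (b := fun j => Fintype.card 𝔞 * ∑ k ∈ Finset.range K, b j k)
    (fun μ hμ => finsum_eq_zero_of_forall_eq_zero fun ν => hf μ ν (Or.inl hμ)) h1).trans
    (le_of_eq ?_)
  rw [← Finset.mul_sum]
  ring

theorem sum_finset_apply_card {m : ℕ} (f : ℕ → ℝ) :
    ∑ J : Finset (Fin m), f J.card = ∑ k ∈ Finset.range (m + 1), m.choose k * f k := by
  have := Finset.sum_powerset_apply_card f (x := (Finset.univ : Finset (Fin m)))
  simpa using this

end FiniteSums

/-- Bounds on the tensors of an Airy structure indexed by `𝔞 × ℕ`. -/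
structure AiryTensors.Bounds {𝔞 : Type*} (T : AiryTensors (𝔞 × ℕ)) (M x ρ : ℝ) : Prop where
  M_pos : 0 < M
  x_nonneg : 0 ≤ x
  ρ_pos : 0 < ρ
  A_le : ∀ α β γ, ‖T.A α β γ‖ ≤ if α.2 = 0 ∧ β.2 = 0 ∧ γ.2 = 0 then M / ρ else 0
  B_le : ∀ α β γ, ‖T.B α β γ‖ * (oddFact α.2 * oddFact β.2) ≤ oddFact γ.2 * ((2 * β.2 + 1) *
    if α.2 + β.2 ≤ γ.2 + 1 then M * (1 + x) * (ρ ^ (α.2 + β.2) / ρ ^ (γ.2 + 2)) else 0)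
  C_le : ∀ α β γ, ‖T.C α β γ‖ * oddFact α.2 ≤ oddFact β.2 * oddFact γ.2 *
    (M * (ρ ^ α.2 / ρ ^ (β.2 + γ.2 + 3)) * quadWeight x α.2 β.2 γ.2)
  D_le : ∀ α, ‖T.D α‖ * oddFact α.2 ≤ if α.2 = 0 then M * (1 + 4 * x) / (8 * ρ ^ 2) else
    if α.2 = 1 then M / (8 * ρ) else 0

theorem LocalSpectralCurve.BoundedBy.tensorBounds {𝔞 : Type*} {L : LocalSpectralCurve 𝔞}
    {Mt ρt Mθ Mφ ρ : ℝ} (hL : L.BoundedBy Mt ρt Mθ Mφ ρ) :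
    L.tensors.Bounds Mθ (ρ * Mφ) ρ where
  M_pos := hL.Mθ_pos
  x_nonneg := mul_nonneg hL.ρ_pos.le hL.Mφ_nonneg
  ρ_pos := hL.ρ_pos
  A_le := hL.norm_A_le
  B_le := hL.norm_B_le
  C_le := hL.norm_C_le
  D_le := hL.norm_D_le

/-- The factor from summing a geometric series from `s - 1` on. -/
noncomputable def linWeight (r : ℝ) (s : ℕ) : ℝ :=
  if s = 0 then 1 / (1 - r) else 1 / (r * (1 - r))

theorem sum_linear_le {r : ℝ} (h0 : 0 < r) (h1 : r < 1) (s K : ℕ) :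
    ∑ k ∈ Finset.range K, (if s ≤ k + 1 then r ^ k else 0) ≤ r ^ s * linWeight r s := by
  have h2 : 0 < 1 - r := by linarith
  have := sum_range_ite_pow_le h0.le h1 (s - 1) K
  simp only [Nat.sub_le_iff_le_add] at this
  refine this.trans (le_of_eq ?_)
  rw [linWeight]
  split_ifs with h
  · simp [h]
  · obtain ⟨m, rfl⟩ := Nat.exists_eq_add_of_le' (Nat.pos_of_ne_zero h)
    rw [show m + 1 - 1 = m by omega, pow_succ]
    field_simp

namespace AiryTensors.Bounds

variable {𝔞 : Type*} {T : AiryTensors (𝔞 × ℕ)} {M x ρ : ℝ}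

theorem amplitude_eq_zero (hT : T.Bounds M x ρ) (g : ℕ) (l : List (𝔞 × ℕ))
    (h2 : 2 < 2 * g + l.length) (hd : 3 * g + l.length < degree l + 3) :
    T.amplitude g l = 0 := by
  refine AiryTensors.amplitude_eq_zero ?_ ?_ ?_ ?_ g l h2 hd
  · intro α β γ h
    have := hT.A_le α β γ
    rw [if_neg h] at this
    exact norm_le_zero_iff.1 this
  · intro α β γ h
    have := hT.B_le α β γ
    rw [if_neg (by omega), mul_zero, mul_zero] at this
    have h3 := mul_pos (oddFact_pos α.2) (oddFact_pos β.2)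
    exact norm_le_zero_iff.1 (nonpos_of_mul_nonpos_left this h3)
  · intro α β γ h
    have := hT.C_le α β γ
    have h0 : quadWeight x α.2 β.2 γ.2 = 0 := by
      rw [quadWeight, if_neg (by omega), if_neg (by omega), show β.2 + 2 - α.2 = 0 by omega,
        show γ.2 + 2 - α.2 = 0 by omega]
      simp
    rw [h0, mul_zero, mul_zero] at this
    exact norm_le_zero_iff.1 (nonpos_of_mul_nonpos_left this (oddFact_pos α.2))
  · intro α h
    have := hT.D_le α
    rw [if_neg (by omega), if_neg (by omega)] at this
    exact norm_le_zero_iff.1 (nonpos_of_mul_nonpos_left this (oddFact_pos α.2))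

variable [Fintype 𝔞] {r : ℝ}

theorem norm_linear_le (hT : T.Bounds M x ρ) (h0 : 0 < r) (h1 : r ≤ 1 / 2) {H : ℝ} (hH : 0 ≤ H)
    (g : ℕ) (α : 𝔞 × ℕ) (l : List (𝔞 × ℕ)) (h3 : 2 < 2 * g + l.length) (m : Fin l.length)
    (ih : ∀ μ, ‖T.amplitude g (μ :: l.eraseIdx m)‖ * weight (μ :: l.eraseIdx m) ≤
      H * (r * ρ) ^ degree (μ :: l.eraseIdx m)) :
    ‖∑ᶠ μ, T.B α (l.get m) μ * T.amplitude g (μ :: l.eraseIdx m)‖ * weight (α :: l) ≤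
      (r * ρ) ^ degree (α :: l) * (Fintype.card 𝔞 * (M * quadMax x / ρ ^ 2) * H *
        ((2 * (l.get m).2 + 1) * linWeight r (α.2 + (l.get m).2))) := by
  have hρ := hT.ρ_pos
  have hM := hT.M_pos
  have hx := hT.x_nonneg
  have hw := weight_pos (α :: l)
  have hwe := weight_pos (l.eraseIdx m)
  set β := l.get m with hβ
  set D := degree (l.eraseIdx m) with hD
  have hdeg : β.2 + D = degree l := add_degree_eraseIdx l m
  have hwt : oddFact β.2 * weight (l.eraseIdx m) = weight l := mul_weight_eraseIdx l m
  have hq : M * (1 + x) ≤ M * quadMax x := by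
    gcongr; exact one_add_le_quadMax hx
  set q := M * quadMax x
  have key := norm_finsum_le (f := fun μ => T.B α β μ * T.amplitude g (μ :: l.eraseIdx m))
    (K := 3 * g + l.length)
    (b := fun k => (2 * β.2 + 1) * (q / ρ ^ 2) * H * ρ ^ (α.2 + β.2) * (r * ρ) ^ D *
      (if α.2 + β.2 ≤ k + 1 then r ^ k else 0) / weight (α :: l)) ?_ ?_
  · calc _ ≤ (Fintype.card 𝔞 * ∑ k ∈ Finset.range (3 * g + l.length),
          ((2 * β.2 + 1) * (q / ρ ^ 2) * H * ρ ^ (α.2 + β.2) * (r * ρ) ^ D *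
            (if α.2 + β.2 ≤ k + 1 then r ^ k else 0) / weight (α :: l))) * weight (α :: l) := by
          gcongr
      _ = Fintype.card 𝔞 * ((2 * β.2 + 1) * (q / ρ ^ 2) * H * ρ ^ (α.2 + β.2) * (r * ρ) ^ D) *
          ∑ k ∈ Finset.range (3 * g + l.length), (if α.2 + β.2 ≤ k + 1 then r ^ k else 0) := by
          rw [← Finset.sum_div, ← Finset.mul_sum]
          field_simp
      _ ≤ Fintype.card 𝔞 * ((2 * β.2 + 1) * (q / ρ ^ 2) * H * ρ ^ (α.2 + β.2) * (r * ρ) ^ D) *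
          (r ^ (α.2 + β.2) * linWeight r (α.2 + β.2)) := by
          have hq0 : 0 ≤ q := le_trans (by positivity) hq
          gcongr
          exact sum_linear_le h0 (by linarith) _ _
      _ = _ := by
          rw [degree_cons, ← hdeg, ← add_assoc, pow_add (r * ρ) (α.2 + β.2), mul_pow r ρ (α.2 + β.2)]
          ring
  · intro μ hμ
    rw [hT.amplitude_eq_zero g _ (by rw [length_eraseIdx_cons]; exact h3), mul_zero]
    rw [length_eraseIdx_cons, degree_cons]
    omega
  · intro μ
    rw [le_div_iff₀ hw, weight_cons, ← hwt, norm_mul]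
    have hB := hT.B_le α β μ
    have hA := ih μ
    rw [weight_cons, degree_cons] at hA
    have hμ := oddFact_pos μ.2
    calc ‖T.B α β μ‖ * ‖T.amplitude g (μ :: l.eraseIdx m)‖ *
          (oddFact α.2 * (oddFact β.2 * weight (l.eraseIdx m)))
        = (‖T.B α β μ‖ * (oddFact α.2 * oddFact β.2)) *
          (‖T.amplitude g (μ :: l.eraseIdx m)‖ * weight (l.eraseIdx m)) := by ring
      _ ≤ (oddFact μ.2 * ((2 * β.2 + 1) * if α.2 + β.2 ≤ μ.2 + 1 then
            q * (ρ ^ (α.2 + β.2) / ρ ^ (μ.2 + 2)) else 0)) *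
          (‖T.amplitude g (μ :: l.eraseIdx m)‖ * weight (l.eraseIdx m)) := by
          refine mul_le_mul_of_nonneg_right (hB.trans ?_) (by positivity)
          gcongr
          split_ifs
          · gcongr
          · exact le_rfl
      _ = ((2 * β.2 + 1) * if α.2 + β.2 ≤ μ.2 + 1 then
            q * (ρ ^ (α.2 + β.2) / ρ ^ (μ.2 + 2)) else 0) *
          (‖T.amplitude g (μ :: l.eraseIdx m)‖ * (oddFact μ.2 * weight (l.eraseIdx m))) := by ring
      _ ≤ ((2 * β.2 + 1) * if α.2 + β.2 ≤ μ.2 + 1 then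
            q * (ρ ^ (α.2 + β.2) / ρ ^ (μ.2 + 2)) else 0) * (H * (r * ρ) ^ (μ.2 + D)) := by
          have hq0 : 0 ≤ q := le_trans (by positivity) hq
          refine mul_le_mul_of_nonneg_left hA ?_
          split_ifs <;> positivity
      _ = _ := by
          split_ifs
          · rw [pow_add (r * ρ) μ.2, mul_pow r ρ μ.2, pow_add ρ μ.2 2]
            field_simp
          · ring

/-- The bound of a product term of the recursion, in terms of bounds `H` for the factors. -/
noncomputable def prodTerm (r : ℝ) (H : ℕ → ℕ → ℝ) (g m g₁ n₁ : ℕ) : ℝ :=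
  if 1 < 2 * g₁ + n₁ ∧ 1 < 2 * (g - g₁) + (m - n₁) then
    ((min (3 * g₁ + n₁ - 2) (3 * (g - g₁) + (m - n₁) - 2) : ℕ) + 1) / (r ^ 2 * (1 - r)) *
      (H g₁ (n₁ + 1) * H (g - g₁) (m - n₁ + 1))
  else 0

theorem norm_quadratic_le (hT : T.Bounds M x ρ) (h0 : 0 < r) (h1 : r ≤ 1 / 2)
    {H : ℕ → ℕ → ℝ} (hH : ∀ g n, 0 ≤ H g n)
    (g : ℕ) (α : 𝔞 × ℕ) (l : List (𝔞 × ℕ)) (h3 : 2 < 2 * g + l.length)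
    (ih : ∀ g' l', 2 < 2 * g' + l'.length → 2 * g' + l'.length ≤ 2 * g + l.length →
      ‖T.amplitude g' l'‖ * weight l' ≤ H g' l'.length * (r * ρ) ^ degree l') :
    ‖∑ᶠ μ, ∑ᶠ ν, T.C α μ ν *
      ((if 0 < g then T.amplitude (g - 1) (μ :: ν :: l) else 0) +
        ∑ g₁ : Fin (g + 1), ∑ J : Finset (Fin l.length),
          if 1 < 2 * g₁.1 + (pick l J).length ∧ 1 < 2 * (g - g₁.1) + (pick l Jᶜ).length then
            T.amplitude g₁.1 (μ :: pick l J) * T.amplitude (g - g₁.1) (ν :: pick l Jᶜ)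
          else 0)‖ * weight (α :: l) ≤
      (r * ρ) ^ degree (α :: l) * ((Fintype.card 𝔞 : ℝ) ^ 2 * (M * quadMax x / ρ ^ 3) *
        (fullWeight r α.2 * (if 0 < g then H (g - 1) (l.length + 2) else 0) +
          ∑ g₁ ∈ Finset.range (g + 1), ∑ n₁ ∈ Finset.range (l.length + 1),
            (l.length.choose n₁ : ℝ) * prodTerm r H g l.length g₁ n₁)) := by
  have hρ := hT.ρ_pos
  have hM := hT.M_pos
  have hx := hT.x_nonneg
  have hw := weight_pos (α :: l)
  have hwl := weight_pos l
  have hr1 : 0 < 1 - r := by linarith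
  set K := 3 * g + l.length with hK
  set H1 : ℝ := if 0 < g then H (g - 1) (l.length + 2) else 0 with hH1
  have hH1' : 0 ≤ H1 := by rw [hH1]; split_ifs; exacts [hH _ _, le_rfl]
  -- the contribution of a splitting at `(j, k)`
  set Y : Fin (g + 1) → Finset (Fin l.length) → ℕ → ℕ → ℝ := fun g₁ J j k =>
    if 1 < 2 * g₁.1 + J.card ∧ 1 < 2 * (g - g₁.1) + (l.length - J.card) then
      (if j ≤ 3 * g₁.1 + J.card - 2 ∧ k ≤ 3 * (g - g₁.1) + (l.length - J.card) - 2 then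
        H g₁.1 (J.card + 1) * H (g - g₁.1) (l.length - J.card + 1) else 0) else 0 with hY
  have hY0 : ∀ g₁ J j k, 0 ≤ Y g₁ J j k := by
    intro g₁ J j k
    simp only [hY]
    split_ifs
    · exact mul_nonneg (hH _ _) (hH _ _)
    · exact le_rfl
    · exact le_rfl
  have hcompl : ∀ J : Finset (Fin l.length), (pick l Jᶜ).length = l.length - J.card := by
    intro J
    rw [length_pick, Finset.card_compl, Fintype.card_fin]
  have hcard : ∀ J : Finset (Fin l.length), J.card ≤ l.length := fun J => by
    simpa using Finset.card_le_univ J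
  have key := norm_finsum_finsum_le (f := fun μ ν => T.C α μ ν *
      ((if 0 < g then T.amplitude (g - 1) (μ :: ν :: l) else 0) +
        ∑ g₁ : Fin (g + 1), ∑ J : Finset (Fin l.length),
          if 1 < 2 * g₁.1 + (pick l J).length ∧ 1 < 2 * (g - g₁.1) + (pick l Jᶜ).length then
            T.amplitude g₁.1 (μ :: pick l J) * T.amplitude (g - g₁.1) (ν :: pick l Jᶜ)
          else 0)) (K := K)
    (b := fun j k => M * (ρ ^ α.2 / ρ ^ 3) * (r * ρ) ^ degree l *
      (quadWeight x α.2 j k * r ^ (j + k) * (H1 + ∑ g₁, ∑ J, Y g₁ J j k)) / weight (α :: l))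
    ?_ ?_
  · have hfull := sum_quadWeight_le hx h0 h1 α.2 K
    have hprod : ∀ g₁ J, ∑ j ∈ Finset.range K, ∑ k ∈ Finset.range K,
        quadWeight x α.2 j k * r ^ (j + k) * Y g₁ J j k ≤
        quadMax x * r ^ α.2 * prodTerm r H g l.length g₁.1 J.card := by
      intro g₁ J
      simp only [hY, prodTerm]
      split_ifs with hst
      · set N₁ := 3 * g₁.1 + J.card - 2
        set N₂ := 3 * (g - g₁.1) + (l.length - J.card) - 2
        set HH := H g₁.1 (J.card + 1) * H (g - g₁.1) (l.length - J.card + 1) with hHH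
        have hHH0 : 0 ≤ HH := mul_nonneg (hH _ _) (hH _ _)
        have e : ∑ j ∈ Finset.range K, ∑ k ∈ Finset.range K,
            quadWeight x α.2 j k * r ^ (j + k) * (if j ≤ N₁ ∧ k ≤ N₂ then HH else 0) =
            (∑ j ∈ (Finset.range K).filter (fun j => j ≤ N₁),
              ∑ k ∈ (Finset.range K).filter (fun k => k ≤ N₂),
                quadWeight x α.2 j k * r ^ (j + k)) * HH := by
          rw [Finset.sum_filter, Finset.sum_mul]
          refine Finset.sum_congr rfl fun j _ => ?_
          by_cases hj : j ≤ N₁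
          · rw [if_pos hj, Finset.sum_filter, Finset.sum_mul]
            refine Finset.sum_congr rfl fun k _ => ?_
            by_cases hk : k ≤ N₂
            · rw [if_pos ⟨hj, hk⟩, if_pos hk]
            · rw [if_neg (fun h => hk h.2), if_neg hk, mul_zero, zero_mul]
          · rw [if_neg hj, zero_mul]
            exact Finset.sum_eq_zero fun k _ => by rw [if_neg (fun h => hj h.1), mul_zero]
        rw [e]
        refine (mul_le_mul_of_nonneg_right
          (sum_quadWeight_filter_filter_le hx h0 h1 α.2 K N₁ N₂) hHH0).trans (le_of_eq ?_)
        ring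
      · simp
    have hsum : ∑ j ∈ Finset.range K, ∑ k ∈ Finset.range K,
        quadWeight x α.2 j k * r ^ (j + k) * (H1 + ∑ g₁, ∑ J, Y g₁ J j k) ≤
        quadMax x * r ^ α.2 * (fullWeight r α.2 * H1 +
          ∑ g₁ ∈ Finset.range (g + 1), ∑ n₁ ∈ Finset.range (l.length + 1),
            (l.length.choose n₁ : ℝ) * prodTerm r H g l.length g₁ n₁) := by
      have e1 : ∑ j ∈ Finset.range K, ∑ k ∈ Finset.range K,
          quadWeight x α.2 j k * r ^ (j + k) * (H1 + ∑ g₁, ∑ J, Y g₁ J j k) =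
          (∑ j ∈ Finset.range K, ∑ k ∈ Finset.range K,
            quadWeight x α.2 j k * r ^ (j + k)) * H1 +
          ∑ g₁, ∑ J, ∑ j ∈ Finset.range K, ∑ k ∈ Finset.range K,
            quadWeight x α.2 j k * r ^ (j + k) * Y g₁ J j k := by
        simp only [mul_add, Finset.sum_add_distrib, Finset.sum_mul, Finset.mul_sum]
        congr 1
        calc _ = ∑ j ∈ Finset.range K, ∑ g₁, ∑ k ∈ Finset.range K, ∑ J,
              quadWeight x α.2 j k * r ^ (j + k) * Y g₁ J j k :=
              Finset.sum_congr rfl fun j _ => Finset.sum_comm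
          _ = ∑ g₁, ∑ j ∈ Finset.range K, ∑ k ∈ Finset.range K, ∑ J,
              quadWeight x α.2 j k * r ^ (j + k) * Y g₁ J j k := Finset.sum_comm
          _ = ∑ g₁, ∑ j ∈ Finset.range K, ∑ J, ∑ k ∈ Finset.range K,
              quadWeight x α.2 j k * r ^ (j + k) * Y g₁ J j k :=
              Finset.sum_congr rfl fun g₁ _ => Finset.sum_congr rfl fun j _ => Finset.sum_comm
          _ = _ := Finset.sum_congr rfl fun g₁ _ => Finset.sum_comm
      rw [e1]
      have e2 : ∑ g₁ ∈ Finset.range (g + 1), ∑ n₁ ∈ Finset.range (l.length + 1),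
            (l.length.choose n₁ : ℝ) * prodTerm r H g l.length g₁ n₁ =
          ∑ g₁ : Fin (g + 1), ∑ J : Finset (Fin l.length),
            prodTerm r H g l.length g₁.1 J.card := by
        rw [Finset.sum_range]
        exact Finset.sum_congr rfl fun g₁ _ => (sum_finset_apply_card _).symm
      rw [e2]
      calc _ ≤ quadMax x * (r ^ α.2 * fullWeight r α.2) * H1 +
            ∑ g₁ : Fin (g + 1), ∑ J : Finset (Fin l.length),
              quadMax x * r ^ α.2 * prodTerm r H g l.length g₁.1 J.card := by
            refine add_le_add (mul_le_mul_of_nonneg_right hfull hH1') ?_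
            exact Finset.sum_le_sum fun g₁ _ => Finset.sum_le_sum fun J _ => hprod g₁ J
        _ = _ := by
            simp only [← Finset.mul_sum]
            ring
    calc _ ≤ ((Fintype.card 𝔞 : ℝ) ^ 2 * ∑ j ∈ Finset.range K, ∑ k ∈ Finset.range K,
          (M * (ρ ^ α.2 / ρ ^ 3) * (r * ρ) ^ degree l *
            (quadWeight x α.2 j k * r ^ (j + k) * (H1 + ∑ g₁, ∑ J, Y g₁ J j k)) /
              weight (α :: l))) * weight (α :: l) := by gcongr
      _ = (Fintype.card 𝔞 : ℝ) ^ 2 * (M * (ρ ^ α.2 / ρ ^ 3) * (r * ρ) ^ degree l) *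
          ∑ j ∈ Finset.range K, ∑ k ∈ Finset.range K,
            quadWeight x α.2 j k * r ^ (j + k) * (H1 + ∑ g₁, ∑ J, Y g₁ J j k) := by
          simp only [← Finset.sum_div, ← Finset.mul_sum]
          field_simp
      _ ≤ (Fintype.card 𝔞 : ℝ) ^ 2 * (M * (ρ ^ α.2 / ρ ^ 3) * (r * ρ) ^ degree l) *
          (quadMax x * r ^ α.2 * (fullWeight r α.2 * H1 +
          ∑ g₁ ∈ Finset.range (g + 1), ∑ n₁ ∈ Finset.range (l.length + 1),
            (l.length.choose n₁ : ℝ) * prodTerm r H g l.length g₁ n₁)) := by gcongr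
      _ = _ := by
          rw [degree_cons, pow_add (r * ρ), mul_pow r ρ α.2]
          ring
  · intro μ ν hμν
    have e1 : (if 0 < g then T.amplitude (g - 1) (μ :: ν :: l) else 0) = 0 := by
      split_ifs with hg
      · apply hT.amplitude_eq_zero
        · simp only [List.length_cons]; omega
        · simp only [List.length_cons, degree_cons]; omega
      · rfl
    rw [e1, zero_add, Finset.sum_eq_zero, mul_zero]
    intro g₁ _
    apply Finset.sum_eq_zero
    intro J _
    split_ifs with hJ
    · have hp := length_pick_add l J
      have hg := g₁.2
      rcases hμν with h | h
      · rw [hT.amplitude_eq_zero g₁.1, zero_mul] <;>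
        simp only [List.length_cons, degree_cons] <;> omega
      · rw [hT.amplitude_eq_zero (g - g₁.1), mul_zero] <;>
        simp only [List.length_cons, degree_cons] <;> omega
    · rfl
  · intro μ ν
    rw [le_div_iff₀ hw, weight_cons, norm_mul]
    have hC := hT.C_le α μ ν
    have hμ := oddFact_pos μ.2
    have hν := oddFact_pos ν.2
    set z := r * ρ with hz
    have hz0 : 0 < z := by positivity
    have hX1 : ‖if 0 < g then T.amplitude (g - 1) (μ :: ν :: l) else 0‖ *
        (oddFact μ.2 * oddFact ν.2 * weight l) ≤ H1 * z ^ (μ.2 + ν.2 + degree l) := by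
      rw [hH1]
      split_ifs with hg
      · have := ih (g - 1) (μ :: ν :: l) (by simp only [List.length_cons]; omega)
          (by simp only [List.length_cons]; omega)
        rw [weight_cons, weight_cons, degree_cons, degree_cons, ← add_assoc, ← mul_assoc (oddFact μ.2)] at this
        exact this
      · simp
    have hX2 : ∀ (g₁ : Fin (g + 1)) (J : Finset (Fin l.length)),
        ‖if 1 < 2 * g₁.1 + (pick l J).length ∧ 1 < 2 * (g - g₁.1) + (pick l Jᶜ).length then
            T.amplitude g₁.1 (μ :: pick l J) * T.amplitude (g - g₁.1) (ν :: pick l Jᶜ)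
          else 0‖ * (oddFact μ.2 * oddFact ν.2 * weight l) ≤
        Y g₁ J μ.2 ν.2 * z ^ (μ.2 + ν.2 + degree l) := by
      intro g₁ J
      have hg := g₁.2
      have hJ := hcard J
      have hc := hcompl J
      have hlp := length_pick l J
      have hnn : 0 ≤ Y g₁ J μ.2 ν.2 * z ^ (μ.2 + ν.2 + degree l) :=
        mul_nonneg (hY0 _ _ _ _) (by positivity)
      by_cases hst : 1 < 2 * g₁.1 + (pick l J).length ∧ 1 < 2 * (g - g₁.1) + (pick l Jᶜ).length
      · rw [if_pos hst]
        by_cases hj : μ.2 ≤ 3 * g₁.1 + J.card - 2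
        · by_cases hk : ν.2 ≤ 3 * (g - g₁.1) + (l.length - J.card) - 2
          · have i1 := ih g₁.1 (μ :: pick l J) (by simp only [List.length_cons]; omega)
              (by simp only [List.length_cons]; omega)
            have i2 := ih (g - g₁.1) (ν :: pick l Jᶜ) (by simp only [List.length_cons]; omega)
              (by simp only [List.length_cons]; omega)
            rw [weight_cons, degree_cons, List.length_cons, hlp] at i1
            rw [weight_cons, degree_cons, List.length_cons, hc] at i2
            have hYe : Y g₁ J μ.2 ν.2 =
                H g₁.1 (J.card + 1) * H (g - g₁.1) (l.length - J.card + 1) := by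
              simp only [hY]
              rw [if_pos (by rw [hlp, hc] at hst; exact hst), if_pos ⟨hj, hk⟩]
            rw [hYe, norm_mul, ← weight_pick_mul l J, ← degree_pick_add l J]
            calc _ = (‖T.amplitude g₁.1 (μ :: pick l J)‖ * (oddFact μ.2 * weight (pick l J))) *
                  (‖T.amplitude (g - g₁.1) (ν :: pick l Jᶜ)‖ *
                    (oddFact ν.2 * weight (pick l Jᶜ))) := by ring
              _ ≤ (H g₁.1 (J.card + 1) * z ^ (μ.2 + degree (pick l J))) *
                  (H (g - g₁.1) (l.length - J.card + 1) * z ^ (ν.2 + degree (pick l Jᶜ))) := by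
                  have w1 := weight_pos (pick l J)
                  have w2 := weight_pos (pick l Jᶜ)
                  refine mul_le_mul i1 i2 (by positivity) ?_
                  exact mul_nonneg (hH _ _) (by positivity)
              _ = _ := by ring
          · rw [hT.amplitude_eq_zero (g - g₁.1) (ν :: pick l Jᶜ), mul_zero, norm_zero, zero_mul]
            · exact hnn
            · simp only [List.length_cons]; omega
            · simp only [List.length_cons, degree_cons]; omega
        · rw [hT.amplitude_eq_zero g₁.1 (μ :: pick l J), zero_mul, norm_zero, zero_mul]
          · exact hnn
          · simp only [List.length_cons]; omega
          · simp only [List.length_cons, degree_cons]; omega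
      · rw [if_neg hst, norm_zero, zero_mul]
        exact hnn
    set S := ∑ g₁ : Fin (g + 1), ∑ J : Finset (Fin l.length),
          if 1 < 2 * g₁.1 + (pick l J).length ∧ 1 < 2 * (g - g₁.1) + (pick l Jᶜ).length then
            T.amplitude g₁.1 (μ :: pick l J) * T.amplitude (g - g₁.1) (ν :: pick l Jᶜ)
          else 0 with hS
    have hX3 : ‖S‖ * (oddFact μ.2 * oddFact ν.2 * weight l) ≤
        (∑ g₁, ∑ J, Y g₁ J μ.2 ν.2) * z ^ (μ.2 + ν.2 + degree l) := by
      calc _ ≤ (∑ g₁ : Fin (g + 1), ∑ J : Finset (Fin l.length),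
          ‖if 1 < 2 * g₁.1 + (pick l J).length ∧ 1 < 2 * (g - g₁.1) + (pick l Jᶜ).length then
            T.amplitude g₁.1 (μ :: pick l J) * T.amplitude (g - g₁.1) (ν :: pick l Jᶜ)
          else 0‖) * (oddFact μ.2 * oddFact ν.2 * weight l) := by
            gcongr
            exact (norm_sum_le _ _).trans (Finset.sum_le_sum fun g₁ _ => norm_sum_le _ _)
        _ ≤ _ := by
            simp only [Finset.sum_mul]
            exact Finset.sum_le_sum fun g₁ _ => Finset.sum_le_sum fun J _ => hX2 g₁ J
    calc _ ≤ ‖T.C α μ ν‖ *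
          (‖if 0 < g then T.amplitude (g - 1) (μ :: ν :: l) else 0‖ + ‖S‖) *
          (oddFact α.2 * weight l) := by
          have := oddFact_pos α.2
          gcongr
          exact norm_add_le _ _
      _ = (‖T.C α μ ν‖ * oddFact α.2) *
          ((‖if 0 < g then T.amplitude (g - 1) (μ :: ν :: l) else 0‖ + ‖S‖) * weight l) := by ring
      _ ≤ (oddFact μ.2 * oddFact ν.2 *
          (M * (ρ ^ α.2 / ρ ^ (μ.2 + ν.2 + 3)) * quadWeight x α.2 μ.2 ν.2)) *
          ((‖if 0 < g then T.amplitude (g - 1) (μ :: ν :: l) else 0‖ + ‖S‖) * weight l) := by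
          gcongr
      _ = (M * (ρ ^ α.2 / ρ ^ (μ.2 + ν.2 + 3)) * quadWeight x α.2 μ.2 ν.2) *
          (‖if 0 < g then T.amplitude (g - 1) (μ :: ν :: l) else 0‖ *
            (oddFact μ.2 * oddFact ν.2 * weight l) +
            ‖S‖ * (oddFact μ.2 * oddFact ν.2 * weight l)) := by ring
      _ ≤ (M * (ρ ^ α.2 / ρ ^ (μ.2 + ν.2 + 3)) * quadWeight x α.2 μ.2 ν.2) *
          (H1 * z ^ (μ.2 + ν.2 + degree l) +
            (∑ g₁, ∑ J, Y g₁ J μ.2 ν.2) * z ^ (μ.2 + ν.2 + degree l)) := by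
          have := quadWeight_nonneg hx α.2 μ.2 ν.2
          gcongr
      _ = _ := by
          rw [pow_add z (μ.2 + ν.2), hz, mul_pow r ρ (μ.2 + ν.2), pow_add ρ (μ.2 + ν.2) 3]
          field_simp

theorem norm_amplitude_le_of_forall (hT : T.Bounds M x ρ) (h0 : 0 < r) (h1 : r ≤ 1 / 2)
    {H : ℕ → ℕ → ℝ} (hH : ∀ g n, 0 ≤ H g n)
    (g : ℕ) (α : 𝔞 × ℕ) (l : List (𝔞 × ℕ)) (h3 : 2 < 2 * g + l.length)
    (ih : ∀ g' l', 2 < 2 * g' + l'.length → 2 * g' + l'.length ≤ 2 * g + l.length →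
      ‖T.amplitude g' l'‖ * weight l' ≤ H g' l'.length * (r * ρ) ^ degree l') :
    ‖T.amplitude g (α :: l)‖ * weight (α :: l) ≤ (r * ρ) ^ degree (α :: l) *
      (Fintype.card 𝔞 * (M * quadMax x / ρ ^ 2) * H g l.length *
        (∑ m : Fin l.length, ((2 * (l.get m).2 + 1) * linWeight r (α.2 + (l.get m).2))) +
      1 / 2 * ((Fintype.card 𝔞 : ℝ) ^ 2 * (M * quadMax x / ρ ^ 3) *
        (fullWeight r α.2 * (if 0 < g then H (g - 1) (l.length + 2) else 0) +
          ∑ g₁ ∈ Finset.range (g + 1), ∑ n₁ ∈ Finset.range (l.length + 1),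
            (l.length.choose n₁ : ℝ) * prodTerm r H g l.length g₁ n₁))) := by
  have hw := weight_pos (α :: l)
  rw [T.amplitude_rec g α l h3, mul_add]
  have hlin : ∀ m : Fin l.length, _ := fun m => hT.norm_linear_le h0 h1 (hH g l.length) g α l h3 m
    (fun μ => by
      have := ih g (μ :: l.eraseIdx m) (by rw [length_eraseIdx_cons]; exact h3)
        (by rw [length_eraseIdx_cons])
      rwa [length_eraseIdx_cons] at this)
  have hquad := hT.norm_quadratic_le h0 h1 hH g α l h3 ih
  refine (mul_le_mul_of_nonneg_right (norm_add_le _ _) hw.le).trans ?_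
  rw [add_mul]
  refine add_le_add ?_ ?_
  · calc _ ≤ (∑ m : Fin l.length,
        ‖∑ᶠ μ, T.B α (l.get m) μ * T.amplitude g (μ :: l.eraseIdx m)‖) * weight (α :: l) := by
          gcongr
          exact norm_sum_le _ _
      _ ≤ _ := by
          rw [Finset.sum_mul, Finset.mul_sum, Finset.mul_sum]
          exact Finset.sum_le_sum fun m _ => hlin m
  · rw [norm_mul, mul_assoc]
    have : ‖(1 / 2 : ℂ)‖ = 1 / 2 := by norm_num
    rw [this]
    refine (mul_le_mul_of_nonneg_left hquad (by norm_num)).trans (le_of_eq (by ring))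

end AiryTensors.Bounds

section LinearSums

variable {𝔞 : Type*} {r : ℝ}

theorem sum_get_snd (l : List (𝔞 × ℕ)) : ∑ m : Fin l.length, (l.get m).2 = degree l := by
  unfold degree
  conv_rhs => rw [← List.ofFn_get l, List.map_ofFn, List.sum_ofFn]
  rfl

theorem sum_linWeight_le (h0 : 0 < r) (h1 : r ≤ 1 / 2) (i : ℕ) (l : List (𝔞 × ℕ)) :
    ∑ m : Fin l.length, ((2 * ((l.get m).2 : ℝ) + 1) * linWeight r (i + (l.get m).2)) ≤
      (2 * degree l + l.length) / (r * (1 - r)) := by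
  have h2 : 0 < 1 - r := by linarith
  have hw : ∀ s, linWeight r s ≤ 1 / (r * (1 - r)) := by
    intro s
    rw [linWeight]
    split_ifs
    · exact one_div_le_one_div_of_le (by positivity) (by nlinarith)
    · exact le_rfl
  calc _ ≤ ∑ m : Fin l.length, ((2 * ((l.get m).2 : ℝ) + 1) * (1 / (r * (1 - r)))) := by
        refine Finset.sum_le_sum fun m _ => ?_
        gcongr
        exact hw _
    _ = _ := by
        rw [← Finset.sum_mul, Finset.sum_add_distrib, ← Finset.mul_sum, ← Nat.cast_sum, sum_get_snd,
          Finset.sum_const, Finset.card_univ, Fintype.card_fin, nsmul_eq_mul, mul_one_div]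
        congr 1
        ring

theorem sum_linWeight_zero_le (h0 : 0 < r) (h1 : r ≤ 1 / 2) (l : List (𝔞 × ℕ)) :
    ∑ m : Fin l.length, ((2 * ((l.get m).2 : ℝ) + 1) * linWeight r (0 + (l.get m).2)) ≤
      ((3 - r) * degree l + r * l.length) / (r * (1 - r)) := by
  have h2 : 0 < 1 - r := by linarith
  calc _ ≤ ∑ m : Fin l.length, (((3 - r) * ((l.get m).2 : ℝ) + r) * (1 / (r * (1 - r)))) := by
        refine Finset.sum_le_sum fun m _ => ?_
        rw [zero_add, linWeight]
        split_ifs with h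
        · rw [h]
          apply le_of_eq
          simp only [Nat.cast_zero]
          field_simp
          ring
        · have : (1 : ℝ) ≤ ((l.get m).2 : ℝ) := by exact_mod_cast Nat.pos_of_ne_zero h
          exact mul_le_mul_of_nonneg_right (by nlinarith) (by positivity)
    _ = _ := by
        rw [← Finset.sum_mul, Finset.sum_add_distrib, ← Finset.mul_sum, ← Nat.cast_sum, sum_get_snd,
          Finset.sum_const, Finset.card_univ, Fintype.card_fin, nsmul_eq_mul, mul_one_div]
        congr 1
        ring

end LinearSums

section ProductSums

/-- The ratio between the bounds in positive genus and in genus zero. -/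
noncomputable def genusRatio (k : ℕ) : ℝ := 6 * k / (k + 5)

/-- The genus dependence of the bounds. -/
noncomputable def genusFactor (g k : ℕ) : ℝ := if g = 0 then 1 else genusRatio k

theorem genusRatio_mono {k l : ℕ} (h : k ≤ l) : genusRatio k ≤ genusRatio l := by
  have : (k : ℝ) ≤ l := by exact_mod_cast h
  unfold genusRatio
  rw [div_le_div_iff₀ (by positivity) (by positivity)]
  nlinarith

theorem one_le_genusRatio {k : ℕ} (h : 1 ≤ k) : 1 ≤ genusRatio k := by
  have : (1 : ℝ) ≤ k := by exact_mod_cast h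
  unfold genusRatio
  rw [le_div_iff₀ (by positivity)]
  linarith

theorem genusRatio_nonneg (k : ℕ) : 0 ≤ genusRatio k := by unfold genusRatio; positivity

theorem genusFactor_nonneg (g k : ℕ) : 0 ≤ genusFactor g k := by
  unfold genusFactor; split_ifs; exacts [zero_le_one, genusRatio_nonneg k]

theorem six_mul_le_choose {g p : ℕ} (h0 : 0 < p) (h : p < g) :
    6 * p ≤ (2 * g).choose (2 * p) := by
  have h1 : (2 * p + 2).choose (2 * p) ≤ (2 * g).choose (2 * p) :=
    Nat.choose_le_choose _ (by omega)
  have h2 : (2 * p + 2).choose (2 * p) = (p + 1) * (2 * p + 1) := by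
    rw [← Nat.choose_symm (by omega : 2 * p ≤ 2 * p + 2), show 2 * p + 2 - 2 * p = 2 by omega,
      Nat.choose_two_right]
    rw [show 2 * p + 2 - 1 = 2 * p + 1 by omega, show (2 * p + 2) * (2 * p + 1) =
      (p + 1) * (2 * p + 1) * 2 by ring, Nat.mul_div_cancel _ (by norm_num)]
  obtain ⟨q, rfl⟩ := Nat.exists_eq_add_of_le' h0
  nlinarith

/-- The summands of Vandermonde's identity, extended by zero. -/
def vandermondeTerm (G m c j : ℕ) : ℕ := if j ≤ c then G.choose j * m.choose (c - j) else 0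

theorem sum_vandermondeTerm (G m c : ℕ) :
    ∑ j ∈ Finset.range (G + 1), vandermondeTerm G m c j = (G + m).choose c := by
  rw [Nat.add_choose_eq, Finset.Nat.sum_antidiagonal_eq_sum_range_succ_mk]
  simp only [Nat.succ_eq_add_one]
  have e1 : ∑ k ∈ Finset.range (c + 1), G.choose k * m.choose (c - k) =
      ∑ k ∈ Finset.range (c + 1 + (G + 1)), vandermondeTerm G m c k := by
    refine Finset.sum_subset_zero_on_sdiff (Finset.range_mono (by omega)) ?_ ?_
    · intro k hk
      simp only [Finset.mem_sdiff, Finset.mem_range] at hk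
      rw [vandermondeTerm, if_neg (by omega)]
    · intro k hk
      rw [vandermondeTerm, if_pos (by have := Finset.mem_range.1 hk; omega)]
  rw [e1]
  refine Finset.sum_subset_zero_on_sdiff (Finset.range_mono (by omega)) ?_ fun _ _ => rfl
  intro k hk
  simp only [Finset.mem_sdiff, Finset.mem_range] at hk
  rw [vandermondeTerm, Nat.choose_eq_zero_of_lt (by omega)]
  simp

/-- One half of the bound of the sum over splittings with `2 g₁ + n₁ = k + 1`. -/
theorem sum_splittings_le_left (g m k l : ℕ) (hk : 1 ≤ k) (hl : 1 ≤ l)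
    (hkl : k + l + 2 = 2 * g + m) :
    ∑ p ∈ Finset.range (g + 1), (if 2 * p ≤ k + 1 then
      (m.choose (k + 1 - 2 * p) : ℝ) * (k + p) * (genusFactor p k * genusFactor (g - p) l) else 0) ≤
    genusFactor g (k + l + 1) * (k * ((2 * g + m).choose (k + 1) : ℝ)) := by
  rcases Nat.eq_zero_or_pos g with rfl | hg
  · simp [genusFactor, mul_comm]
  have hF : genusFactor g (k + l + 1) = genusRatio (k + l + 1) := by
    rw [genusFactor, if_neg hg.ne']
  rw [hF]
  set F := genusRatio (k + l + 1) with hFdef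
  have hF1 : 1 ≤ F := one_le_genusRatio (by omega)
  have hFk : genusRatio k ≤ F := genusRatio_mono (by omega)
  have hFl : genusRatio l ≤ F := genusRatio_mono (by omega)
  have hk0 : (0 : ℝ) < k := by exact_mod_cast hk
  set v : ℕ → ℝ := fun j => (vandermondeTerm (2 * g) m (k + 1) j : ℝ) with hv
  have hv0 : ∀ j, 0 ≤ v j := fun j => Nat.cast_nonneg _
  have hvan : ((2 * g + m).choose (k + 1) : ℝ) =
      ∑ p ∈ Finset.range (g + 1), v (2 * p) + ∑ p ∈ Finset.range g, v (2 * p + 1) := by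
    rw [← sum_vandermondeTerm, Nat.cast_sum, Finset.sum_range_two_mul_add_one]
  have hodd : v (2 * (g - 1) + 1) ≤ ∑ p ∈ Finset.range g, v (2 * p + 1) :=
    Finset.single_le_sum (f := fun p => v (2 * p + 1)) (fun p _ => hv0 _)
      (Finset.mem_range.2 (by omega))
  have hsmall : ∀ p ∈ Finset.range g, (if 2 * p ≤ k + 1 then
      (m.choose (k + 1 - 2 * p) : ℝ) * (k + p) * (genusFactor p k * genusFactor (g - p) l) else 0) ≤
      F * (k * v (2 * p)) := by
    intro p hp
    have hp := Finset.mem_range.1 hp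
    split_ifs with h2
    · have hvp : v (2 * p) = (2 * g).choose (2 * p) * m.choose (k + 1 - 2 * p) := by
        simp only [hv, vandermondeTerm, if_pos h2]; push_cast; ring
      have hgl : genusFactor (g - p) l = genusRatio l := by
        rw [genusFactor, if_neg (by omega)]
      rw [hvp, hgl]
      have hkey : (k + p) * genusFactor p k ≤ k * ((2 * g).choose (2 * p) : ℝ) := by
        rcases Nat.eq_zero_or_pos p with rfl | hp0
        · simp [genusFactor]
        · rw [genusFactor, if_neg hp0.ne', genusRatio]
          have h6 : (6 * p : ℝ) ≤ ((2 * g).choose (2 * p) : ℝ) := by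
            exact_mod_cast six_mul_le_choose hp0 hp
          have hp1 : (1 : ℝ) ≤ p := by exact_mod_cast hp0
          calc ((k : ℝ) + p) * (6 * k / (k + 5)) = k * (6 * ((k + p) / (k + 5))) := by
                field_simp
            _ ≤ k * (6 * p) := by
                gcongr
                rw [div_le_iff₀ (by positivity)]
                nlinarith
            _ ≤ _ := by gcongr
      have hc : (0 : ℝ) ≤ m.choose (k + 1 - 2 * p) := Nat.cast_nonneg _
      have hgk := genusFactor_nonneg p k
      calc (m.choose (k + 1 - 2 * p) : ℝ) * (k + p) * (genusFactor p k * genusRatio l)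
          = (m.choose (k + 1 - 2 * p) : ℝ) * ((k + p) * genusFactor p k) * genusRatio l := by ring
        _ ≤ (m.choose (k + 1 - 2 * p) : ℝ) * (k * ((2 * g).choose (2 * p) : ℝ)) * F := by
            gcongr
            exact genusRatio_nonneg l
        _ = _ := by ring
    · have := hv0 (2 * p)
      positivity
  have htop : (if 2 * g ≤ k + 1 then
      (m.choose (k + 1 - 2 * g) : ℝ) * (k + g) * (genusFactor g k * genusFactor (g - g) l) else 0) ≤
      F * (k * (v (2 * g) + v (2 * (g - 1) + 1))) := by
    split_ifs with h2
    · have hv1 : v (2 * g) = m.choose (k + 1 - 2 * g) := by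
        simp [hv, vandermondeTerm, h2]
      have hv2 : v (2 * (g - 1) + 1) = 2 * g * m.choose (k + 1 - 2 * g + 1) := by
        simp only [hv, vandermondeTerm]
        rw [if_pos (by omega), show 2 * (g - 1) + 1 = 2 * g - 1 by omega,
          show k + 1 - (2 * g - 1) = k + 1 - 2 * g + 1 by omega,
          ← Nat.choose_symm (by omega : 2 * g - 1 ≤ 2 * g),
          show 2 * g - (2 * g - 1) = 1 by omega, Nat.choose_one_right]
        push_cast; ring
      rw [hv1, hv2, Nat.sub_self, genusFactor, if_neg hg.ne', genusFactor, if_pos rfl, mul_one]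
      set b := k + 1 - 2 * g with hb
      have hch : m.choose b ≤ 2 * k * m.choose (b + 1) := by
        have h3 := Nat.choose_succ_right_eq m b
        have h4 : 1 ≤ m - b := by omega
        have h5 : b + 1 ≤ k := by omega
        have h6 : (b + 1) * m.choose b ≤ (b + 1) * (2 * k * m.choose (b + 1)) := by
          calc (b + 1) * m.choose b ≤ k * (m.choose b * (m - b)) := by
                have : m.choose b ≤ m.choose b * (m - b) := Nat.le_mul_of_pos_right _ h4
                exact Nat.mul_le_mul h5 this
            _ = k * m.choose (b + 1) * (b + 1) := by rw [← h3]; ring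
            _ ≤ _ := by nlinarith [Nat.zero_le (k * m.choose (b + 1) * (b + 1))]
        exact Nat.le_of_mul_le_mul_left h6 (by omega)
      have hch' : (m.choose b : ℝ) ≤ 2 * k * m.choose (b + 1) := by exact_mod_cast hch
      have hg0 : (0 : ℝ) < g := by exact_mod_cast hg
      calc (m.choose b : ℝ) * (k + g) * genusRatio k ≤ (m.choose b : ℝ) * (k + g) * F := by gcongr
        _ = F * (k * m.choose b + g * m.choose b) := by ring
        _ ≤ F * (k * m.choose b + g * (2 * k * m.choose (b + 1))) := by gcongr
        _ = _ := by ring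
    · have := hv0 (2 * g)
      have := hv0 (2 * (g - 1) + 1)
      positivity
  rw [Finset.sum_range_succ]
  refine (add_le_add (Finset.sum_le_sum hsmall) htop).trans ?_
  rw [hvan, Finset.sum_range_succ (fun p => v (2 * p)) g]
  simp only [← Finset.mul_sum]
  have : F * (k * v (2 * (g - 1) + 1)) ≤ F * (k * ∑ p ∈ Finset.range g, v (2 * p + 1)) := by gcongr
  linarith [this, mul_add F (k * ∑ i ∈ Finset.range g, v (2 * i))
    (k * (v (2 * g) + v (2 * (g - 1) + 1))), (by ring : F * (k * (∑ p ∈ Finset.range g, v (2 * p) +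
      v (2 * g) + ∑ p ∈ Finset.range g, v (2 * p + 1))) = F * (k * ∑ p ∈ Finset.range g, v (2 * p)) +
      F * (k * v (2 * g)) + F * (k * ∑ p ∈ Finset.range g, v (2 * p + 1))),
    (by ring : F * (k * (v (2 * g) + v (2 * (g - 1) + 1))) = F * (k * v (2 * g)) +
      F * (k * v (2 * (g - 1) + 1)))]

/-- The weight of a splitting in the product part of the recursion. -/
noncomputable def splitWeight (g m p n : ℕ) : ℝ :=
  (m.choose n : ℝ) * ((min (3 * p + n - 2) (3 * (g - p) + (m - n) - 2) : ℕ) + 1)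

theorem sum_splittings_le (g m k l : ℕ) (hk : 1 ≤ k) (hl : 1 ≤ l) (hkl : k + l + 2 = 2 * g + m) :
    ∑ x ∈ (Finset.range (g + 1) ×ˢ Finset.range (m + 1)).filter (fun x => 2 * x.1 + x.2 = k + 1),
      splitWeight g m x.1 x.2 * (genusFactor x.1 k * genusFactor (g - x.1) l) ≤
    genusFactor g (k + l + 1) * ((min k l : ℕ) * ((2 * g + m).choose (k + 1) : ℝ)) := by
  have main : ∀ k l : ℕ, 1 ≤ k → 1 ≤ l → k + l + 2 = 2 * g + m → k ≤ l →
      ∑ x ∈ (Finset.range (g + 1) ×ˢ Finset.range (m + 1)).filter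
        (fun x => 2 * x.1 + x.2 = k + 1),
        splitWeight g m x.1 x.2 * (genusFactor x.1 k * genusFactor (g - x.1) l) ≤
      genusFactor g (k + l + 1) * ((k : ℕ) * ((2 * g + m).choose (k + 1) : ℝ)) := by
    intro k l hk hl hkl _
    refine le_trans ?_ (sum_splittings_le_left g m k l hk hl hkl)
    rw [Finset.sum_filter, Finset.sum_product]
    refine Finset.sum_le_sum fun p hp => ?_
    have hp := Finset.mem_range.1 hp
    rw [← Finset.sum_filter]
    split_ifs with h2
    · refine (Finset.sum_le_sum_of_subset_of_nonneg (t := {k + 1 - 2 * p}) ?_ ?_).trans ?_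
      · intro n hn
        have := (Finset.mem_filter.1 hn).2
        simp only [Finset.mem_singleton]
        omega
      · intro n _ _
        have h1 := genusFactor_nonneg p k
        have h2 := genusFactor_nonneg (g - p) l
        unfold splitWeight
        positivity
      · rw [Finset.sum_singleton]
        have h1 := genusFactor_nonneg p k
        have h2' := genusFactor_nonneg (g - p) l
        unfold splitWeight
        have : min (3 * p + (k + 1 - 2 * p) - 2) (3 * (g - p) + (m - (k + 1 - 2 * p)) - 2) + 1 ≤
            k + p := by
          refine (Nat.add_le_add_right (min_le_left _ _) 1).trans ?_
          omega
        exact mul_le_mul_of_nonneg_right (mul_le_mul_of_nonneg_left (by exact_mod_cast this)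
          (Nat.cast_nonneg _)) (mul_nonneg h1 h2')
    · rw [Finset.sum_eq_zero]
      intro n hn
      have := (Finset.mem_filter.1 hn).2
      omega
  rcases le_total k l with h | h
  · rw [min_eq_left h]
    exact main k l hk hl hkl h
  · rw [min_eq_right h]
    have := main l k hl hk (by omega) h
    rw [show l + k + 1 = k + l + 1 by ring, ← Nat.choose_symm_of_eq_add
      (by omega : 2 * g + m = (k + 1) + (l + 1))] at this
    refine le_trans (le_of_eq ?_) this
    refine Finset.sum_nbij' (fun x => (g - x.1, m - x.2)) (fun x => (g - x.1, m - x.2)) ?_ ?_ ?_ ?_ ?_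
    · rintro ⟨p, n⟩ hx
      simp only [Finset.mem_filter, Finset.mem_product, Finset.mem_range] at hx ⊢
      omega
    · rintro ⟨p, n⟩ hx
      simp only [Finset.mem_filter, Finset.mem_product, Finset.mem_range] at hx ⊢
      omega
    · rintro ⟨p, n⟩ hx
      simp only [Finset.mem_filter, Finset.mem_product, Finset.mem_range] at hx
      ext <;> simp <;> omega
    · rintro ⟨p, n⟩ hx
      simp only [Finset.mem_filter, Finset.mem_product, Finset.mem_range] at hx
      ext <;> simp <;> omega
    · rintro ⟨p, n⟩ hx
      simp only [Finset.mem_filter, Finset.mem_product, Finset.mem_range] at hx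
      have e1 : g - (g - p) = p := by omega
      have e2 : m - (m - n) = n := by omega
      simp only [splitWeight, e1, e2]
      rw [Nat.choose_symm (by omega), min_comm]
      ring

end ProductSums

section DecaySequence

/-- The correction to factorial growth in the bounds of the amplitudes. -/
noncomputable def decay (k : ℕ) : ℝ :=
  if k = 1 then 1 else if k = 2 then 27 / 25 else 30 / ((k : ℝ) + 25)

theorem decay_one : decay 1 = 1 := by simp [decay]

theorem decay_two : decay 2 = 27 / 25 := by simp [decay]

theorem decay_of_le {k : ℕ} (h : 3 ≤ k) : decay k = 30 / ((k : ℝ) + 25) := by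
  rw [decay, if_neg (by omega), if_neg (by omega)]

theorem decay_pos (k : ℕ) : 0 < decay k := by
  unfold decay; split_ifs <;> positivity

theorem decay_le (k : ℕ) : decay k ≤ 30 / ((k : ℝ) + 25) := by
  unfold decay
  split_ifs with h h'
  · rw [h]; norm_num
  · rw [h']; norm_num
  · exact le_rfl

/-- The total weight of the products of two lower amplitudes, of Euler characteristics `-k` and
`-l` with `k + l + 1 = χ`. -/
noncomputable def splitSum (χ : ℕ) : ℝ :=
  ∑ j ∈ Finset.range (χ - 2), ((min (j + 1) (χ - 2 - j) : ℕ) : ℝ) * (((χ : ℝ) + 1) * χ) /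
    ((((j + 1 : ℕ) : ℝ) * (((j + 1 : ℕ) : ℝ) + 1)) *
      (((χ - 2 - j : ℕ) : ℝ) * (((χ - 2 - j : ℕ) : ℝ) + 1))) *
    (decay (j + 1) * decay (χ - 2 - j))

theorem splitSum_nonneg (χ : ℕ) : 0 ≤ splitSum χ := by
  refine Finset.sum_nonneg fun j _ => ?_
  have := (decay_pos (j + 1)).le
  have := (decay_pos (χ - 2 - j)).le
  positivity

/-- The numerator of `decay k`. -/
def decayNum (k : ℕ) : ℕ := cond (Nat.beq k 1) 1 (cond (Nat.beq k 2) 27 30)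

/-- The denominator of `decay k`. -/
def decayDen (k : ℕ) : ℕ := cond (Nat.beq k 1) 1 (cond (Nat.beq k 2) 25 (Nat.add k 25))

theorem decay_eq_div (k : ℕ) : decay k = decayNum k / decayDen k := by
  unfold decay decayNum decayDen
  split_ifs with h h'
  · subst h; norm_num
  · subst h'; simp [Nat.beq]
  · have e1 : Nat.beq k 1 = false := by
      cases hb : Nat.beq k 1 with
      | false => rfl
      | true => exact absurd (Nat.eq_of_beq_eq_true hb) h
    have e2 : Nat.beq k 2 = false := by
      cases hb : Nat.beq k 2 with
      | false => rfl
      | true => exact absurd (Nat.eq_of_beq_eq_true hb) h'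
    rw [e1, e2]
    simp

/-- An upper bound of `10 ^ 8` times a summand of `splitSum χ`. -/
def splitTermUpper (χ k l : ℕ) : ℕ :=
  Nat.add (Nat.div
    (Nat.mul (Nat.mul (Nat.mul 100000000 (cond (Nat.ble k l) k l)) (Nat.mul (Nat.succ χ) χ))
      (Nat.mul (decayNum k) (decayNum l)))
    (Nat.mul (Nat.mul (Nat.mul k (Nat.succ k)) (Nat.mul l (Nat.succ l)))
      (Nat.mul (decayDen k) (decayDen l)))) 1

/-- An upper bound of `10 ^ 8` times the sum of the first `n` summands of `splitSum χ`. -/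
noncomputable def splitSumUpper (χ n : ℕ) : ℕ :=
  Nat.rec 0 (fun j s => Nat.add (splitTermUpper χ (Nat.succ j) (Nat.sub (Nat.sub χ 2) j)) s) n

theorem splitSumUpper_eq (χ n : ℕ) :
    splitSumUpper χ n = ∑ j ∈ Finset.range n, splitTermUpper χ (j + 1) (χ - 2 - j) := by
  induction n with
  | zero => rfl
  | succ n ih => rw [Finset.sum_range_succ, ← ih]; exact add_comm _ _

theorem cond_ble_eq_min (k l : ℕ) : cond (Nat.ble k l) k l = min k l := by
  cases h : Nat.ble k l with
  | true => rw [min_eq_left (Nat.le_of_ble_eq_true h)]; rfl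
  | false =>
    have : ¬ k ≤ l := fun h' => by simp [Nat.ble_eq_true_of_le h'] at h
    rw [min_eq_right (by omega)]
    rfl

theorem decayDen_pos {k : ℕ} : 0 < decayDen k := by
  unfold decayDen
  cases Nat.beq k 1 <;> cases Nat.beq k 2 <;> simp

theorem splitSum_le_upper (χ : ℕ) : splitSum χ ≤ splitSumUpper χ (χ - 2) / 10 ^ 8 := by
  rw [splitSumUpper_eq, Nat.cast_sum, Finset.sum_div]
  refine Finset.sum_le_sum fun j hj => ?_
  have hl : 0 < χ - 2 - j := by have := Finset.mem_range.1 hj; omega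
  generalize χ - 2 - j = l at hl
  have hk : 0 < j + 1 := j.succ_pos
  generalize j + 1 = k at hk
  set a := 100000000 * min k l * ((χ + 1) * χ) * (decayNum k * decayNum l) with ha
  set b := (k * (k + 1)) * (l * (l + 1)) * (decayDen k * decayDen l) with hb
  have hdk := decayDen_pos (k := k)
  have hdl := decayDen_pos (k := l)
  have hb0 : 0 < b := by positivity
  have e : splitTermUpper χ k l = a / b + 1 := by
    rw [ha, ← cond_ble_eq_min]; rfl
  have h1 : (a : ℝ) / b ≤ (a / b + 1 : ℕ) := by
    rw [div_le_iff₀ (by exact_mod_cast hb0)]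
    have := Nat.lt_div_mul_add (a := a) hb0
    have h2 : a ≤ (a / b + 1) * b := by rw [add_mul, one_mul]; exact this.le
    exact_mod_cast h2
  rw [e, decay_eq_div, decay_eq_div, le_div_iff₀ (by positivity)]
  refine le_trans (le_of_eq ?_) h1
  have hk' : (0 : ℝ) < k := by exact_mod_cast hk
  have hl' : (0 : ℝ) < l := by exact_mod_cast hl
  have hdk' : (0 : ℝ) < decayDen k := by exact_mod_cast hdk
  have hdl' : (0 : ℝ) < decayDen l := by exact_mod_cast hdl
  rw [ha, hb]
  simp only [Nat.cast_mul, Nat.cast_add, Nat.cast_ofNat, Nat.cast_one]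
  field_simp
  norm_num

/-- The four inequalities of `decay` at `χ = j + 4`, cleared of denominators; `s` stands for
`10 ^ 8 * splitSum χ`. -/
structure DecayStep (j s : ℝ) : Prop where
  zero_half : 8013 * (3 * j + 10) * 10 ^ 10 * (j + 29) + 1785 * s * (j + 28) * (j + 3) * (j + 29) ≤
    30 * 10 ^ 13 * (j + 28) * (j + 3)
  zero_zero : 20802 * 10 ^ 9 * (j + 29) + 268 * s * (j + 28) * (j + 29) ≤ 30 * 10 ^ 12 * (j + 28)
  pos_half : 30 * (8013 * j + 31616) * 10 ^ 9 * (j + 9) * (j + 29) +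
    1785 * (j + 4) * s * (j + 28) * (j + 8) * (j + 29) ≤ 30 * 10 ^ 13 * (j + 4) * (j + 28) * (j + 8)
  pos_zero : (20802 * j + 76274) * 10 ^ 9 * (j + 9) * (j + 29) +
    268 * (j + 4) * s * (j + 28) * (j + 8) * (j + 29) ≤ 30 * 10 ^ 12 * (j + 4) * (j + 28) * (j + 8)

/-- The inequalities of `DecayStep` on natural numbers. -/
def decayCheck (j s : ℕ) : Bool :=
  (Nat.ble (8013 * (3 * j + 10) * 10 ^ 10 * (j + 29) + 1785 * s * (j + 28) * (j + 3) * (j + 29))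
    (30 * 10 ^ 13 * (j + 28) * (j + 3)) &&
  Nat.ble (20802 * 10 ^ 9 * (j + 29) + 268 * s * (j + 28) * (j + 29)) (30 * 10 ^ 12 * (j + 28))) &&
  (Nat.ble (30 * (8013 * j + 31616) * 10 ^ 9 * (j + 9) * (j + 29) +
    1785 * (j + 4) * s * (j + 28) * (j + 8) * (j + 29)) (30 * 10 ^ 13 * (j + 4) * (j + 28) * (j + 8)) &&
  Nat.ble ((20802 * j + 76274) * 10 ^ 9 * (j + 9) * (j + 29) +
    268 * (j + 4) * s * (j + 28) * (j + 8) * (j + 29)) (30 * 10 ^ 12 * (j + 4) * (j + 28) * (j + 8)))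

theorem decayStep_of_check {j s : ℕ} (h : decayCheck j s = true) : DecayStep j s := by
  simp only [decayCheck, Bool.and_eq_true, Nat.ble_eq] at h
  obtain ⟨⟨h1, h2⟩, h3, h4⟩ := h
  exact ⟨by exact_mod_cast h1, by exact_mod_cast h2, by exact_mod_cast h3, by exact_mod_cast h4⟩

/-- `decayCheck` for all indices below `n`. -/
noncomputable def decayCheckBelow (n : ℕ) : Bool :=
  Nat.rec true (fun j b =>
    cond (decayCheck j (splitSumUpper (Nat.add j 4) (Nat.add j 2))) b false) n

theorem decayCheck_of_below {n j : ℕ} (h : decayCheckBelow n = true) (hj : j < n) :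
    decayCheck j (splitSumUpper (j + 4) (j + 2)) = true := by
  induction n with
  | zero => omega
  | succ n ih =>
    have e : decayCheckBelow (n + 1) =
      cond (decayCheck n (splitSumUpper (n + 4) (n + 2))) (decayCheckBelow n) false := rfl
    rw [e] at h
    cases hc : decayCheck n (splitSumUpper (n + 4) (n + 2)) with
    | false => rw [hc] at h; exact absurd h (by simp)
    | true =>
      rw [hc] at h
      rcases Nat.lt_succ_iff_lt_or_eq.1 hj with h' | rfl
      · exact ih h h'
      · exact hc

set_option maxRecDepth 100000 in
theorem decayCheckBelow_eq_true : decayCheckBelow 256 = true := by decide +kernel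

theorem DecayStep.mono {j s s' : ℝ} (hj : 0 ≤ j) (hs : s' ≤ s) (h : DecayStep j s) :
    DecayStep j s' where
  zero_half := le_trans (by gcongr) h.zero_half
  zero_zero := le_trans (by gcongr) h.zero_zero
  pos_half := le_trans (by gcongr) h.pos_half
  pos_zero := le_trans (by gcongr) h.pos_zero

end DecaySequence

section DecayTail

theorem sum_telescope_le (n : ℕ) :
    ∑ j ∈ Finset.range n, 1 / (((j : ℝ) + 2) * (j + 26)) ≤ 11735 / 100000 := by
  obtain ⟨a, ha⟩ : ∃ a : ℕ → ℝ, a = fun j : ℕ => 1 / ((j : ℝ) + 2) := ⟨_, rfl⟩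
  have e : ∀ j ∈ Finset.range n, 1 / (((j : ℝ) + 2) * (j + 26)) = 1 / 24 * (a j - a (24 + j)) := by
    intro j _
    simp only [ha]
    push_cast
    have : (0 : ℝ) ≤ j := Nat.cast_nonneg j
    rw [show (24 : ℝ) + j + 2 = j + 26 by ring]
    field_simp
    ring
  rw [Finset.sum_congr rfl e, ← Finset.mul_sum, Finset.sum_sub_distrib]
  have h1 := Finset.sum_range_add a n 24
  have h2 := Finset.sum_range_add a 24 n
  rw [add_comm n 24, h2] at h1
  have h3 : 0 ≤ ∑ x ∈ Finset.range 24, a (n + x) :=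
    Finset.sum_nonneg fun x _ => by simp only [ha]; positivity
  have h4 : ∑ x ∈ Finset.range 24, a x ≤ 24 * (11735 / 100000) := by
    norm_num [ha, Finset.sum_range_succ]
  linarith

theorem inv_cube_le {κ : ℝ} (h0 : 0 ≤ κ) (h1 : κ ≤ 251 / 500) :
    1 ≤ (28 / 25 + 57 / 2 * κ ^ 2) * (1 - κ) ^ 3 := by
  have h3 : 0 ≤ 251 / 500 - κ := sub_nonneg.2 h1
  have h4 := sq_nonneg (κ - 7 / 100)
  have h5 := sq_nonneg (κ * (κ - 7 / 100))
  nlinarith [mul_nonneg h0 h3, mul_nonneg h0 h4, mul_nonneg h3 h4,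
    mul_nonneg (mul_nonneg h0 h3) h4, mul_nonneg h3 h5]

/-- The bound of a summand of `splitSum χ` with `k ≤ l`, for large `χ`. -/
theorem split_term_le {χ k l : ℝ} (hχ : 260 ≤ χ) (hk : 1 ≤ k) (hkl : k ≤ l) (h : k + l + 1 = χ) :
    k * ((χ + 1) * χ) / ((k * (k + 1)) * (l * (l + 1))) * (30 / (k + 25) * (30 / (l + 25))) ≤
      900 / (χ + 25) * (28 / 25 * (1 / ((k + 1) * (k + 25))) + 57 / 2 * ((χ + 1) / (χ + 49)) / χ ^ 2) := by
  have hl : 0 < l := by linarith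
  have hχ0 : 0 < χ := by linarith
  set κ := (k + 1) / χ with hκ
  have hκ0 : 0 ≤ κ := by positivity
  have hκ1 : κ ≤ 251 / 500 := by
    rw [hκ, div_le_iff₀ hχ0]; linarith
  have hlκ : l = χ * (1 - κ) := by rw [hκ]; field_simp; linarith
  have key := inv_cube_le hκ0 hκ1
  have h1κ : 0 < 1 - κ := by linarith
  have hl1 : (χ + 1) * (1 - κ) ≤ l + 1 := by rw [hlκ]; nlinarith
  have hl25 : (χ + 25) * (1 - κ) ≤ l + 25 := by rw [hlκ]; nlinarith
  have h2 : (χ + 1) * χ * (χ + 25) ≤ (28 / 25 + 57 / 2 * κ ^ 2) * (l * (l + 1) * (l + 25)) := by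
    calc (χ + 1) * χ * (χ + 25) ≤ (χ + 1) * χ * (χ + 25) * ((28 / 25 + 57 / 2 * κ ^ 2) * (1 - κ) ^ 3) :=
          le_mul_of_one_le_right (by positivity) key
      _ = (28 / 25 + 57 / 2 * κ ^ 2) * ((χ * (1 - κ)) * ((χ + 1) * (1 - κ)) * ((χ + 25) * (1 - κ))) := by
          ring
      _ ≤ _ := by rw [← hlκ]; gcongr
  have h3 : k * ((χ + 1) * χ) / ((k * (k + 1)) * (l * (l + 1))) * (30 / (k + 25) * (30 / (l + 25))) =
      900 / (χ + 25) * (1 / ((k + 1) * (k + 25))) *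
        ((χ + 1) * χ * (χ + 25) / (l * (l + 1) * (l + 25))) := by
    field_simp
    norm_num
  rw [h3]
  calc _ ≤ 900 / (χ + 25) * (1 / ((k + 1) * (k + 25))) * (28 / 25 + 57 / 2 * κ ^ 2) := by
        gcongr
        rw [div_le_iff₀ (by positivity)]
        exact h2
    _ = 900 / (χ + 25) * (28 / 25 * (1 / ((k + 1) * (k + 25))) +
          57 / 2 * ((k + 1) / (k + 25)) / χ ^ 2) := by
        rw [hκ]; field_simp
    _ ≤ _ := by
        have : (k + 1) / (k + 25) ≤ (χ + 1) / (χ + 49) := by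
          rw [div_le_div_iff₀ (by positivity) (by positivity)]
          nlinarith
        gcongr

theorem splitSum_le_of_le {χ : ℕ} (hχ : 260 ≤ χ) : splitSum χ ≤ 1066 / 100 * (30 / ((χ : ℝ) + 25)) := by
  have hχ' : (260 : ℝ) ≤ χ := by exact_mod_cast hχ
  obtain ⟨c, rfl⟩ : ∃ c, χ = c + 2 := ⟨χ - 2, by omega⟩
  set χ := c + 2 with hc
  have hbound : ∀ j ∈ Finset.range (χ - 2),
      ((min (j + 1) (χ - 2 - j) : ℕ) : ℝ) * (((χ : ℝ) + 1) * χ) /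
        ((((j + 1 : ℕ) : ℝ) * (((j + 1 : ℕ) : ℝ) + 1)) *
          (((χ - 2 - j : ℕ) : ℝ) * (((χ - 2 - j : ℕ) : ℝ) + 1))) *
        (decay (j + 1) * decay (χ - 2 - j)) ≤
      900 / ((χ : ℝ) + 25) * (28 / 25 * (1 / (((j : ℝ) + 2) * (j + 26)) +
        1 / (((c - 1 - j : ℕ) + 2 : ℝ) * ((c - 1 - j : ℕ) + 26))) +
          57 / 2 * (((χ : ℝ) + 1) / (χ + 49)) / (χ : ℝ) ^ 2) := by
    intro j hj
    have hj := Finset.mem_range.1 hj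
    set k := j + 1 with hk
    set l := χ - 2 - j with hl
    have hk1 : (1 : ℝ) ≤ k := by exact_mod_cast (by omega : 1 ≤ k)
    have hl1 : (1 : ℝ) ≤ l := by exact_mod_cast (by omega : 1 ≤ l)
    have hkl : (k : ℝ) + l + 1 = χ := by exact_mod_cast (by omega : k + l + 1 = χ)
    have ej : (j : ℝ) + 2 = k + 1 ∧ (j : ℝ) + 26 = k + 25 := by rw [hk]; push_cast; constructor <;> ring
    have el : ((c - 1 - j : ℕ) : ℝ) + 2 = l + 1 ∧ ((c - 1 - j : ℕ) : ℝ) + 26 = l + 25 := by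
      have : ((c - 1 - j : ℕ) : ℝ) + 1 = l := by exact_mod_cast (by omega : c - 1 - j + 1 = l)
      rw [← this]; constructor <;> ring
    rw [ej.1, ej.2, el.1, el.2]
    have p1 : 0 ≤ 1 / (((k : ℝ) + 1) * (k + 25)) := by positivity
    have p2 : 0 ≤ 1 / (((l : ℝ) + 1) * (l + 25)) := by positivity
    have d1 := decay_le k
    have d2 := decay_le l
    have d3 := (decay_pos k).le
    have d4 := (decay_pos l).le
    rcases le_total k l with h | h
    · rw [min_eq_left h]
      have := split_term_le hχ' hk1 (by exact_mod_cast h) hkl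
      refine le_trans (by gcongr) (this.trans ?_)
      gcongr
      linarith
    · rw [min_eq_right h]
      have := split_term_le hχ' hl1 (by exact_mod_cast h) (by linarith : (l : ℝ) + k + 1 = χ)
      rw [mul_comm (30 / ((l : ℝ) + 25)), mul_comm ((l : ℝ) * (l + 1))] at this
      refine le_trans (by gcongr) (this.trans ?_)
      gcongr
      linarith
  refine (Finset.sum_le_sum hbound).trans ?_
  have hcc : χ - 2 = c := by omega
  rw [hcc, ← Finset.mul_sum, Finset.sum_add_distrib, ← Finset.mul_sum, Finset.sum_add_distrib,
    Finset.sum_const, Finset.card_range, nsmul_eq_mul,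
    Finset.sum_range_reflect (fun i : ℕ => 1 / (((i : ℕ) + 2 : ℝ) * ((i : ℕ) + 26))) c]
  have ht := sum_telescope_le c
  have hrest : (c : ℝ) * (57 / 2 * (((χ : ℝ) + 1) / (χ + 49)) / (χ : ℝ) ^ 2) ≤ 57 / 2 / 309 := by
    have hcχ : (c : ℝ) = χ - 2 := by rw [hc]; push_cast; ring
    have h309 : (309 : ℝ) ≤ χ + 49 := by linarith
    calc (c : ℝ) * (57 / 2 * (((χ : ℝ) + 1) / (χ + 49)) / (χ : ℝ) ^ 2)
        = 57 / 2 / ((χ : ℝ) + 49) * ((((χ : ℝ) - 2) * (χ + 1)) / (χ : ℝ) ^ 2) := by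
          rw [hcχ]; field_simp
      _ ≤ 57 / 2 / ((χ : ℝ) + 49) * 1 := by
          gcongr
          rw [div_le_one (by positivity)]
          linarith [(by ring : ((χ : ℝ) - 2) * (χ + 1) = (χ : ℝ) ^ 2 - χ - 2)]
      _ ≤ _ := by rw [mul_one]; gcongr
  have : (0 : ℝ) ≤ 900 / ((χ : ℝ) + 25) := by positivity
  calc _ ≤ 900 / ((χ : ℝ) + 25) * (28 / 25 * (11735 / 100000 + 11735 / 100000) +
        57 / 2 / 309) := by
        gcongr
    _ ≤ _ := by
        rw [div_mul_eq_mul_div, mul_div_assoc', div_le_div_iff_of_pos_right (by positivity)]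
        norm_num

theorem decayStep_of_le {j : ℝ} (hj : 256 ≤ j) :
    DecayStep j (10 ^ 8 * (1066 / 100 * (30 / (j + 29)))) := by
  have h : 0 < j + 29 := by linarith
  have e : (10 ^ 8 * (1066 / 100 * (30 / (j + 29)))) * (j + 29) = 10 ^ 8 * (1066 / 100 * 30) := by
    field_simp
  generalize (10 : ℝ) ^ 8 * (1066 / 100 * (30 / (j + 29))) = s at e
  obtain ⟨i, rfl⟩ : ∃ i, j = i + 256 := ⟨j - 256, by ring⟩
  have hi : 0 ≤ i := by linarith
  constructor
  · rw [show 1785 * s * (i + 256 + 28) * (i + 256 + 3) * (i + 256 + 29) =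
      1785 * ((i + 256 + 28) * (i + 256 + 3)) * (s * (i + 256 + 29)) by ring, e]
    ring_nf
    nlinarith [mul_nonneg hi hi]
  · rw [show 268 * s * (i + 256 + 28) * (i + 256 + 29) =
      268 * (i + 256 + 28) * (s * (i + 256 + 29)) by ring, e]
    nlinarith
  · rw [show 1785 * (i + 256 + 4) * s * (i + 256 + 28) * (i + 256 + 8) * (i + 256 + 29) =
      1785 * (i + 256 + 4) * ((i + 256 + 28) * (i + 256 + 8)) * (s * (i + 256 + 29)) by ring, e]
    ring_nf
    nlinarith [mul_nonneg hi hi, pow_nonneg hi 3]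
  · rw [show 268 * (i + 256 + 4) * s * (i + 256 + 28) * (i + 256 + 8) * (i + 256 + 29) =
      268 * (i + 256 + 4) * ((i + 256 + 28) * (i + 256 + 8)) * (s * (i + 256 + 29)) by ring, e]
    ring_nf
    nlinarith [mul_nonneg hi hi, pow_nonneg hi 3]

theorem decayStep (j : ℕ) : DecayStep j (10 ^ 8 * splitSum (j + 4)) := by
  rcases lt_or_ge j 256 with h | h
  · refine (decayStep_of_check (decayCheck_of_below decayCheckBelow_eq_true h)).mono
      (Nat.cast_nonneg j) ?_
    have := splitSum_le_upper (j + 4)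
    rw [le_div_iff₀ (by positivity), show j + 4 - 2 = j + 2 by omega] at this
    linarith
  · refine (decayStep_of_le (by exact_mod_cast h)).mono (Nat.cast_nonneg j) ?_
    have := splitSum_le_of_le (by omega : 260 ≤ j + 4)
    push_cast at this
    rw [show (j : ℝ) + 4 + 25 = j + 29 by ring] at this
    linarith

end DecayTail

section DecayInequalities

theorem splitSum_two : splitSum 2 = 0 := by simp [splitSum]

theorem splitSum_three : splitSum 3 = 3 := by
  simp [splitSum, decay_one]; norm_num

theorem nat_cases_decay {p : ℕ → Prop} (h0 : p 0) (h1 : p 1) (h : ∀ j, p (j + 2)) (c : ℕ) : p c := by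
  rcases c with _ | _ | j
  exacts [h0, h1, h j]

theorem decay_step_zero_half (c : ℕ) :
    8013 / 10000 * ((c : ℝ) + 4 / 3) / (c + 1) * decay (c + 1) + 1785 / 100000 * splitSum (c + 2) ≤
      decay (c + 2) := by
  refine nat_cases_decay (p := fun c : ℕ => 8013 / 10000 * ((c : ℝ) + 4 / 3) / (c + 1) *
    decay (c + 1) + 1785 / 100000 * splitSum (c + 2) ≤ decay (c + 2)) ?_ ?_ ?_ c
  · simp only [zero_add, splitSum_two, decay_one, decay_two]; norm_num
  · simp only [Nat.reduceAdd, splitSum_three, decay_two, decay_of_le (le_refl 3)]; norm_num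
  · intro j
    have h := (decayStep j).zero_half
    rw [decay_of_le (by omega), decay_of_le (by omega)]
    push_cast
    generalize splitSum (j + 2 + 2) = s at *
    have hj : (0 : ℝ) ≤ j := Nat.cast_nonneg j
    rw [← sub_nonneg]
    have e : 30 / ((j : ℝ) + 2 + 2 + 25) - (8013 / 10000 * ((j : ℝ) + 2 + 4 / 3) / (j + 2 + 1) *
        (30 / ((j : ℝ) + 2 + 1 + 25)) + 1785 / 100000 * s) =
      (30 * 10 ^ 13 * ((j : ℝ) + 28) * (j + 3) - (8013 * (3 * (j : ℝ) + 10) * 10 ^ 10 * (j + 29) +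
        1785 * (10 ^ 8 * s) * (j + 28) * (j + 3) * (j + 29))) /
        (10 ^ 13 * (j + 28) * (j + 3) * (j + 29)) := by
      have h1 : (j : ℝ) + 2 + 2 + 25 = j + 29 := by ring
      have h2 : (j : ℝ) + 2 + 1 + 25 = j + 28 := by ring
      have h3 : (j : ℝ) + 2 + 1 = j + 3 := by ring
      rw [h1, h2, h3]
      field_simp
      ring
    rw [e]
    exact div_nonneg (sub_nonneg.2 h) (by positivity)

theorem decay_step_zero_zero (c : ℕ) :
    6934 / 10000 * decay (c + 1) + 268 / 10000 * splitSum (c + 2) ≤ decay (c + 2) := by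
  refine nat_cases_decay (p := fun c : ℕ => 6934 / 10000 * decay (c + 1) +
    268 / 10000 * splitSum (c + 2) ≤ decay (c + 2)) ?_ ?_ ?_ c
  · simp only [zero_add, splitSum_two, decay_one, decay_two]; norm_num
  · simp only [Nat.reduceAdd, splitSum_three, decay_two, decay_of_le (le_refl 3)]; norm_num
  · intro j
    have h := (decayStep j).zero_zero
    rw [decay_of_le (by omega), decay_of_le (by omega)]
    push_cast
    generalize splitSum (j + 2 + 2) = s at *
    have hj : (0 : ℝ) ≤ j := Nat.cast_nonneg j
    rw [← sub_nonneg]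
    have e : 30 / ((j : ℝ) + 2 + 2 + 25) - (6934 / 10000 * (30 / ((j : ℝ) + 2 + 1 + 25)) +
        268 / 10000 * s) =
      (30 * 10 ^ 12 * ((j : ℝ) + 28) - (20802 * 10 ^ 9 * (j + 29) +
        268 * (10 ^ 8 * s) * (j + 28) * (j + 29))) / (10 ^ 12 * (j + 28) * (j + 29)) := by
      have h1 : (j : ℝ) + 2 + 2 + 25 = j + 29 := by ring
      have h2 : (j : ℝ) + 2 + 1 + 25 = j + 28 := by ring
      rw [h1, h2]
      field_simp
      ring
    rw [e]
    exact div_nonneg (sub_nonneg.2 h) (by positivity)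

theorem decay_step_pos_half (c : ℕ) :
    (8013 / 10000 * ((c : ℝ) + 5 / 3) + 2235 / 10000) * (genusRatio (c + 1) * decay (c + 1)) /
      (c + 1) + 1785 / 100000 * (genusRatio (c + 2) * splitSum (c + 2)) ≤
      genusRatio (c + 2) * decay (c + 2) := by
  refine nat_cases_decay (p := fun c : ℕ => (8013 / 10000 * ((c : ℝ) + 5 / 3) + 2235 / 10000) *
    (genusRatio (c + 1) * decay (c + 1)) / (c + 1) +
      1785 / 100000 * (genusRatio (c + 2) * splitSum (c + 2)) ≤
      genusRatio (c + 2) * decay (c + 2)) ?_ ?_ ?_ c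
  · simp only [zero_add, splitSum_two, decay_one, decay_two, genusRatio]; norm_num
  · simp only [Nat.reduceAdd, splitSum_three, decay_two, decay_of_le (le_refl 3), genusRatio]
    norm_num
  · intro j
    have h := (decayStep j).pos_half
    rw [decay_of_le (by omega), decay_of_le (by omega), genusRatio, genusRatio]
    push_cast
    generalize splitSum (j + 2 + 2) = s at *
    have hj : (0 : ℝ) ≤ j := Nat.cast_nonneg j
    rw [← sub_nonneg]
    have h1 : (j : ℝ) + 2 + 2 + 25 = j + 29 := by ring
    have h2 : (j : ℝ) + 2 + 1 + 25 = j + 28 := by ring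
    have h3 : (j : ℝ) + 2 + 2 + 5 = j + 9 := by ring
    have h4 : (j : ℝ) + 2 + 1 + 5 = j + 8 := by ring
    have h5 : (j : ℝ) + 2 + 1 = j + 3 := by ring
    have h6 : (j : ℝ) + 2 + 2 = j + 4 := by ring
    rw [h1, h2, h3, h4, h5, h6]
    have e : 6 * ((j : ℝ) + 4) / (j + 9) * (30 / (j + 29)) -
        ((8013 / 10000 * ((j : ℝ) + 2 + 5 / 3) + 2235 / 10000) * (6 * (j + 3) / (j + 8) *
          (30 / (j + 28))) / (j + 3) + 1785 / 100000 * (6 * (j + 4) / (j + 9) * s)) =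
      6 * (30 * 10 ^ 13 * ((j : ℝ) + 4) * (j + 28) * (j + 8) - (30 * (8013 * (j : ℝ) + 31616) * 10 ^ 9 *
        (j + 9) * (j + 29) + 1785 * (j + 4) * (10 ^ 8 * s) * (j + 28) * (j + 8) * (j + 29))) /
        (10 ^ 13 * (j + 28) * (j + 8) * (j + 9) * (j + 29)) := by
      field_simp
      ring
    rw [e]
    exact div_nonneg (mul_nonneg (by norm_num) (sub_nonneg.2 h)) (by positivity)

theorem decay_step_pos_zero (c : ℕ) :
    6934 / 10000 * ((c : ℝ) + 5 / 3) * (genusRatio (c + 1) * decay (c + 1)) / (c + 1) +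
      268 / 10000 * (genusRatio (c + 2) * splitSum (c + 2)) ≤ genusRatio (c + 2) * decay (c + 2) := by
  refine nat_cases_decay (p := fun c : ℕ => 6934 / 10000 * ((c : ℝ) + 5 / 3) *
    (genusRatio (c + 1) * decay (c + 1)) / (c + 1) +
      268 / 10000 * (genusRatio (c + 2) * splitSum (c + 2)) ≤
      genusRatio (c + 2) * decay (c + 2)) ?_ ?_ ?_ c
  · simp only [zero_add, splitSum_two, decay_one, decay_two, genusRatio]; norm_num
  · simp only [Nat.reduceAdd, splitSum_three, decay_two, decay_of_le (le_refl 3), genusRatio]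
    norm_num
  · intro j
    have h := (decayStep j).pos_zero
    rw [decay_of_le (by omega), decay_of_le (by omega), genusRatio, genusRatio]
    push_cast
    generalize splitSum (j + 2 + 2) = s at *
    have hj : (0 : ℝ) ≤ j := Nat.cast_nonneg j
    rw [← sub_nonneg]
    have h1 : (j : ℝ) + 2 + 2 + 25 = j + 29 := by ring
    have h2 : (j : ℝ) + 2 + 1 + 25 = j + 28 := by ring
    have h3 : (j : ℝ) + 2 + 2 + 5 = j + 9 := by ring
    have h4 : (j : ℝ) + 2 + 1 + 5 = j + 8 := by ring
    have h5 : (j : ℝ) + 2 + 1 = j + 3 := by ring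
    have h6 : (j : ℝ) + 2 + 2 = j + 4 := by ring
    rw [h1, h2, h3, h4, h5, h6]
    have e : 6 * ((j : ℝ) + 4) / (j + 9) * (30 / (j + 29)) -
        (6934 / 10000 * ((j : ℝ) + 2 + 5 / 3) * (6 * (j + 3) / (j + 8) * (30 / (j + 28))) / (j + 3) +
          268 / 10000 * (6 * (j + 4) / (j + 9) * s)) =
      6 * (30 * 10 ^ 12 * ((j : ℝ) + 4) * (j + 28) * (j + 8) - ((20802 * (j : ℝ) + 76274) * 10 ^ 9 *
        (j + 9) * (j + 29) + 268 * (j + 4) * (10 ^ 8 * s) * (j + 28) * (j + 8) * (j + 29))) /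
        (10 ^ 12 * (j + 28) * (j + 8) * (j + 9) * (j + 29)) := by
      field_simp
      ring
    rw [e]
    exact div_nonneg (mul_nonneg (by norm_num) (sub_nonneg.2 h)) (by positivity)

end DecayInequalities

section ProductBound

open AiryTensors.Bounds

/-- The growth of the bounds of the amplitudes in terms of `(g, n)`. -/
noncomputable def growth (g n : ℕ) : ℝ :=
  (2 * g + n - 3).factorial * decay (2 * g + n - 2) * genusFactor g (2 * g + n - 2)

theorem growth_nonneg (g n : ℕ) : 0 ≤ growth g n := by
  have := (decay_pos (2 * g + n - 2)).le
  have := genusFactor_nonneg g (2 * g + n - 2)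
  unfold growth
  positivity

theorem growth_eq {g n c : ℕ} (h : 2 * g + n = c + 3) :
    growth g n = c.factorial * decay (c + 1) * genusFactor g (c + 1) := by
  rw [growth, show 2 * g + n - 3 = c by omega, show 2 * g + n - 2 = c + 1 by omega]

theorem choose_mul_factorial_eq {c k l : ℕ} (hk : 1 ≤ k) (hl : 1 ≤ l) (h : k + l = c + 1) :
    ((c + 3).choose (k + 1) : ℝ) * ((k - 1).factorial * (l - 1).factorial) =
      (c + 1).factorial * ((((c + 2 : ℕ) : ℝ) + 1) * (c + 2 : ℕ) /
        (((k : ℝ) * (k + 1)) * ((l : ℝ) * (l + 1)))) := by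
  obtain ⟨k, rfl⟩ := Nat.exists_eq_add_of_le' hk
  obtain ⟨l, rfl⟩ := Nat.exists_eq_add_of_le' hl
  obtain rfl : c = k + l + 1 := by omega
  have h1 := Nat.add_choose_mul_factorial_mul_factorial (l + 2) (k + 2)
  rw [show l + 2 + (k + 2) = k + l + 1 + 3 by ring, mul_right_comm] at h1
  have h2 : ((k + l + 1 + 3).choose (k + 2) : ℝ) * (k + 2).factorial * (l + 2).factorial =
      (k + l + 1 + 3).factorial := by exact_mod_cast h1
  simp only [Nat.factorial_succ, Nat.cast_mul, Nat.add_sub_cancel] at h2 ⊢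
  push_cast at h2 ⊢
  have hk0 : (0 : ℝ) < k.factorial := by exact_mod_cast k.factorial_pos
  have hl0 : (0 : ℝ) < l.factorial := by exact_mod_cast l.factorial_pos
  rw [mul_div_assoc', eq_div_iff (by positivity)]
  ring_nf at h2 ⊢
  linear_combination h2

theorem sum_prodTerm_le {g m c : ℕ} (h : 2 * g + m = c + 3) {r K a b : ℝ} (h0 : 0 < r)
    (h1 : r ≤ 1 / 2) (ha : 0 ≤ a) (hb : 0 ≤ b) :
    ∑ g₁ ∈ Finset.range (g + 1), ∑ n₁ ∈ Finset.range (m + 1), (m.choose n₁ : ℝ) *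
      prodTerm r (fun g n => K * a ^ g * b ^ n * growth g n) g m g₁ n₁ ≤
    K ^ 2 * a ^ g * b ^ (m + 2) / (r ^ 2 * (1 - r)) *
      ((c + 1).factorial * genusFactor g (c + 2) * splitSum (c + 2)) := by
  have h2 : 0 < 1 - r := by linarith
  set Z := K ^ 2 * a ^ g * b ^ (m + 2) / (r ^ 2 * (1 - r)) with hZ
  have hZ0 : 0 ≤ Z := by positivity
  set S := (Finset.range (g + 1) ×ˢ Finset.range (m + 1)).filter
    (fun x => 1 < 2 * x.1 + x.2 ∧ 1 < 2 * (g - x.1) + (m - x.2)) with hS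
  set G : ℕ × ℕ → ℝ := fun x => splitWeight g m x.1 x.2 *
    (growth x.1 (x.2 + 1) * growth (g - x.1) (m - x.2 + 1)) with hG
  have e1 : ∑ g₁ ∈ Finset.range (g + 1), ∑ n₁ ∈ Finset.range (m + 1), (m.choose n₁ : ℝ) *
      prodTerm r (fun g n => K * a ^ g * b ^ n * growth g n) g m g₁ n₁ = Z * ∑ x ∈ S, G x := by
    rw [← Finset.sum_product', hS, Finset.sum_filter, Finset.mul_sum]
    refine Finset.sum_congr rfl fun x hx => ?_
    simp only [Finset.mem_product, Finset.mem_range] at hx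
    unfold prodTerm
    split_ifs with hst
    · have ea : a ^ g = a ^ x.1 * a ^ (g - x.1) := by rw [← pow_add]; congr 1; omega
      have eb : b ^ (m + 2) = b ^ (x.2 + 1) * b ^ (m - x.2 + 1) := by
        rw [← pow_add]; congr 1; omega
      simp only [hZ, hG, ea, eb, splitWeight]
      field_simp
    · simp
  rw [e1]
  refine mul_le_mul_of_nonneg_left ?_ hZ0
  rw [← Finset.sum_fiberwise_of_maps_to (t := Finset.range c) (g := fun x => 2 * x.1 + x.2 - 2)
    (fun x hx => by
      simp only [hS, Finset.mem_filter, Finset.mem_product, Finset.mem_range] at hx ⊢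
      omega), splitSum, Finset.mul_sum]
  refine Finset.sum_le_sum fun j hj => ?_
  have hj := Finset.mem_range.1 hj
  rw [show c + 2 - 2 - j = c - j by omega]
  have hfib : S.filter (fun x => 2 * x.1 + x.2 - 2 = j) =
      (Finset.range (g + 1) ×ˢ Finset.range (m + 1)).filter
        (fun x => 2 * x.1 + x.2 = j + 1 + 1) := by
    ext x
    simp only [hS, Finset.mem_filter, Finset.mem_product, Finset.mem_range]
    omega
  rw [hfib]
  set k := j + 1 with hk
  set l := c - j with hl
  have hterm : ∀ x ∈ (Finset.range (g + 1) ×ˢ Finset.range (m + 1)).filter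
      (fun x => 2 * x.1 + x.2 = k + 1), G x =
      ((k - 1).factorial * (l - 1).factorial * (decay k * decay l)) *
        (splitWeight g m x.1 x.2 * (genusFactor x.1 k * genusFactor (g - x.1) l)) := by
    intro x hx
    simp only [Finset.mem_filter, Finset.mem_product, Finset.mem_range] at hx
    rw [hG]
    simp only
    rw [growth_eq (c := k - 1) (by omega), growth_eq (c := l - 1) (by omega),
      show k - 1 + 1 = k by omega, show l - 1 + 1 = l by omega]
    ring
  rw [Finset.sum_congr rfl hterm, ← Finset.mul_sum]
  have hd1 := decay_pos k
  have hd2 := decay_pos l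
  refine (mul_le_mul_of_nonneg_left (sum_splittings_le g m k l (by omega) (by omega) (by omega))
    (by positivity)).trans (le_of_eq ?_)
  have hch := choose_mul_factorial_eq (c := c) (k := k) (l := l) (by omega) (by omega) (by omega)
  rw [h, show k + l + 1 = c + 2 by omega]
  calc _ = ((c + 3).choose (k + 1) * ((k - 1).factorial * (l - 1).factorial : ℝ)) *
        (genusFactor g (c + 2) * (min k l : ℕ) * (decay k * decay l)) := by ring
    _ = _ := by rw [hch]; ring

end ProductBound

section RelativeConstants

/-- The constants of the inductive bound, relative to the constants of the tensors. -/
structure RelativeConstants (r y X : ℝ) : Prop where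
  r_pos : 0 < r
  r_le : r ≤ 1 / 2
  y_pos : 0 < y
  X_pos : 0 < X
  linear_le : 3 / (y * r * (1 - r)) ≤ 6934 / 10000 * (1 - 2 * r) + 8013 / 10000 * (2 * r)
  product_le : 1 / (2 * y ^ 2 * r ^ 2 * (1 - r)) ≤
    268 / 10000 * (1 - 2 * r) + 1785 / 100000 * (2 * r)
  sq_le : y ^ 2 ≤ 4 * X * r
  full_le : y / X * (13 / 18) / (1 - r) ^ 2 ≤ 2235 / 10000 * (2 * r)

variable {r y X : ℝ}

theorem RelativeConstants.genus_zero (h : RelativeConstants r y X) (c : ℕ) {L : ℝ}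
    (hL : L ≤ 3 / (y * r * (1 - r)) * (c + 1 + 2 * r / 3)) :
    L * decay (c + 1) / (c + 1) + 1 / (2 * y ^ 2 * r ^ 2 * (1 - r)) * splitSum (c + 2) ≤
      decay (c + 2) := by
  have h0 := h.r_pos
  have h1 := h.r_le
  have hd := (decay_pos (c + 1)).le
  have hs := splitSum_nonneg (c + 2)
  have hz := mul_le_mul_of_nonneg_left (decay_step_zero_zero c) (by linarith : 0 ≤ 1 - 2 * r)
  have hh := mul_le_mul_of_nonneg_left (decay_step_zero_half c) (by linarith : 0 ≤ 2 * r)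
  have hp := mul_le_mul_of_nonneg_right h.product_le hs
  have hc : (0 : ℝ) < c + 1 := by positivity
  have hL' : L ≤ (1 - 2 * r) * (6934 / 10000 * (c + 1)) + 2 * r * (8013 / 10000 * (c + 4 / 3)) := by
    refine hL.trans ((mul_le_mul_of_nonneg_right h.linear_le (by positivity)).trans ?_)
    nlinarith [mul_nonneg h0.le (by linarith : 0 ≤ 1 - 2 * r)]
  have hlin : L * decay (c + 1) / (c + 1) ≤ (1 - 2 * r) * (6934 / 10000 * decay (c + 1)) +
      2 * r * (8013 / 10000 * ((c : ℝ) + 4 / 3) / (c + 1) * decay (c + 1)) := by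
    rw [div_le_iff₀ hc]
    refine (mul_le_mul_of_nonneg_right hL' hd).trans (le_of_eq ?_)
    field_simp
  linarith

theorem RelativeConstants.genus_pos (h : RelativeConstants r y X) (c : ℕ) {L : ℝ}
    (hL : L ≤ 3 / (y * r * (1 - r)) * (c + 5 / 3) + y / X * (13 / 18) / (1 - r) ^ 2) :
    L * (genusRatio (c + 1) * decay (c + 1)) / (c + 1) +
        1 / (2 * y ^ 2 * r ^ 2 * (1 - r)) * (genusRatio (c + 2) * splitSum (c + 2)) ≤
      genusRatio (c + 2) * decay (c + 2) := by
  have h0 := h.r_pos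
  have h1 := h.r_le
  have hd := mul_nonneg (genusRatio_nonneg (c + 1)) (decay_pos (c + 1)).le
  have hs := mul_nonneg (genusRatio_nonneg (c + 2)) (splitSum_nonneg (c + 2))
  have hz := mul_le_mul_of_nonneg_left (decay_step_pos_zero c) (by linarith : 0 ≤ 1 - 2 * r)
  have hh := mul_le_mul_of_nonneg_left (decay_step_pos_half c) (by linarith : 0 ≤ 2 * r)
  have hp := mul_le_mul_of_nonneg_right h.product_le hs
  have hc : (0 : ℝ) < c + 1 := by positivity
  have hL' : L ≤ (1 - 2 * r) * (6934 / 10000 * (c + 5 / 3)) +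
      2 * r * (8013 / 10000 * (c + 5 / 3) + 2235 / 10000) := by
    have := mul_le_mul_of_nonneg_right h.linear_le (by positivity : (0 : ℝ) ≤ c + 5 / 3)
    linarith [h.full_le]
  have hlin : L * (genusRatio (c + 1) * decay (c + 1)) / (c + 1) ≤
      (1 - 2 * r) * (6934 / 10000 * (c + 5 / 3) * (genusRatio (c + 1) * decay (c + 1)) / (c + 1)) +
      2 * r * ((8013 / 10000 * ((c : ℝ) + 5 / 3) + 2235 / 10000) *
        (genusRatio (c + 1) * decay (c + 1)) / (c + 1)) := by
    rw [div_le_iff₀ hc]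
    refine (mul_le_mul_of_nonneg_right hL' hd).trans (le_of_eq ?_)
    field_simp
  linarith

theorem exists_relativeConstants {c u : ℝ} (hc : 0 < c) (hc3 : c ^ 3 = 81) (hu : 0 < u) :
    ∃ r, r * (c * u) ≤ 1 ∧ RelativeConstants r (2 * (c * u) ^ 2 * constP u)
      (2 * u * (c * u) ^ 5 * constP u ^ 3) := by
  have hcl : 43267 / 10000 ≤ c := by
    by_contra! hlt
    have : c ^ 3 < (43267 / 10000) ^ 3 := by gcongr
    norm_num at this
    linarith
  have hcu : c ≤ 43268 / 10000 := by
    by_contra! hlt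
    have : (43268 / 10000 : ℝ) ^ 3 < c ^ 3 := by gcongr
    norm_num at this
    linarith
  have hP : 2 / (5 * u ^ 2) ≤ constP u := by
    unfold constP
    split_ifs with h
    · exact le_rfl
    · rw [div_le_div_iff₀ (by positivity) (by linarith)]
      nlinarith [sq_nonneg (5 * u - 2)]
  have hP0 : 0 < constP u := lt_of_lt_of_le (by positivity) hP
  set P := constP u with hPdef
  have hPu : 2 / 5 ≤ u ^ 2 * P := by
    rw [div_le_iff₀ (by positivity)] at hP
    linarith
  have hyX : 2 * (c * u) ^ 2 * P / (2 * u * (c * u) ^ 5 * P ^ 3) = 1 / (81 * (u ^ 2 * P) ^ 2) := by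
    rw [← hc3]; field_simp
  rcases le_total (c * u) 2 with h | h
  · refine ⟨1 / 2, by linarith, by norm_num, le_rfl, by positivity, by positivity, ?_, ?_, ?_, ?_⟩
    · have hy : 14976 / 1000 ≤ 2 * (c * u) ^ 2 * P := by
        have : (43267 / 10000) ^ 2 ≤ c ^ 2 := by gcongr
        calc (14976 / 1000 : ℝ) ≤ 2 * (43267 / 10000) ^ 2 * (2 / 5) := by norm_num
          _ ≤ 2 * c ^ 2 * (u ^ 2 * P) := by gcongr
          _ = _ := by ring
      rw [div_le_iff₀ (by positivity)]
      nlinarith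
    · have hy : 14976 / 1000 ≤ 2 * (c * u) ^ 2 * P := by
        have : (43267 / 10000) ^ 2 ≤ c ^ 2 := by gcongr
        calc (14976 / 1000 : ℝ) ≤ 2 * (43267 / 10000) ^ 2 * (2 / 5) := by norm_num
          _ ≤ 2 * c ^ 2 * (u ^ 2 * P) := by gcongr
          _ = _ := by ring
      generalize 2 * (c * u) ^ 2 * P = y at *
      rw [div_le_iff₀ (by positivity)]
      nlinarith
    · have : 1 ≤ c * (u ^ 2 * P) := by nlinarith
      calc (2 * (c * u) ^ 2 * P) ^ 2 = 4 * c ^ 4 * u ^ 4 * P ^ 2 * 1 := by ring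
        _ ≤ 4 * c ^ 4 * u ^ 4 * P ^ 2 * (c * (u ^ 2 * P)) := by gcongr
        _ = _ := by ring
    · rw [hyX]
      have : 1 / (81 * (u ^ 2 * P) ^ 2) ≤ 1 / (81 * (2 / 5) ^ 2) := by gcongr
      calc _ ≤ 1 / (81 * (2 / 5) ^ 2) * (13 / 18) / (1 - 1 / 2 : ℝ) ^ 2 := by gcongr
        _ ≤ _ := by norm_num
  · obtain ⟨r, hr⟩ : ∃ r, r = 1 / (c * u) := ⟨_, rfl⟩
    have hr0 : 0 < r := by rw [hr]; positivity
    have hr2 : r ≤ 1 / 2 := by rw [hr]; gcongr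
    have hrcu : r * (c * u) = 1 := by rw [hr]; field_simp
    have hu' : ¬ u < 2 / 5 := by
      intro hlt
      nlinarith
    have hP' : P = 5 / (10 * u - 2) := by rw [hPdef, constP, if_neg hu']
    have hden : 0 < 10 * u - 2 := by linarith
    obtain ⟨d, hd⟩ : ∃ d, d = 1 / c := ⟨_, rfl⟩
    have hdc : d * c = 1 := by rw [hd]; field_simp
    have hd0 : 0 < d := by rw [hd]; positivity
    have hdu : d ≤ 231124 / 1000000 := by nlinarith
    have hur : u * r = d := by
      have : u * r * c = d * c := by rw [hdc]; linarith
      exact mul_right_cancel₀ hc.ne' this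
    have hw : 0 < 10 * d - 2 * r := by rw [← hur]; nlinarith
    have hy : 2 * (c * u) ^ 2 * P * r = 10 / (10 * d - 2 * r) := by
      rw [hP', ← hur, show 2 * (c * u) ^ 2 * (5 / (10 * u - 2)) * r =
        10 * (r * (c * u)) * ((c * u)) / (10 * u - 2) by ring, hrcu,
        div_eq_div_iff hden.ne' (by rw [hur]; exact hw.ne')]
      linear_combination 10 * (10 * u - 2) * hrcu
    have hr1 : 0 < 1 - r := by linarith
    have hyX' : 2 * (c * u) ^ 2 * P / (2 * u * (c * u) ^ 5 * P ^ 3) =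
        c * r ^ 2 * (10 * d - 2 * r) ^ 2 / 25 := by
      rw [hyX, hP', div_eq_div_iff (by positivity) (by norm_num)]
      have e : r * (10 * u - 2) = 10 * d - 2 * r := by rw [← hur]; ring
      have e2 : c * r ^ 4 * u ^ 4 * 81 = 1 := by
        rw [← hc3]
        calc _ = (r * (c * u)) ^ 4 := by ring
          _ = 1 := by rw [hrcu]; norm_num
      rw [← e]
      field_simp
      linear_combination (-25) * e2
    refine ⟨r, hrcu.le, hr0, hr2, by positivity, by positivity, ?_, ?_, ?_, ?_⟩
    · rw [hy, div_le_iff₀ (by positivity)]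
      rw [show (6934 / 10000 * (1 - 2 * r) + 8013 / 10000 * (2 * r)) *
        (10 / (10 * d - 2 * r) * (1 - r)) = (6934 / 10000 * (1 - 2 * r) + 8013 / 10000 * (2 * r)) *
        (10 * (1 - r)) / (10 * d - 2 * r) by ring, le_div_iff₀ hw]
      nlinarith
    · rw [show 2 * (2 * (c * u) ^ 2 * P) ^ 2 * r ^ 2 * (1 - r) =
        2 * (2 * (c * u) ^ 2 * P * r) ^ 2 * (1 - r) by ring, hy, div_le_iff₀ (by positivity)]
      rw [show (268 / 10000 * (1 - 2 * r) + 1785 / 100000 * (2 * r)) *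
        (2 * (10 / (10 * d - 2 * r)) ^ 2 * (1 - r)) =
        (268 / 10000 * (1 - 2 * r) + 1785 / 100000 * (2 * r)) * (200 * (1 - r)) /
          (10 * d - 2 * r) ^ 2 by rw [div_pow]; ring, le_div_iff₀ (by positivity), one_mul]
      have : (10 * d - 2 * r) ^ 2 ≤ (231124 / 100000 - 2 * r) ^ 2 := by gcongr; linarith
      nlinarith
    · have h1 : 1 ≤ 2 * (u * P) := by
        rw [hP', mul_div_assoc', mul_div_assoc', le_div_iff₀ hden]
        linarith
      calc (2 * (c * u) ^ 2 * P) ^ 2 = 4 * (c * u) ^ 4 * P ^ 2 * 1 := by ring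
        _ ≤ 4 * (c * u) ^ 4 * P ^ 2 * (2 * (u * P)) := by gcongr
        _ = 4 * (c * u) ^ 4 * P ^ 2 * (2 * (u * P)) * (r * (c * u)) := by rw [hrcu, mul_one]
        _ = _ := by ring
    · rw [hyX', div_le_iff₀ (by positivity)]
      have : (10 * d - 2 * r) ^ 2 ≤ (231124 / 100000 - 2 * r) ^ 2 := by gcongr; linarith
      calc c * r ^ 2 * (10 * d - 2 * r) ^ 2 / 25 * (13 / 18)
          ≤ 43268 / 10000 * r ^ 2 * (231124 / 100000 - 2 * r) ^ 2 / 25 * (13 / 18) := by gcongr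
        _ = r * (43268 / 10000 * r * (231124 / 100000 - 2 * r) ^ 2 / 25 * (13 / 18)) := by ring
        _ ≤ r * (2235 / 10000 * 2 * (1 - r) ^ 2) := by
            refine mul_le_mul_of_nonneg_left ?_ hr0.le
            nlinarith [mul_nonneg hr0.le (sub_nonneg.2 hr2), sq_nonneg (r - 1 / 2),
              mul_nonneg (mul_nonneg hr0.le hr0.le) (sub_nonneg.2 hr2),
              mul_nonneg hr0.le (sq_nonneg (r - 1 / 2))]
        _ = _ := by ring

end RelativeConstants

section InductiveStep

variable {𝔞 : Type*} {r y X : ℝ}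

theorem fullWeight_nonneg (h0 : 0 < r) (h1 : r ≤ 1 / 2) (i : ℕ) : 0 ≤ fullWeight r i := by
  have h2 : 0 < 1 - r := by linarith
  unfold fullWeight
  split_ifs with h
  · positivity
  · have : (1 : ℝ) ≤ i := by exact_mod_cast Nat.pos_of_ne_zero h
    have : (0 : ℝ) ≤ i - 1 := by linarith
    positivity

theorem RelativeConstants.linear_genus_zero_le (h : RelativeConstants r y X) {c i : ℕ}
    {l : List (𝔞 × ℕ)} (hl : l.length = c + 3) (hd : i + degree l ≤ c + 1) :
    (∑ m : Fin l.length, ((2 * ((l.get m).2 : ℝ) + 1) * linWeight r (i + (l.get m).2))) / y ≤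
      3 / (y * r * (1 - r)) * (c + 1 + 2 * r / 3) := by
  have h0 := h.r_pos
  have h2 : 0 < 1 - r := by linarith [h.r_le]
  have hy := h.y_pos
  have e : 3 / (y * r * (1 - r)) * (c + 1 + 2 * r / 3) =
      ((3 * ((c : ℝ) + 1) + 2 * r) / (r * (1 - r))) / y := by field_simp
  rw [e]
  refine div_le_div_of_nonneg_right ?_ hy.le
  have hd' : (i : ℝ) + degree l ≤ c + 1 := by exact_mod_cast hd
  have hl' : (l.length : ℝ) = c + 3 := by exact_mod_cast hl
  rcases Nat.eq_zero_or_pos i with rfl | hi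
  · refine (sum_linWeight_zero_le h0 h.r_le l).trans ?_
    refine div_le_div_of_nonneg_right ?_ (by positivity)
    rw [hl']
    simp only [Nat.cast_zero, zero_add] at hd'
    nlinarith [h.r_le]
  · refine (sum_linWeight_le h0 h.r_le i l).trans ?_
    refine div_le_div_of_nonneg_right ?_ (by positivity)
    have : (1 : ℝ) ≤ i := by exact_mod_cast hi
    rw [hl']
    linarith

theorem RelativeConstants.linear_genus_pos_le (h : RelativeConstants r y X) {g c i : ℕ}
    {l : List (𝔞 × ℕ)} (hl : 2 * g + l.length = c + 3) (hd : i + degree l + 2 ≤ 3 * g + l.length) :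
    (∑ m : Fin l.length, ((2 * ((l.get m).2 : ℝ) + 1) * linWeight r (i + (l.get m).2))) / y +
      y / X / 2 * fullWeight r i ≤
      3 / (y * r * (1 - r)) * (c + 5 / 3) + y / X * (13 / 18) / (1 - r) ^ 2 := by
  have h0 := h.r_pos
  have h1 := h.r_le
  have h2 : 0 < 1 - r := by linarith
  have hy := h.y_pos
  have hX := h.X_pos
  have hd' : (i : ℝ) + degree l + 2 ≤ 3 * g + l.length := by exact_mod_cast hd
  have hl' : 2 * (g : ℝ) + l.length = c + 3 := by exact_mod_cast hl
  set β := 3 / (y * r * (1 - r)) with hβ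
  have hlin : (∑ m : Fin l.length, ((2 * ((l.get m).2 : ℝ) + 1) * linWeight r (i + (l.get m).2))) / y ≤
      β * (c + 5 / 3) - 2 / 3 * β * i := by
    have e : β * (c + 5 / 3) - 2 / 3 * β * i =
        ((3 * (c : ℝ) + 5 - 2 * i) / (r * (1 - r))) / y := by rw [hβ]; field_simp
    rw [e]
    refine div_le_div_of_nonneg_right ?_ hy.le
    refine (sum_linWeight_le h0 h.r_le i l).trans ?_
    refine div_le_div_of_nonneg_right ?_ (by positivity)
    linarith
  rcases Nat.eq_zero_or_pos i with rfl | hi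
  · have : y / X / 2 * fullWeight r 0 = y / X * (13 / 18) / (1 - r) ^ 2 := by
      rw [fullWeight, if_pos rfl]; field_simp; norm_num
    rw [this]
    simp only [Nat.cast_zero, mul_zero, sub_zero] at hlin
    linarith
  · have hi' : (1 : ℝ) ≤ i := by exact_mod_cast hi
    have hw : y / X / 2 * fullWeight r i ≤ 2 / 3 * β * i := by
      rw [fullWeight, if_neg (by omega)]
      have hr1 : r / (1 - r) ≤ 1 := by rw [div_le_one h2]; linarith
      have hγ : y / X / 2 * (1 / (r ^ 2 * (1 - r))) ≤ 2 / 3 * β := by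
        rw [hβ, show y / X / 2 * (1 / (r ^ 2 * (1 - r))) = y / (2 * X * (r ^ 2 * (1 - r))) by
          field_simp, show 2 / 3 * (3 / (y * r * (1 - r))) = 2 / (y * r * (1 - r)) by ring,
          div_le_div_iff₀ (by positivity) (by positivity)]
        have := mul_le_mul_of_nonneg_right h.sq_le (by positivity : 0 ≤ r * (1 - r))
        linarith
      calc y / X / 2 * (((i : ℝ) - 1 + r / (1 - r)) / (r ^ 2 * (1 - r)))
          = y / X / 2 * (1 / (r ^ 2 * (1 - r))) * ((i : ℝ) - 1 + r / (1 - r)) := by ring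
        _ ≤ y / X / 2 * (1 / (r ^ 2 * (1 - r))) * i := by gcongr; linarith
        _ ≤ _ := by gcongr
    have : 0 ≤ y / X * (13 / 18) / (1 - r) ^ 2 := by positivity
    linarith

theorem RelativeConstants.step (h : RelativeConstants r y X) {g c i : ℕ}
    {l : List (𝔞 × ℕ)} (hl : 2 * g + l.length = c + 3) (hd : i + degree l + 2 ≤ 3 * g + l.length) :
    (∑ m : Fin l.length, ((2 * ((l.get m).2 : ℝ) + 1) * linWeight r (i + (l.get m).2))) / y *
        growth g l.length +
      y / X / 2 * (fullWeight r i * (if 0 < g then growth (g - 1) (l.length + 2) else 0)) +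
      1 / (2 * y ^ 2 * r ^ 2 * (1 - r)) *
        ((c + 1).factorial * genusFactor g (c + 2) * splitSum (c + 2)) ≤
      growth g (l.length + 1) := by
  have hc : (0 : ℝ) < c + 1 := by positivity
  have hfact : ((c + 1).factorial : ℝ) = (c + 1) * c.factorial := by
    rw [Nat.factorial_succ]; push_cast; ring
  have hc0 : (0 : ℝ) < c.factorial := by exact_mod_cast c.factorial_pos
  have hy := h.y_pos
  have hX := h.X_pos
  rw [growth_eq hl, growth_eq (g := g) (n := l.length + 1) (c := c + 1) (by omega)]
  rcases Nat.eq_zero_or_pos g with rfl | hg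
  · have := h.genus_zero c (h.linear_genus_zero_le (c := c) (i := i) (l := l) (by omega) (by omega))
    simp only [lt_irrefl, if_false, mul_zero, add_zero, genusFactor, if_true, mul_one]
    set L := (∑ m : Fin l.length, ((2 * ((l.get m).2 : ℝ) + 1) *
      linWeight r (i + (l.get m).2))) / y
    set ε := 1 / (2 * y ^ 2 * r ^ 2 * (1 - r))
    calc L * (c.factorial * decay (c + 1)) + ε * ((c + 1).factorial * splitSum (c + 2))
        = (c + 1).factorial * (L * decay (c + 1) / (c + 1) + ε * splitSum (c + 2)) := by
          rw [hfact]; field_simp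
      _ ≤ _ := by gcongr
  · have := h.genus_pos c (h.linear_genus_pos_le hl hd)
    have hfull := fullWeight_nonneg h.r_pos h.r_le i
    have hf : growth (g - 1) (l.length + 2) ≤ c.factorial * decay (c + 1) * genusRatio (c + 1) := by
      rw [growth_eq (c := c) (by omega)]
      have := decay_pos (c + 1)
      gcongr
      unfold genusFactor
      split_ifs
      exacts [one_le_genusRatio (by omega), le_rfl]
    have hgf : ∀ k, genusFactor g k = genusRatio k := fun k => by
      rw [genusFactor, if_neg hg.ne']
    rw [if_pos hg, hgf, hgf]
    set L := (∑ m : Fin l.length, ((2 * ((l.get m).2 : ℝ) + 1) *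
      linWeight r (i + (l.get m).2))) / y
    set ε := 1 / (2 * y ^ 2 * r ^ 2 * (1 - r))
    calc _ ≤ L * (c.factorial * decay (c + 1) * genusRatio (c + 1)) +
          y / X / 2 * (fullWeight r i * (c.factorial * decay (c + 1) * genusRatio (c + 1))) +
          ε * ((c + 1).factorial * genusRatio (c + 2) * splitSum (c + 2)) := by gcongr
      _ = (c + 1).factorial * ((L + y / X / 2 * fullWeight r i) *
          (genusRatio (c + 1) * decay (c + 1)) / (c + 1) +
          ε * (genusRatio (c + 2) * splitSum (c + 2))) := by
          rw [hfact]; field_simp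
      _ ≤ (c + 1).factorial * (genusRatio (c + 2) * decay (c + 2)) := by gcongr
      _ = _ := by ring

end InductiveStep

namespace AiryTensors.Bounds

variable {𝔞 : Type*} {T : AiryTensors (𝔞 × ℕ)} {M x ρ r y X : ℝ} [Fintype 𝔞]

/-- The bound of the amplitudes with indices of degree `0`; `N` is the number of ramification
points. -/
noncomputable def amplitudeBound (N : ℕ) (q ρ y X : ℝ) (g n : ℕ) : ℝ :=
  ρ ^ 5 / (N ^ 3 * q ^ 2 * y ^ 3) * (N ^ 3 * q ^ 2 * X / ρ ^ 5) ^ g * (N * q * y / ρ ^ 2) ^ n *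
    growth g n

theorem growth_zero_three : growth 0 3 = 1 := by
  simp [growth, decay_one, genusFactor]

theorem growth_one_one : growth 1 1 = 1 := by
  simp [growth, decay_one, genusFactor, genusRatio]; norm_num

theorem one_le_quadMax (hx : 0 ≤ x) : 1 ≤ quadMax x :=
  le_trans (by linarith) (one_add_four_le_quadMax x)

/-- The inductive bound of the amplitudes. -/
theorem norm_amplitude_le [Nonempty 𝔞] (hT : T.Bounds M x ρ) (hc : RelativeConstants r y X) (g : ℕ)
    (l : List (𝔞 × ℕ)) (h2 : 2 < 2 * g + l.length) :
    ‖T.amplitude g l‖ * weight l ≤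
      amplitudeBound (Fintype.card 𝔞) (M * quadMax x) ρ y X g l.length * (r * ρ) ^ degree l := by
  have hρ := hT.ρ_pos
  have hM := hT.M_pos
  have hx := hT.x_nonneg
  have hr := hc.r_pos
  have hr2 := hc.r_le
  have hr1 : 0 < 1 - r := by linarith
  have hy := hc.y_pos
  have hX := hc.X_pos
  have hQ1 := one_le_quadMax hx
  have hq : 0 < M * quadMax x := by positivity
  have hN1 : (1 : ℝ) ≤ Fintype.card 𝔞 := by exact_mod_cast Fintype.card_pos
  have hMq : M ≤ M * quadMax x := le_mul_of_one_le_right hM.le hQ1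
  have h4q : M * (1 + 4 * x) ≤ M * quadMax x :=
    mul_le_mul_of_nonneg_left (one_add_four_le_quadMax x) hM.le
  have hH : ∀ g n, 0 ≤ amplitudeBound (Fintype.card 𝔞) (M * quadMax x) ρ y X g n := by
    intro g n
    have := growth_nonneg g n
    unfold amplitudeBound
    positivity
  induction hs : 2 * g + l.length using Nat.strong_induction_on generalizing g l with
  | _ s ih =>
  by_cases hd : 3 * g + l.length < degree l + 3
  · rw [hT.amplitude_eq_zero g l h2 hd, norm_zero, zero_mul]
    exact mul_nonneg (hH _ _) (by positivity)
  rcases l with _ | ⟨α, l⟩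
  · have : T.amplitude g [] = 0 := by rw [AiryTensors.amplitude]
    rw [this, norm_zero, zero_mul]
    exact mul_nonneg (hH _ _) (by positivity)
  rw [List.length_cons] at h2 hs hd
  rcases Nat.lt_or_ge 2 (2 * g + l.length) with h3 | h3
  · refine (hT.norm_amplitude_le_of_forall hr hr2 hH g α l h3 (fun g' l' h h' =>
      ih _ (by omega) g' l' h rfl)).trans ?_
    rw [mul_comm (amplitudeBound _ _ _ _ _ _ _)]
    refine mul_le_mul_of_nonneg_left ?_ (by positivity)
    obtain ⟨c, hgl⟩ : ∃ c, 2 * g + l.length = c + 3 := ⟨2 * g + l.length - 3, by omega⟩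
    rw [degree_cons] at hd
    have hstep := hc.step hgl (i := α.2) (by omega)
    generalize M * quadMax x = q at hq hMq h4q hH ⊢
    generalize (Fintype.card 𝔞) = N at hN1 hH ⊢
    set K := ρ ^ 5 / ((N : ℝ) ^ 3 * q ^ 2 * y ^ 3) with hK
    set a := (N : ℝ) ^ 3 * q ^ 2 * X / ρ ^ 5 with ha
    set b := (N : ℝ) * q * y / ρ ^ 2 with hb
    have hK0 : 0 < K := by positivity
    have ha0 : 0 < a := by positivity
    have hb0 : 0 < b := by positivity
    have hAB : amplitudeBound N q ρ y X = fun g n => K * a ^ g * b ^ n * growth g n := rfl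
    rw [hAB, List.length_cons]
    beta_reduce
    have hprod := sum_prodTerm_le (K := K) hgl hr hr2 ha0.le hb0.le
    set Lsum := ∑ m : Fin l.length, ((2 * ((l.get m).2 : ℝ) + 1) * linWeight r (α.2 + (l.get m).2))
    set prodSum := ∑ g₁ ∈ Finset.range (g + 1), ∑ n₁ ∈ Finset.range (l.length + 1), (l.length.choose n₁ : ℝ) *
      prodTerm r (fun g n => K * a ^ g * b ^ n * growth g n) g l.length g₁ n₁
    set R := ((c + 1).factorial : ℝ) * genusFactor g (c + 2) * splitSum (c + 2)
    have e1 : (N : ℝ) * (q / ρ ^ 2) = b / y := by rw [hb]; field_simp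
    have e2 : 1 / 2 * ((N : ℝ) ^ 2 * (q / ρ ^ 3)) * b = a * (y / X / 2) := by
      rw [hb, ha]; field_simp
    have e3 : 1 / 2 * ((N : ℝ) ^ 2 * (q / ρ ^ 3)) * (K * b) = 1 / (2 * y ^ 2) := by
      rw [hb, hK]; field_simp
    have t2 : 1 / 2 * ((N : ℝ) ^ 2 * (q / ρ ^ 3)) * (fullWeight r α.2 *
        (if 0 < g then K * a ^ (g - 1) * b ^ (l.length + 2) * growth (g - 1) (l.length + 2) else 0)) =
        K * a ^ g * b ^ (l.length + 1) * (y / X / 2 * (fullWeight r α.2 *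
          (if 0 < g then growth (g - 1) (l.length + 2) else 0))) := by
      split_ifs with hg
      · obtain ⟨g', rfl⟩ := Nat.exists_eq_add_of_le' hg
        rw [show g' + 1 - 1 = g' by omega]
        calc _ = (1 / 2 * ((N : ℝ) ^ 2 * (q / ρ ^ 3)) * b) * (K * a ^ g' * b ^ (l.length + 1) *
              (fullWeight r α.2 * growth g' (l.length + 2))) := by ring
          _ = _ := by rw [e2]; ring
      · simp
    have t3 : 1 / 2 * ((N : ℝ) ^ 2 * (q / ρ ^ 3)) * (K ^ 2 * a ^ g * b ^ (l.length + 2) /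
        (r ^ 2 * (1 - r)) * R) =
        K * a ^ g * b ^ (l.length + 1) * (1 / (2 * y ^ 2 * r ^ 2 * (1 - r)) * R) := by
      calc _ = 1 / 2 * ((N : ℝ) ^ 2 * (q / ρ ^ 3)) * (K * b) * (K * a ^ g * b ^ (l.length + 1) *
            (1 / (r ^ 2 * (1 - r))) * R) := by ring
        _ = _ := by rw [e3]; field_simp
    have hpos : 0 ≤ 1 / 2 * ((N : ℝ) ^ 2 * (q / ρ ^ 3)) := by positivity
    have hprod' := mul_le_mul_of_nonneg_left hprod hpos
    rw [t3] at hprod'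
    have hstep' := mul_le_mul_of_nonneg_left hstep
      (by positivity : 0 ≤ K * a ^ g * b ^ (l.length + 1))
    calc _ = K * a ^ g * b ^ (l.length + 1) * (Lsum / y * growth g l.length) +
          1 / 2 * ((N : ℝ) ^ 2 * (q / ρ ^ 3)) * (fullWeight r α.2 *
            (if 0 < g then K * a ^ (g - 1) * b ^ (l.length + 2) * growth (g - 1) (l.length + 2) else 0)) +
          1 / 2 * ((N : ℝ) ^ 2 * (q / ρ ^ 3)) * prodSum := by rw [e1]; ring
      _ ≤ _ := by rw [t2]; linarith
  · have hcases : (g = 0 ∧ l.length = 2) ∨ (g = 1 ∧ l.length = 0) := by omega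
    rcases hcases with ⟨rfl, hl⟩ | ⟨rfl, hl⟩
    · obtain ⟨β, γ, rfl⟩ := List.length_eq_two.1 hl
      rw [AiryTensors.amplitude]
      have hA := hT.A_le α β γ
      split_ifs at hA with h0
      · have hw : weight [α, β, γ] = 1 := by
          simp [weight, oddFact, h0.1, h0.2.1, h0.2.2]
        have hdeg : degree [α, β, γ] = 0 := by simp [degree, h0.1, h0.2.1, h0.2.2]
        rw [hw, hdeg, mul_one, pow_zero, mul_one]
        refine hA.trans ?_
        rw [amplitudeBound, show [α, β, γ].length = 3 from rfl, growth_zero_three]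
        calc M / ρ ≤ (M * quadMax x) / ρ := by gcongr
          _ = _ := by
            generalize M * quadMax x = q at *
            generalize (Fintype.card 𝔞 : ℝ) = N at *
            field_simp
      · have : ‖T.A α β γ‖ = 0 := le_antisymm hA (norm_nonneg _)
        rw [this, zero_mul]
        exact mul_nonneg (hH _ _) (by positivity)
    · obtain rfl := List.length_eq_zero_iff.1 hl
      rw [AiryTensors.amplitude, show weight [α] = oddFact α.2 by simp [weight],
        show degree [α] = α.2 by simp [degree], show [α].length = 1 from rfl, amplitudeBound,
        growth_one_one]
      refine (hT.D_le α).trans ?_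
      have hsq := hc.sq_le
      have e : ρ ^ 5 / ((Fintype.card 𝔞 : ℝ) ^ 3 * (M * quadMax x) ^ 2 * y ^ 3) *
          ((Fintype.card 𝔞 : ℝ) ^ 3 * (M * quadMax x) ^ 2 * X / ρ ^ 5) ^ 1 *
          ((Fintype.card 𝔞 : ℝ) * (M * quadMax x) * y / ρ ^ 2) ^ 1 * 1 =
          (Fintype.card 𝔞 : ℝ) * (M * quadMax x / ρ ^ 2 * (X / y ^ 2)) := by
        generalize M * quadMax x = q at *
        generalize (Fintype.card 𝔞 : ℝ) = N at *
        field_simp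
      rw [e]
      have hXy : 1 / (4 * r) ≤ X / y ^ 2 := by
        rw [div_le_div_iff₀ (by positivity) (by positivity)]; linarith
      have hge : M * quadMax x / ρ ^ 2 * (1 / (4 * r)) ≤
          (Fintype.card 𝔞 : ℝ) * (M * quadMax x / ρ ^ 2 * (X / y ^ 2)) := by
        refine le_trans ?_ (le_mul_of_one_le_left (by positivity) hN1)
        gcongr
      refine le_trans ?_ (mul_le_mul_of_nonneg_right hge (by positivity))
      split_ifs with h0 h1
      · rw [h0, pow_zero, mul_one, div_mul_div_comm, mul_one]
        have h4r : 4 * r ≤ 8 := by linarith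
        calc M * (1 + 4 * x) / (8 * ρ ^ 2) ≤ M * quadMax x / (ρ ^ 2 * 8) := by
              rw [mul_comm (8 : ℝ)]; gcongr; 
          _ ≤ _ := by gcongr
      · rw [h1, pow_one]
        calc M / (8 * ρ) ≤ M * quadMax x / (4 * ρ) := by gcongr; norm_num
          _ = _ := by field_simp
      · positivity

end AiryTensors.Bounds

section GrowthBounds

theorem pow_mul_factorial_le (k j : ℕ) :
    (27 / 4 : ℝ) ^ k * (k.factorial * (2 * k + j).factorial) ≤ (3 * k + 1 + j).factorial := by
  induction j with
  | zero =>
    simp only [add_zero]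
    induction k with
    | zero => simp
    | succ k ih =>
      have e1 : ((2 * (k + 1)).factorial : ℝ) = (2 * k + 2) * (2 * k + 1) * (2 * k).factorial := by
        rw [show 2 * (k + 1) = 2 * k + 1 + 1 by ring, Nat.factorial_succ, Nat.factorial_succ]
        push_cast; ring
      have e2 : ((3 * (k + 1) + 1).factorial : ℝ) =
          (3 * k + 4) * (3 * k + 3) * (3 * k + 2) * (3 * k + 1).factorial := by
        rw [show 3 * (k + 1) + 1 = 3 * k + 1 + 1 + 1 + 1 by ring, Nat.factorial_succ,
          Nat.factorial_succ, Nat.factorial_succ]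
        push_cast; ring
      rw [e1, e2, Nat.factorial_succ]
      push_cast
      have hk : (0 : ℝ) ≤ k := Nat.cast_nonneg k
      calc (27 / 4 : ℝ) ^ (k + 1) * ((k + 1) * k.factorial *
            ((2 * k + 2) * (2 * k + 1) * (2 * k).factorial))
          = (27 / 4 * ((k + 1) * ((2 * k + 2) * (2 * k + 1)))) *
            ((27 / 4 : ℝ) ^ k * (k.factorial * (2 * k).factorial)) := by ring
        _ ≤ ((3 * k + 4) * (3 * k + 3) * (3 * k + 2)) * (3 * k + 1).factorial := by
            refine mul_le_mul ?_ ih (by positivity) (by positivity)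
            nlinarith [mul_nonneg hk hk]
  | succ j ih =>
    rw [← add_assoc, ← add_assoc, Nat.factorial_succ, Nat.factorial_succ]
    push_cast
    calc (27 / 4 : ℝ) ^ k * (k.factorial * ((2 * k + j + 1) * (2 * k + j).factorial))
        = (2 * k + j + 1) * ((27 / 4 : ℝ) ^ k * (k.factorial * (2 * k + j).factorial)) := by ring
      _ ≤ (3 * k + 1 + j + 1) * (3 * k + 1 + j).factorial := by
          refine mul_le_mul ?_ ih (by positivity) (by positivity)
          have hk : (0 : ℝ) ≤ k := Nat.cast_nonneg k
          linarith

theorem decay_mul_genusRatio_le (k : ℕ) : decay (k + 1) * genusRatio (k + 1) ≤ 180 / (k + 1) := by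
  have hk : (0 : ℝ) ≤ k := Nat.cast_nonneg k
  refine (mul_le_mul_of_nonneg_right (decay_le _) (genusRatio_nonneg _)).trans ?_
  rw [genusRatio, div_mul_div_comm, div_le_div_iff₀ (by positivity) (by positivity)]
  push_cast
  nlinarith [mul_nonneg hk hk]

theorem growth_mul_pow_le {g n : ℕ} (hn : 0 < n) (h : 2 < 2 * g + n) :
    growth g n * (27 / 4) ^ g ≤ 1215 * ((3 * g + n - 3).factorial / g.factorial) := by
  rcases g with _ | k
  · obtain ⟨j, rfl⟩ : ∃ j, n = j + 3 := ⟨n - 3, by omega⟩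
    rw [growth_eq (c := j) (by omega), genusFactor, if_pos rfl]
    simp only [mul_zero, zero_add, Nat.add_sub_cancel, Nat.factorial_zero, Nat.cast_one, div_one,
      pow_zero, mul_one]
    have h1 : decay (j + 1) ≤ 1215 := by
      refine (decay_le _).trans ?_
      rw [div_le_iff₀ (by positivity)]
      have : (0 : ℝ) ≤ ((j + 1 : ℕ) : ℝ) := Nat.cast_nonneg _
      linarith
    rw [mul_comm]
    gcongr
  · obtain ⟨j, rfl⟩ : ∃ j, n = j + 1 := ⟨n - 1, by omega⟩
    rw [growth_eq (c := 2 * k + j) (by omega), genusFactor, if_neg (by omega),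
      show 3 * (k + 1) + (j + 1) - 3 = 3 * k + 1 + j by omega, Nat.factorial_succ k]
    have h1 := decay_mul_genusRatio_le (2 * k + j)
    have h2 := pow_mul_factorial_le k j
    push_cast at h1 ⊢
    rw [mul_div_assoc', le_div_iff₀ (by positivity)]
    have hk : (0 : ℝ) ≤ k := Nat.cast_nonneg k
    have hj : (0 : ℝ) ≤ j := Nat.cast_nonneg j
    have h3 : (180 : ℝ) / (2 * k + j + 1) * (k + 1) ≤ 180 := by
      rw [div_mul_eq_mul_div, div_le_iff₀ (by positivity)]
      linarith
    calc ((2 * k + j).factorial : ℝ) * decay (2 * k + j + 1) * genusRatio (2 * k + j + 1) *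
          (27 / 4) ^ (k + 1) * ((k + 1) * k.factorial)
        = (decay (2 * k + j + 1) * genusRatio (2 * k + j + 1)) * (k + 1) *
          (27 / 4 * ((27 / 4) ^ k * (k.factorial * (2 * k + j).factorial))) := by ring
      _ ≤ (180 / (2 * k + j + 1)) * (k + 1) *
          (27 / 4 * ((27 / 4) ^ k * (k.factorial * (2 * k + j).factorial))) := by gcongr
      _ ≤ 180 * (27 / 4 * (3 * k + 1 + j).factorial) := by gcongr
      _ = _ := by ring

theorem growth_le (g n : ℕ) : growth g n ≤ 36 / 5 * (2 * g + n - 3).factorial := by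
  have h1 : decay (2 * g + n - 2) ≤ 6 / 5 := by
    refine (decay_le _).trans ?_
    have : (0 : ℝ) ≤ ((2 * g + n - 2 : ℕ) : ℝ) := Nat.cast_nonneg _
    rw [div_le_div_iff₀ (by positivity) (by norm_num)]
    linarith
  have h2 : genusFactor g (2 * g + n - 2) ≤ 6 := by
    unfold genusFactor genusRatio
    split_ifs
    · norm_num
    · rw [div_le_iff₀ (by positivity)]; linarith
  have := genusFactor_nonneg g (2 * g + n - 2)
  calc growth g n ≤ (2 * g + n - 3).factorial * (6 / 5) * 6 := by
        unfold growth; gcongr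
    _ = _ := by ring

end GrowthBounds

section Constants

theorem constP_pos {u : ℝ} (hu : 0 < u) : 0 < constP u := by
  unfold constP
  split_ifs with h
  · positivity
  · exact div_pos (by norm_num) (by linarith)

theorem rpow_mul_constU (ρ : ℝ) : (3 : ℝ) ^ (4 / 3 : ℝ) * constU ρ = ρ := by
  rw [constU, ← mul_assoc, ← Real.rpow_add (by norm_num)]
  norm_num

theorem constU_pos {ρ : ℝ} (hρ : 0 < ρ) : 0 < constU ρ := by unfold constU; positivity

theorem constQ_eq (Mθ Mφ ρ : ℝ) : constQ Mθ Mφ ρ = 2 * (Mθ * quadMax (ρ * Mφ)) := by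
  rw [constQ, quadMax, mul_assoc 4, mul_assoc 2]

theorem constQ_pos {Mθ Mφ ρ : ℝ} (hM : 0 < Mθ) (hφ : 0 ≤ Mφ) (hρ : 0 < ρ) :
    0 < constQ Mθ Mφ ρ := by
  have := AiryTensors.Bounds.one_le_quadMax (mul_nonneg hρ.le hφ)
  rw [constQ_eq]
  positivity

theorem constA_pos {N : ℕ} {Mθ Mφ ρ : ℝ} (hN : 0 < N) (hM : 0 < Mθ) (hφ : 0 ≤ Mφ) (hρ : 0 < ρ) :
    0 < constA N Mθ Mφ ρ := by
  have := constQ_pos hM hφ hρ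
  have := constU_pos hρ
  have := constP_pos this
  unfold constA
  positivity

/-- The inductive bound in terms of the constants `Q`, `u`, `P(u)`. -/
theorem amplitudeBound_eq {N : ℕ} (hN : 0 < N) {q ρ u P : ℝ} (hq : 0 < q) (hρ : 0 < ρ) (hP : 0 < P)
    {g n : ℕ} (h : 2 < 2 * g + n) :
    AiryTensors.Bounds.amplitudeBound N q ρ (2 * ρ ^ 2 * P) (2 * u * ρ ^ 5 * P ^ 3) g n =
      1 / (2 * ρ) * (u / 2) ^ g * (2 * q) ^ (2 * g + n - 2) * (N * P) ^ (3 * g + n - 3) *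
        growth g n := by
  have hN' : (0 : ℝ) < N := by exact_mod_cast hN
  have e1 : (2 * q) ^ (2 * g + n - 2) * (2 * q) ^ 2 = ((2 * q) ^ 2) ^ g * (2 * q) ^ n := by
    rw [← pow_add, ← pow_mul, ← pow_add]; congr 1; omega
  have e2 : ((N : ℝ) * P) ^ (3 * g + n - 3) * ((N : ℝ) * P) ^ 3 =
      (((N : ℝ) * P) ^ 3) ^ g * ((N : ℝ) * P) ^ n := by
    rw [← pow_add, ← pow_mul, ← pow_add]; congr 1; omega
  rw [AiryTensors.Bounds.amplitudeBound]
  congr 1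
  have hpos : 0 < (2 * q) ^ 2 * ((N : ℝ) * P) ^ 3 := by positivity
  refine mul_right_cancel₀ hpos.ne' ?_
  calc _ = ρ ^ 5 / ((N : ℝ) ^ 3 * q ^ 2 * (2 * ρ ^ 2 * P) ^ 3) * ((2 * q) ^ 2 * ((N : ℝ) * P) ^ 3) *
        ((N : ℝ) ^ 3 * q ^ 2 * (2 * u * ρ ^ 5 * P ^ 3) / ρ ^ 5) ^ g *
        ((N : ℝ) * q * (2 * ρ ^ 2 * P) / ρ ^ 2) ^ n := by ring
    _ = 1 / (2 * ρ) * (u / 2 * ((2 * q) ^ 2 * ((N : ℝ) * P) ^ 3)) ^ g * (2 * q * ((N : ℝ) * P)) ^ n := by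
        congr 1
        · congr 1
          · field_simp
          · congr 1; field_simp
        · congr 1; field_simp
    _ = 1 / (2 * ρ) * (u / 2) ^ g * (((2 * q) ^ 2) ^ g * (2 * q) ^ n) *
        ((((N : ℝ) * P) ^ 3) ^ g * ((N : ℝ) * P) ^ n) := by
        rw [mul_pow, mul_pow, mul_pow (2 * q)]; ring
    _ = _ := by rw [← e1, ← e2]; ring

/-- The function `S(u)`. -/
noncomputable def constS (u : ℝ) : ℝ := 1215 / (2 * ((3 : ℝ) ^ (4 / 3 : ℝ) * u))

/-- The function `S_n(u)`. -/
noncomputable def constSn (n : ℕ) (u : ℝ) : ℝ :=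
  1 / (2 * ((3 : ℝ) ^ (4 / 3 : ℝ) * u)) * (36 / 5) * ((u / 2) / (√(u / 2) ^ n * √(constP u) ^ n))

theorem constS_pos {u : ℝ} (hu : 0 < u) : 0 < constS u := by unfold constS; positivity

theorem constSn_pos (n : ℕ) {u : ℝ} (hu : 0 < u) : 0 < constSn n u := by
  have := constP_pos hu
  unfold constSn
  positivity

theorem pow_le_sqrt_pow {N : ℕ} (hN : 0 < N) {u P : ℝ} (hu : 0 < u) (hP : 0 < P) {g n : ℕ}
    (h : 2 < 2 * g + n) :
    (u / 2) ^ g * (N * P) ^ (3 * g + n - 3) ≤ (u / 2) / (√(u / 2) ^ n * √P ^ n) *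
      (√(u / 2) * (N * P) ^ (3 / 2 : ℝ)) ^ (2 * g + n - 2) := by
  have hN1 : (1 : ℝ) ≤ N := by exact_mod_cast hN
  have hNP : 0 < (N : ℝ) * P := by positivity
  set s := √(u / 2) with hs
  have hs0 : 0 < s := Real.sqrt_pos.2 (by positivity)
  have hs2 : u / 2 = s ^ 2 := (Real.sq_sqrt (by positivity)).symm
  set w := √((N : ℝ) * P) with hw
  have hw0 : 0 < w := Real.sqrt_pos.2 hNP
  have hw2 : (N : ℝ) * P = w ^ 2 := (Real.sq_sqrt hNP.le).symm
  have hw3 : ((N : ℝ) * P) ^ (3 / 2 : ℝ) = w ^ 3 := by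
    rw [hw, Real.sqrt_eq_rpow, ← Real.rpow_natCast, ← Real.rpow_mul hNP.le]
    norm_num
  have hle : √P ≤ w := Real.sqrt_le_sqrt (le_mul_of_one_le_left hP.le hN1)
  have hP0 : 0 < √P := Real.sqrt_pos.2 hP
  rw [hw3, hw2, hs2, div_mul_eq_mul_div, le_div_iff₀ (by positivity)]
  calc (s ^ 2) ^ g * (w ^ 2) ^ (3 * g + n - 3) * (s ^ n * √P ^ n)
      ≤ (s ^ 2) ^ g * (w ^ 2) ^ (3 * g + n - 3) * (s ^ n * w ^ n) := by gcongr
    _ = s ^ (2 * g + n) * w ^ (2 * (3 * g + n - 3) + n) := by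
        rw [← pow_mul, ← pow_mul, pow_add, pow_add]; ring
    _ = s ^ (2 + (2 * g + n - 2)) * w ^ (3 * (2 * g + n - 2)) := by
        congr 2 <;> omega
    _ = _ := by rw [mul_pow, ← pow_mul, pow_add]; ring

end Constants

theorem weight_ofFn {𝔞 : Type*} {n : ℕ} (α : Fin n → 𝔞 × ℕ) :
    weight (List.ofFn α) = ∏ i, ((2 * (α i).2 + 1).doubleFactorial : ℝ) := by
  rw [weight, List.map_ofFn, List.prod_ofFn]
  rfl

theorem Gamma_eq_factorial {g n : ℕ} (h : 2 < 2 * g + n) :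
    Real.Gamma (2 * (g : ℝ) - 2 + n) = (2 * g + n - 3).factorial := by
  obtain ⟨c, hc⟩ : ∃ c, 2 * g + n = c + 3 := ⟨2 * g + n - 3, by omega⟩
  have hc' : 2 * (g : ℝ) + n = c + 3 := by exact_mod_cast hc
  rw [show 2 * g + n - 3 = c by omega, ← Real.Gamma_nat_eq_factorial]
  congr 1
  linarith

namespace LocalSpectralCurve

variable {𝔞 : Type*} [Finite 𝔞] [Nonempty 𝔞] {L : LocalSpectralCurve 𝔞} {Mt ρt Mθ Mφ ρ : ℝ}

theorem BoundedBy.norm_amplitude_le (hL : L.BoundedBy Mt ρt Mθ Mφ ρ) {g n : ℕ}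
    (h : 2 < 2 * g + n) (α : Fin n → 𝔞 × ℕ) :
    ‖L.amplitude g α‖ * ∏ i, ((2 * (α i).2 + 1).doubleFactorial : ℝ) ≤
      1 / (2 * ρ) * (constU ρ / 2) ^ g * constQ Mθ Mφ ρ ^ (2 * g + n - 2) *
        ((Nat.card 𝔞 : ℝ) * constP (constU ρ)) ^ (3 * g + n - 3) * growth g n := by
  have := Fintype.ofFinite 𝔞
  have hρ := hL.ρ_pos
  have hu := constU_pos hρ
  have hP := constP_pos hu
  have hT := hL.tensorBounds
  obtain ⟨r, hr, hrel⟩ := exists_relativeConstants (c := (3 : ℝ) ^ (4 / 3 : ℝ)) (by positivity)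
    (by rw [← Real.rpow_natCast, ← Real.rpow_mul (by norm_num)]; norm_num) hu
  rw [rpow_mul_constU] at hr hrel
  have hq : 0 < Mθ * quadMax (ρ * Mφ) := mul_pos hT.M_pos
    (zero_lt_one.trans_le (AiryTensors.Bounds.one_le_quadMax hT.x_nonneg))
  have hlen : (List.ofFn α).length = n := List.length_ofFn
  have key := hT.norm_amplitude_le hrel g (List.ofFn α) (by rw [hlen]; exact h)
  rw [weight_ofFn, hlen, amplitudeBound_eq Fintype.card_pos hq hρ hP h, ← constQ_eq,
    ← Nat.card_eq_fintype_card] at key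
  refine key.trans (mul_le_of_le_one_right ?_ (pow_le_one₀ (mul_nonneg hrel.r_pos.le hρ.le) hr))
  have := growth_nonneg g n
  have := constQ_pos hL.Mθ_pos hL.Mφ_nonneg hρ
  positivity

theorem BoundedBy.norm_amplitude_le_factorial (hL : L.BoundedBy Mt ρt Mθ Mφ ρ) {g n : ℕ}
    (hn : 0 < n) (h : 2 < 2 * g + n) (α : Fin n → 𝔞 × ℕ) :
    ‖L.amplitude g α‖ * ∏ i, ((2 * (α i).2 + 1).doubleFactorial : ℝ) ≤
      constS (constU ρ) * (2 * constU ρ / 27) ^ g * constQ Mθ Mφ ρ ^ (2 * g + n - 2) *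
        ((Nat.card 𝔞 : ℝ) * constP (constU ρ)) ^ (3 * g + n - 3) *
        ((3 * g + n - 3).factorial / g.factorial) := by
  have hρ := hL.ρ_pos
  have hu := constU_pos hρ
  have hP := constP_pos hu
  have hQ := constQ_pos hL.Mθ_pos hL.Mφ_nonneg hρ
  refine (hL.norm_amplitude_le h α).trans ?_
  rw [constS, rpow_mul_constU]
  have e : (constU ρ / 2) ^ g = (2 * constU ρ / 27) ^ g * (27 / 4) ^ g := by
    rw [← mul_pow]; congr 1; ring
  rw [e]
  calc _ = 1 / (2 * ρ) * (2 * constU ρ / 27) ^ g * constQ Mθ Mφ ρ ^ (2 * g + n - 2) *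
        ((Nat.card 𝔞 : ℝ) * constP (constU ρ)) ^ (3 * g + n - 3) * (growth g n * (27 / 4) ^ g) := by
        ring
    _ ≤ 1 / (2 * ρ) * (2 * constU ρ / 27) ^ g * constQ Mθ Mφ ρ ^ (2 * g + n - 2) *
        ((Nat.card 𝔞 : ℝ) * constP (constU ρ)) ^ (3 * g + n - 3) *
        (1215 * ((3 * g + n - 3).factorial / g.factorial)) :=
        mul_le_mul_of_nonneg_left (growth_mul_pow_le hn h) (by positivity)
    _ = _ := by ring

theorem BoundedBy.norm_amplitude_le_Gamma (hL : L.BoundedBy Mt ρt Mθ Mφ ρ) {g n : ℕ}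
    (h : 2 < 2 * g + n) (α : Fin n → 𝔞 × ℕ) :
    ‖L.amplitude g α‖ * ∏ i, ((2 * (α i).2 + 1).doubleFactorial : ℝ) ≤
      constSn n (constU ρ) * (Real.Gamma (2 * (g : ℝ) - 2 + n) /
        constA (Nat.card 𝔞) Mθ Mφ ρ ^ (2 * g + n - 2)) := by
  have hρ := hL.ρ_pos
  have hu := constU_pos hρ
  have hP := constP_pos hu
  have hQ := constQ_pos hL.Mθ_pos hL.Mφ_nonneg hρ
  refine (hL.norm_amplitude_le h α).trans ?_
  rw [constSn, rpow_mul_constU, Gamma_eq_factorial h, constA, inv_pow, div_inv_eq_mul]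
  set Q := constQ Mθ Mφ ρ
  set u := constU ρ
  set N := Nat.card 𝔞
  have h1 := pow_le_sqrt_pow (N := N) Nat.card_pos hu hP h
  have h2 := growth_le g n
  set Y := (√(u / 2) * ((N : ℝ) * constP u) ^ (3 / 2 : ℝ)) ^ (2 * g + n - 2) with hY
  calc _ = 1 / (2 * ρ) * Q ^ (2 * g + n - 2) *
        ((u / 2) ^ g * ((N : ℝ) * constP u) ^ (3 * g + n - 3)) * growth g n := by ring
    _ ≤ 1 / (2 * ρ) * Q ^ (2 * g + n - 2) * ((u / 2) / (√(u / 2) ^ n * √(constP u) ^ n) * Y) *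
        (36 / 5 * (2 * g + n - 3).factorial) := by
        gcongr
        exact growth_nonneg g n
    _ = _ := by rw [mul_assoc Q, mul_pow Q, ← hY]; ring

end LocalSpectralCurve

theorem mainTheorem2 :
    ∃ (S : ℝ → ℝ) (Sn : ℕ → ℝ → ℝ),
      (∀ u, 0 < u → 0 < S u) ∧ (∀ n u, 0 < u → 0 < Sn n u) ∧
      -- local spectral curves
      (∀ (𝔞 : Type*) [Finite 𝔞] [Nonempty 𝔞] (L : LocalSpectralCurve 𝔞) (Mt ρt Mθ Mφ ρ : ℝ),
        L.BoundedBy Mt ρt Mθ Mφ ρ →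
        0 < constA (Nat.card 𝔞) Mθ Mφ ρ ∧
        ∀ (g n : ℕ), 0 < n → 2 < 2 * g + n → ∀ α : Fin n → 𝔞 × ℕ,
          ‖L.amplitude g α‖ * ∏ i, ((2 * (α i).2 + 1).doubleFactorial : ℝ) ≤
            S (constU ρ) * (2 * constU ρ / 27) ^ g * constQ Mθ Mφ ρ ^ (2 * g + n - 2) *
              ((Nat.card 𝔞 : ℝ) * constP (constU ρ)) ^ (3 * g + n - 3) *
              ((3 * g + n - 3).factorial / g.factorial) ∧
          ‖L.amplitude g α‖ * ∏ i, ((2 * (α i).2 + 1).doubleFactorial : ℝ) ≤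
            Sn n (constU ρ) * (Real.Gamma (2 * (g : ℝ) - 2 + n) /
              constA (Nat.card 𝔞) Mθ Mφ ρ ^ (2 * g + n - 2))) ∧
      -- spectral curves
      (∀ (X : Type*) [TopologicalSpace X] [ChartedSpace ℂ X]
        [IsManifold (modelWithCornersSelf ℂ ℂ) ⊤ X] (C : SpectralCurve X) (c : C.Coordinates)
        (Mt ρt Mθ Mφ ρ : ℝ),
        C.ramification.Nonempty → c.toLocal.BoundedBy Mt ρt Mθ Mφ ρ →
        0 < constA C.ramification.ncard Mθ Mφ ρ ∧
        ∀ (g n : ℕ), 0 < n → 2 < 2 * g + n → ∀ α : Fin n → C.ramification × ℕ,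
          ‖c.toLocal.amplitude g α‖ * ∏ i, ((2 * (α i).2 + 1).doubleFactorial : ℝ) ≤
            S (constU ρ) * (2 * constU ρ / 27) ^ g * constQ Mθ Mφ ρ ^ (2 * g + n - 2) *
              ((C.ramification.ncard : ℝ) * constP (constU ρ)) ^ (3 * g + n - 3) *
              ((3 * g + n - 3).factorial / g.factorial) ∧
          ‖c.toLocal.amplitude g α‖ * ∏ i, ((2 * (α i).2 + 1).doubleFactorial : ℝ) ≤
            Sn n (constU ρ) * (Real.Gamma (2 * (g : ℝ) - 2 + n) /
              constA C.ramification.ncard Mθ Mφ ρ ^ (2 * g + n - 2))) := by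
  refine ⟨constS, constSn, fun u hu => constS_pos hu, fun n u hu => constSn_pos n hu, ?_, ?_⟩
  · intro 𝔞 _ _ L Mt ρt Mθ Mφ ρ hL
    exact ⟨constA_pos Nat.card_pos hL.Mθ_pos hL.Mφ_nonneg hL.ρ_pos, fun g n hn h α =>
      ⟨hL.norm_amplitude_le_factorial hn h α, hL.norm_amplitude_le_Gamma h α⟩⟩
  · intro X _ _ _ C c Mt ρt Mθ Mφ ρ hne hL
    have : Finite C.ramification := C.finite_zeros
    have : Nonempty C.ramification := hne.to_subtype
    rw [← Nat.card_coe_set_eq]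
    exact ⟨constA_pos Nat.card_pos hL.Mθ_pos hL.Mφ_nonneg hL.ρ_pos, fun g n hn h α =>
      ⟨hL.norm_amplitude_le_factorial hn h α, hL.norm_amplitude_le_Gamma h α⟩⟩
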